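/- **Setting.** Let $\mathcal S,\mathcal A$ be finite, $A=|\mathcal A|$, and consider a discounted MDP with transition kernel $P$, rewards $r:\mathcal S\times\mathcal A\to[0,1]$, discount factor $\gamma\in[0,1)$ and initial distribution $\rho$. For a policy $\pi\in(\Delta_{\mathcal A})^{\mathcal S}$ and a start distribution $\nu$ let $Q^\pi$, $V^\pi_\nu$ and $d^\pi_\nu=(1-\gamma)\sum_t\gamma^t\,\mathbb P(s_t=\cdot\mid s_0\sim\nu,\pi)$ be the usual value functions and discounted state distribution; $V^\pi=V^\pi_\rho$, $d^\pi=d^\pi_\rho$. Let $\pi^*$ be an optimal policy, $V^*=V^{\pi^*}$. For a nonempty policy class $\Pi$ with convex hull $\mathrm{CH}(\Pi)$ and a restart distribution $\mu$ put $$D_\infty^\mu=\max_s\frac{d^{\pi^*}(s)}{\mu(s)},\qquad \epsilon_{\Pi,\mu}=\sup_{\pi\in\mathrm{CH}(\Pi)}\inf_{\pi'\in\Pi}\mathbb E_{s\sim d^\pi_\mu}\Big[\max_aQ^\pi(s,a)-Q^\pi(s,\cdot)^\top\pi'(s)\Big].$$ $|\Pi_\varepsilon|$ is the least number of points of an $\varepsilon$-cover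 of $\Pi$ in the norm $\|\pi\|_{\infty,1}=\max_s\sum_a|\pi(a|s)|$. An ERM oracle for $\Pi$ with tolerance $\varepsilon_{\rm ERM}$ maps every finite dataset $\{(s_i,l_i)\}$, $s_i\in\mathcal S$, $l_i\in\mathbb R^{\mathcal A}$, to some $\pi\in\Pi$ with $\sum_il_i^\top\pi(s_i)\ge\sup_{\pi'\in\Pi}\sum_il_i^\top\pi'(s_i)-\varepsilon_{\rm ERM}\sum_i\|l_i\|_\infty$. **Samplers.** Let $g_1,g_2,g_3$ be independent with $\mathbb P(g_i=n)=(1-\gamma)\gamma^n$, $n\ge0$. *Q-sampler* $(\pi,\mu)$: from $s_0\sim\mu$ follow $\pi$ for $g_1$ steps to a state $s$, play a uniformly random action $a$ in $s$, then from the pair $(s,a)$ follow $\pi$ for $g_2$ further steps to a pair $(\bar s,\bar a)$ (equal to $(s,a)$ if $g_2=0$); return $s$ and $\widehat Q=\frac{A\,r(\bar s,\bar a)}{1-\gamma}e_a\in\mathbb R^{\mathcal A}$. *H-sampler* $(\pi,\mu)$: from $s_0\sim\mu$ follow $\pi$ for $g_1$ steps to $s'$, play a uniformly random $a'$ and move to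 the next state, follow $\pi$ for $g_2$ steps to $s''$, play a uniformly random $a''$ in $s''$, then from the pair $(s'',a'')$ follow $\pi$ for $g_3$ further steps to a pair $(\bar s,\bar a)$; return $s',s''$ and $\widehat H=\frac{A^2r(\bar s,\bar a)}{1-\gamma}e_{a'}e_{a''}^\top\in\mathbb R^{\mathcal A\times\mathcal A}$. The length of an episode is the number of actions in it up to and including the one whose reward is recorded. **Algorithm** (variance-reduced conservative policy iteration, parameters $\eta,\lambda\in[0,1]$, $T$, oracle $\mathrm{ERM}$). Start from an arbitrary $\pi_0=\pi_1\in\Pi$ and $D_0=\emptyset$. For $t=1,\dots,T$: run the Q-sampler with $(\pi_t,\mu)$ to get $(s_t,\widehat Q_t)$; draw $b\sim\mathrm{Unif}[0,1]$ and run the H-sampler with $((1-b)\pi_t+b\pi_{t-1},\mu)$ to get $(s'_t,s''_t,\widehat H_t)$; multiply all loss vectors of $D_{t-1}$ by $1-\lambda$ and append $$\Big(s_t,\tfrac{\lambda}{1-\gamma}\widehat Q_t\Big),\quad\Big(s'_t,\tfrac{\gamma(1-\lambda)}{(1-\gamma)^2}\widehat H_t(\pi_t-\pi_{t-1})(s''_t)\Big),\quad\Big(s''_t,\tfrac{\gamma(1-\lambda)}{(1-\gamma)^2}\widehat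 H_t^\top(\pi_t-\pi_{t-1})(s'_t)\Big)$$ to obtain $D_t$; put $\pi'_t=\mathrm{ERM}(D_t)$, $\widehat A_t=\sum_{(s,l)\in D_t}l^\top(\pi'_t(s)-\pi_t(s))$ and $\pi_{t+1}=(1-\eta)\pi_t+\eta\pi'_t$. Return $\bar\pi=\pi_{t'}$ where $t'$ minimizes $\widehat A_t$ over $T/2\le t\le T$ (ties broken arbitrarily). **Claim.** There are universal constants $C>0$, $c\in(0,1]$, $k\in\mathbb N$ such that for all $\mathcal S,\mathcal A,\Pi,\gamma$, all $\varepsilon>0$, $\delta\in(0,1)$ and $D\ge1$ there are parameters $\eta,\lambda,T$ such that the following holds for every MDP on $\mathcal S,\mathcal A$ with discount factor $\gamma$, every optimal policy $\pi^*$, every $\mu$ with $D_\infty^\mu\le D$, every ERM oracle for $\Pi$ with tolerance $\varepsilon_{\rm ERM}=\varepsilon_c:=c\,\varepsilon(1-\gamma)^3/(AD)$ and every initial policy in $\Pi$. 1. With probability at least $1-\delta$ the returned policy satisfies $$V^*-V^{\bar\pi}\le\varepsilon+\frac{D_\infty^\mu\,\epsilon_{\Pi,\mu}}{(1-\gamma)^2}.$$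 2. With $L=\log\!\big(2+\frac{AD}{(1-\gamma)^2\varepsilon}\big)$, the number of episodes sampled from the MDP, all started from $\mu$, is at most $$C\Big(1+\frac{A^3D^3}{(1-\gamma)^9\varepsilon^3}\,\log\frac{2|\Pi_{\varepsilon_c}|}{\delta}\,L^k\Big).$$ If moreover the covering numbers scale logarithmically in the sense that, for some $\kappa\ge1$, $\log|\Pi_{\varepsilon'}|\le\kappa\,(1+\log\frac{\varepsilon}{\varepsilon'})(1+\log|\Pi_\varepsilon|)$ for all $0<\varepsilon'\le\varepsilon$, then it is at most $$C\Big(1+\kappa\,\frac{A^3D^3}{(1-\gamma)^9\varepsilon^3}\,\log\frac{2|\Pi_{\varepsilon}|}{\delta}\,L^k\Big).$$ In particular, for $D=D_\infty^\mu$ it is $\tilde O\big((D_\infty^\mu)^3\log|\Pi_\varepsilon|/\varepsilon^3\big)$. 3. Every episode has expected length at most $C/(1-\gamma)$. -/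

import Mathlib

open scoped ENNReal NNReal

universe u v

noncomputable section

namespace VRCPI

/-! ### Policies, policy classes, covering numbers -/

/-- Stochastic policies: an element of `(Δ_A)^S`. -/
abbrev Policy (S : Type u) (A : Type v) [Fintype A] : Type (max u v) := S → stdSimplex ℝ A

variable {S : Type u} {A : Type v} [Fintype A]

/-- The matrix `(π(a|s))` in `ℝ^{S × A}` of a policy. -/
def Policy.mat (π : Policy S A) : S → A → ℝ := fun s a => (π s).1 a

/-- The policy `(1 - c) π + c π'`. -/
def mix (c : unitInterval) (π π' : Policy S A) : Policy S A := fun s =>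
  ⟨(1 - (c : ℝ)) • (π s).1 + (c : ℝ) • (π' s).1,
    convex_stdSimplex ℝ A (π s).2 (π' s).2 (sub_nonneg.2 c.2.2) c.2.1 (by ring)⟩

/-- `CH(Π)`, the convex hull of a policy class in `ℝ^{S × A}`. -/
def convHull (Pi : Set (Policy S A)) : Set (Policy S A) :=
  {π | Policy.mat π ∈ convexHull ℝ (Policy.mat '' Pi)}

/-- The `ε`-covering number `|Π_ε|` of a policy class with respect to the norm
`‖π‖_{∞,1} = max_s ∑_a |π(a|s)|`, which is the norm of `S → PiLp 1 (fun _ : A => ℝ)`. The points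
of the cover may be arbitrary matrices. It is finite for `ε > 0`. -/
def covNum [Fintype S] (Pi : Set (Policy S A)) (ε : ℝ) : ℕ :=
  (Metric.externalCoveringNumber ε.toNNReal
    ((fun (π : Policy S A) (s : S) =>
      (WithLp.toLp 1 (π s).1 : PiLp 1 (fun _ : A => ℝ))) '' Pi)).toNat

/-- Below the scale `ε`, the logarithm of the covering number `|Π_{ε'}|` grows at most
logarithmically in `1/ε'`, with constant `κ`. -/
def LogScaling [Fintype S] (Pi : Set (Policy S A)) (ε κ : ℝ) : Prop :=
  ∀ ε' : ℝ, 0 < ε' → ε' ≤ ε →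
    Real.log (covNum Pi ε') ≤
      κ * (1 + Real.log (ε / ε')) * (1 + Real.log (covNum Pi ε))

/-- The law of an action drawn from `π(·|s)`. -/
def actionLaw (π : Policy S A) (s : S) : PMF A :=
  PMF.ofFintype (fun a => ENNReal.ofReal (Policy.mat π s a)) (by
    simp only [Policy.mat]
    rw [← ENNReal.ofReal_sum_of_nonneg (fun a _ => (π s).2.1 a), (π s).2.2, ENNReal.ofReal_one])

/-! ### Markov decision processes -/

/-- A Markov decision process: transition kernel `P`, rewards in `[0,1]`, initial state
distribution `ρ`. The discount factor is carried separately. -/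
structure MDP (S : Type u) (A : Type v) where
  P : S → A → PMF S
  r : S → A → ℝ
  r_mem : ∀ s a, r s a ∈ Set.Icc (0 : ℝ) 1
  ρ : PMF S

/-- Discount factors `γ ∈ [0, 1)`. -/
abbrev Discount : Type := Set.Ico (0 : ℝ) 1

variable (M : MDP S A) (γ : Discount)

/-- The pair `(s, a)` with `s ∼ ν`, `a ∼ π(·|s)`. -/
def startLaw (π : Policy S A) (ν : PMF S) : PMF (S × A) :=
  ν.bind fun s => (actionLaw π s).bind fun a => PMF.pure (s, a)

/-- The law of `(s_t, a_t)` when `(s_0, a_0)` has law `p` and `s_{i+1} ∼ P(·|s_i, a_i)`,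
`a_{i+1} ∼ π(·|s_{i+1})`. -/
def pairLaw (π : Policy S A) (p : PMF (S × A)) : ℕ → PMF (S × A)
  | 0 => p
  | t + 1 => (pairLaw π p t).bind fun x => startLaw π (M.P x.1 x.2)

/-- `Q^π(s,a) = ∑_t γ^t E[r(s_t,a_t) | s_0 = s, a_0 = a]`. -/
def Q [Fintype S] (π : Policy S A) (s : S) (a : A) : ℝ :=
  ∑' t : ℕ, (γ : ℝ) ^ t * ∑ x : S × A, (pairLaw M π (PMF.pure (s, a)) t x).toReal * M.r x.1 x.2

/-- `V^π(s) = E_{a ∼ π(·|s)} Q^π(s,a)`. -/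
def Vstate [Fintype S] (π : Policy S A) (s : S) : ℝ :=
  ∑ a, Policy.mat π s a * Q M γ π s a

/-- `V^π_ν = E_{s ∼ ν} V^π(s)`. -/
def V [Fintype S] (π : Policy S A) (ν : PMF S) : ℝ :=
  ∑ s, (ν s).toReal * Vstate M γ π s

/-- `d^π_ν(s,a) = (1-γ) ∑_t γ^t P(s_t = s, a_t = a)` with `s_0 ∼ ν`. -/
def occPair (π : Policy S A) (ν : PMF S) (s : S) (a : A) : ℝ :=
  (1 - (γ : ℝ)) * ∑' t : ℕ, (γ : ℝ) ^ t * (pairLaw M π (startLaw π ν) t (s, a)).toReal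

/-- The state marginal `d^π_ν(s)`. -/
def occ (π : Policy S A) (ν : PMF S) (s : S) : ℝ :=
  ∑ a, occPair M γ π ν s a

/-- `π` maximizes `V^π = V^π_ρ` over all policies. -/
def IsOptimal [Fintype S] (π : Policy S A) : Prop :=
  ∀ π' : Policy S A, V M γ π' M.ρ ≤ V M γ π M.ρ

/-- The distribution mismatch coefficient `D_∞^μ = ‖d^{π*} / μ‖_∞ = max_s d^{π*}(s) / μ(s)`,
infinite if `μ(s) = 0 < d^{π*}(s)` for some `s`. -/
def mismatch (πstar : Policy S A) (μ : PMF S) : ℝ≥0∞ :=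
  ⨆ s, ENNReal.ofReal (occ M γ πstar M.ρ s) / μ s

/-- The policy completeness term
`ε_{Π,μ} = max_{π ∈ CH(Π)} min_{π' ∈ Π} E_{s ∼ d^π_μ} [max_a Q^π(s,a) - Q^π(s,·)ᵀ π'(s)]`. -/
def completeness [Fintype S] (Pi : Set (Policy S A)) (μ : PMF S) : ℝ :=
  ⨆ π : convHull Pi, ⨅ π' : Pi,
    ∑ s, occ M γ π.1 μ s * ((⨆ a, Q M γ π.1 s a) - ∑ a, Q M γ π.1 s a * Policy.mat π'.1 s a)

/-! ### Sampling subroutines -/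

/-- The number of rounds completed by a loop that, at the beginning of each round, is left with
probability `1 - γ`, independently of everything else. -/
def geom : PMF ℕ :=
  ⟨fun n => ENNReal.ofReal ((1 - (γ : ℝ)) * (γ : ℝ) ^ n), by
    have h1 : (γ : ℝ) < 1 := γ.2.2
    have h := (hasSum_geometric_of_lt_one γ.2.1 h1).mul_left (1 - (γ : ℝ))
    rw [mul_inv_cancel₀ (by linarith)] at h
    have hn : ∀ n : ℕ, 0 ≤ (1 - (γ : ℝ)) * (γ : ℝ) ^ n := fun n =>
      mul_nonneg (by linarith) (pow_nonneg γ.2.1 n)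
    have h2 := ENNReal.ofReal_tsum_of_nonneg hn h.summable
    rw [h.tsum_eq, ENNReal.ofReal_one] at h2
    rw [h2]
    exact ENNReal.summable.hasSum⟩

/-- The law of the state after `t` steps of `π` when the initial state has law `ν`. -/
def stateLaw (π : Policy S A) (ν : PMF S) : ℕ → PMF S
  | 0 => ν
  | t + 1 => (stateLaw π ν t).bind fun s => (actionLaw π s).bind fun a => M.P s a

/-- The data that the learner keeps of an episode of the Q-sampler: the recorded state `s` with
the uniformly random action `a` played there, the state-action pair `(sEnd, aEnd)` whose reward is
recorded, and the length of the episode (the number of actions played). -/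
structure QEpisode (S : Type u) (A : Type v) where
  s : S
  a : A
  sEnd : S
  aEnd : A
  len : ℕ

/-- The data that the learner keeps of an episode of the H-sampler: two recorded states with the
uniformly random actions played there, the state-action pair whose reward is recorded, and the
length of the episode. -/
structure HEpisode (S : Type u) (A : Type v) where
  s₁ : S
  a₁ : A
  s₂ : S
  a₂ : A
  sEnd : S
  aEnd : A
  len : ℕ

/-- The Q-sampler. From `s_0 ∼ μ` follow `π` for a geometric number `t` of steps; play a uniformly
random action in `s_t`; then follow `π` until a second geometric clock, which may ring already at
the pair `(s_t, a_t)`, stops the episode at a pair `(sEnd, aEnd)`. -/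
def qSampler [Nonempty A] (π : Policy S A) (μ : PMF S) : PMF (QEpisode S A) :=
  (geom γ).bind fun t => (stateLaw M π μ t).bind fun s => (PMF.uniformOfFintype A).bind fun a =>
  (geom γ).bind fun n => (pairLaw M π (PMF.pure (s, a)) n).bind fun x =>
  PMF.pure ⟨s, a, x.1, x.2, t + n + 1⟩

/-- The H-sampler. As the Q-sampler, with two recorded states: after the uniformly random action
`a₁` in `s₁`, move to the next state, follow `π` for a geometric number of steps to reach `s₂`,
play a uniformly random action `a₂` there, and end as the Q-sampler does. -/
def hSampler [Nonempty A] (π : Policy S A) (μ : PMF S) : PMF (HEpisode S A) :=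
  (geom γ).bind fun t => (stateLaw M π μ t).bind fun s₁ =>
  (PMF.uniformOfFintype A).bind fun a₁ =>
  (geom γ).bind fun n => (stateLaw M π (M.P s₁ a₁) n).bind fun s₂ =>
  (PMF.uniformOfFintype A).bind fun a₂ =>
  (geom γ).bind fun m => (pairLaw M π (PMF.pure (s₂, a₂)) m).bind fun x =>
  PMF.pure ⟨s₁, a₁, s₂, a₂, x.1, x.2, t + 1 + n + 1 + m⟩

open Classical in
/-- `Q̂(a) = 1[a = a_t] |A| R` with `R = r(sEnd, aEnd) / (1-γ)`. -/
def QEpisode.Qhat (e : QEpisode S A) : A → ℝ := fun a =>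
  if a = e.a then (Fintype.card A : ℝ) * (M.r e.sEnd e.aEnd / (1 - (γ : ℝ))) else 0

open Classical in
/-- `Ĥ(b₁,b₂) = 1[b₁ = a₁, b₂ = a₂] |A|² R` with `R = r(sEnd, aEnd) / (1-γ)`. -/
def HEpisode.Hhat (e : HEpisode S A) : Matrix A A ℝ := fun b₁ b₂ =>
  if b₁ = e.a₁ ∧ b₂ = e.a₂ then
    (Fintype.card A : ℝ) ^ 2 * (M.r e.sEnd e.aEnd / (1 - (γ : ℝ))) else 0

/-! Measurability in the mixing parameter, needed to average the H-sampler over it. -/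

instance [Countable S] [Countable A] : Countable (HEpisode S A) :=
  Function.Injective.countable
    (f := fun e : HEpisode S A => (e.s₁, e.a₁, e.s₂, e.a₂, e.sEnd, e.aEnd, e.len))
    (by
      rintro ⟨⟩ ⟨⟩ h
      simpa using h)

theorem meas_bind {Ω : Type*} [MeasurableSpace Ω] {α β : Type*} [Countable α]
    {p : Ω → PMF α} {f : Ω → α → PMF β}
    (hp : ∀ a, Measurable fun ω => p ω a) (hf : ∀ a b, Measurable fun ω => f ω a b) (b : β) :
    Measurable fun ω => ((p ω).bind (f ω)) b := by
  simp only [PMF.bind_apply]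
  exact Measurable.tsum fun a => (hp a).mul (hf a b)

theorem meas_actionLaw (π π' : Policy S A) (s : S) (a : A) :
    Measurable fun b : unitInterval => actionLaw (mix b π π') s a := by
  have h : (fun b : unitInterval => actionLaw (mix b π π') s a) = fun b : unitInterval =>
      ENNReal.ofReal ((1 - (b : ℝ)) * (π s).1 a + (b : ℝ) * (π' s).1 a) := rfl
  rw [h]
  fun_prop

theorem meas_startLaw [Countable S] (π π' : Policy S A) (ν : PMF S) (x : S × A) :
    Measurable fun b : unitInterval => startLaw (mix b π π') ν x := by
  unfold startLaw
  refine meas_bind (fun _ => measurable_const) (fun s y => ?_) x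
  exact meas_bind (f := fun _ a => PMF.pure (s, a)) (meas_actionLaw π π' s)
    (fun _ _ => measurable_const) y

theorem meas_pairLaw [Countable S] (π π' : Policy S A) (p : PMF (S × A)) (t : ℕ) (x : S × A) :
    Measurable fun b : unitInterval => pairLaw M (mix b π π') p t x := by
  induction t generalizing x with
  | zero => simp only [pairLaw]; exact measurable_const
  | succ t ih =>
    simp only [pairLaw]
    exact meas_bind ih (fun _ y => meas_startLaw π π' _ y) x

theorem meas_stateLaw [Countable S] (π π' : Policy S A) (ν : PMF S) (t : ℕ) (s : S) :
    Measurable fun b : unitInterval => stateLaw M (mix b π π') ν t s := by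
  induction t generalizing s with
  | zero => simp only [stateLaw]; exact measurable_const
  | succ t ih =>
    simp only [stateLaw]
    refine meas_bind ih (fun s' y => ?_) s
    exact meas_bind (f := fun _ a => M.P s' a) (meas_actionLaw π π' s')
      (fun _ _ => measurable_const) y

theorem meas_hSampler [Countable S] [Nonempty A] (π π' : Policy S A) (μ : PMF S)
    (e : HEpisode S A) :
    Measurable fun b : unitInterval => hSampler M γ (mix b π π') μ e := by
  unfold hSampler
  refine meas_bind (fun _ => measurable_const) (fun t e => ?_) e
  refine meas_bind (meas_stateLaw M π π' _ _) (fun s₁ e => ?_) e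
  refine meas_bind (fun _ => measurable_const) (fun a₁ e => ?_) e
  refine meas_bind (fun _ => measurable_const) (fun n e => ?_) e
  refine meas_bind (meas_stateLaw M π π' _ _) (fun s₂ e => ?_) e
  refine meas_bind (fun _ => measurable_const) (fun a₂ e => ?_) e
  refine meas_bind (fun _ => measurable_const) (fun m e => ?_) e
  refine meas_bind (meas_pairLaw M π π' _ _) (fun x e => ?_) e
  exact measurable_const

/-- The law of an episode of the H-sampler run with the random policy `(1-b) π + b π'`, where
`b ∼ Unif([0,1])`. -/
def hSamplerMixed [Countable S] [Nonempty A] (π π' : Policy S A) (μ : PMF S) :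
    PMF (HEpisode S A) :=
  ⟨fun e => ∫⁻ b : unitInterval, hSampler M γ (mix b π π') μ e, by
    have h : ∑' e, ∫⁻ b : unitInterval, hSampler M γ (mix b π π') μ e = 1 := by
      rw [← MeasureTheory.lintegral_tsum
        fun e => (meas_hSampler M γ π π' μ e).aemeasurable]
      simp [PMF.tsum_coe]
    rw [← h]
    exact ENNReal.summable.hasSum⟩

/-! ### ERM oracles and variance-reduced conservative policy iteration -/

/-- Datasets of states paired with linear losses. -/
abbrev Dataset (S : Type u) (A : Type v) : Type (max u v) := List (S × (A → ℝ))

/-- `∑_{(s,l) ∈ D} lᵀ π(s)`. -/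
def Dataset.score (D : Dataset S A) (π : Policy S A) : ℝ :=
  (D.map fun x => ∑ a, x.2 a * Policy.mat π x.1 a).sum

/-- `erm` is an ERM oracle for the class `Π` with tolerance `tol`; `‖l‖` is the sup norm. -/
def IsERM (Pi : Set (Policy S A)) (tol : ℝ) (erm : Dataset S A → Policy S A) : Prop :=
  ∀ D : Dataset S A, erm D ∈ Pi ∧
    ∀ π ∈ Pi, D.score π - tol * (D.map fun x => ‖x.2‖).sum ≤ D.score (erm D)

/-- What the algorithm remembers after its iteration `t`: the policies `π_t` and `π_{t+1}`, the
dataset `D_t`, the list of the triples `(i, π_i, Â_i)` for the iterations `i ≤ t` so far, and the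
lengths of all episodes drawn so far (newest first). -/
structure State (S : Type u) (A : Type v) [Fintype A] where
  prev : Policy S A
  cur : Policy S A
  data : Dataset S A
  log : List (ℕ × Policy S A × ℝ)
  lens : List ℕ

variable [Countable S] [Nonempty A]

/-- The deterministic part of iteration `t`: given the two episodes, rescale the dataset by
`1 - lam`, append the three new examples, call the oracle and update. -/
def update (η lam : unitInterval) (erm : Dataset S A → Policy S A) (t : ℕ) (σ : State S A)
    (q : QEpisode S A) (h : HEpisode S A) : State S A :=
  let c : ℝ := (γ : ℝ) * (1 - (lam : ℝ)) / (1 - (γ : ℝ)) ^ 2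
  let Δ : S → A → ℝ := fun s => Policy.mat σ.cur s - Policy.mat σ.prev s
  let D : Dataset S A := (σ.data.map fun x => (x.1, (1 - (lam : ℝ)) • x.2)) ++
    [(q.s, ((lam : ℝ) / (1 - (γ : ℝ))) • q.Qhat M γ),
     (h.s₁, c • (h.Hhat M γ).mulVec (Δ h.s₂)),
     (h.s₂, c • (h.Hhat M γ).transpose.mulVec (Δ h.s₁))]
  let π' : Policy S A := erm D
  { prev := σ.cur
    cur := mix η σ.cur π'
    data := D
    log := (t, σ.cur, D.score π' - D.score σ.cur) :: σ.log
    lens := h.len :: q.len :: σ.lens }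

/-- The law of the algorithm's memory after `t` iterations, when it is started at `π_0 = π_1`.
Iteration `t` draws one episode of the Q-sampler with `π_t` and one episode of the H-sampler with
`(1-b) π_t + b π_{t-1}`, `b ∼ Unif([0,1])`, both with `s_0 ∼ μ`. -/
def run (η lam : unitInterval) (erm : Dataset S A → Policy S A) (μ : PMF S) (π₁ : Policy S A) :
    ℕ → PMF (State S A)
  | 0 => PMF.pure ⟨π₁, π₁, [], [], []⟩
  | t + 1 => (run η lam erm μ π₁ t).bind fun σ =>
      (qSampler M γ σ.cur μ).bind fun q =>
      (hSamplerMixed M γ σ.cur σ.prev μ).bind fun h =>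
      PMF.pure (update M γ η lam erm (t + 1) σ q h)

/-- `π` is returned by the algorithm with `T` iterations: `π = π_i` for some `T/2 ≤ i ≤ T` that
minimizes `Â_i` among these, however ties are broken. -/
def IsOutput {S : Type u} {A : Type v} [Fintype A] (T : ℕ) (σ : State S A) (π : Policy S A) :
    Prop :=
  ∃ i adv, (i, π, adv) ∈ σ.log ∧ T ≤ 2 * i ∧ ∀ x ∈ σ.log, T ≤ 2 * x.1 → adv ≤ x.2.2

end VRCPI

end

/-! The algorithm is Frank-Wolfe ascent on `π ↦ V^π_μ` with a variance-reduced estimate of the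
gradient. For a matrix `w` with invertible `1 - γ P_w` one has `V^w_μ = E_μ (1 - γ P_w)⁻¹ r_w`, so
derivatives of the value are resolvent algebra; the Neumann series links the resolvents to
discounted sums and to the geometric clocks of the samplers.

Estimation. The score of `D_t` is a linear functional of the policy that estimates the derivative
`grad` at `π_t`. The Q-sampler estimates this derivative without bias. The H-sampler, run at a
uniform point of the segment from `π_t` to `π_{t-1}`, estimates the difference of the two
derivatives without bias, by the fundamental theorem of calculus (`integral_hess_seg`,
`expect_hSamplerMixed_eq`). Hence the error obeys `e_t = (1-λ) e_{t-1} + centred noise`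
(`err_update`). Consecutive policies differ by at most `η` in each entry, and the coupling `λ(1-γ) =
ηA` makes both noises of order `λA/(1-γ)²`. Hoeffding's lemma and the contraction give the variance
proxy `10λA²/(1-γ)⁴` (`lexp_run_exp_err_le`). The error is Lipschitz and linear in the policy, so a
union bound over a cover of `Π` controls it on `Π` and then on `CH(Π)`, at no extra cost.

Optimization. A step of size `η` towards the oracle's policy gains `η` times its recorded advantage,
up to estimation error and a curvature loss `4η²/(1-γ)³` (`V_mix_ge`). Values lie in `[0, 1/(1-γ)]`,
so the least advantage recorded in the second half is small, and by the oracle property so is the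
Frank-Wolfe gap of the returned policy (`Progress.step`, `Progress.gap_le`). Gradient domination
(`V_sub_V_le`) turns the gap into suboptimality: the performance difference lemma is combined with
the changes of measure `d^{π*} ≤ D_∞^μ μ` and `(1-γ) μ ≤ d^π_μ`.

Parameters. Gradient accuracy of order `ε(1-γ)/D` asks for `λ` of order `ε²(1-γ)⁶/(D²A²)`, which
fixes `η = λ(1-γ)/A`; then `1/(ηT(1-γ))` of order `ε(1-γ)/D` gives `T` of order `A³D³/((1-γ)⁹ε³)`,
up to logarithms (`exists_parameters`). -/

set_option linter.unusedSectionVars false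

noncomputable section

namespace VRCPI

/-! ### Expectations under probability mass functions -/

section Expectation

variable {α β : Type*}

/-- The expectation of a nonnegative function. -/
def lexp (p : PMF α) (f : α → ℝ≥0∞) : ℝ≥0∞ := ∑' a, p a * f a

theorem lexp_bind (p : PMF α) (q : α → PMF β) (f : β → ℝ≥0∞) :
    lexp (p.bind q) f = lexp p fun a => lexp (q a) f := by
  simp only [lexp, PMF.bind_apply, ← ENNReal.tsum_mul_right, ← ENNReal.tsum_mul_left]
  rw [ENNReal.tsum_comm]
  simp only [mul_assoc]

theorem lexp_pure (a : α) (f : α → ℝ≥0∞) : lexp (PMF.pure a) f = f a := by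
  classical
  rw [lexp, tsum_eq_single a]
  · simp
  · intro b hb
    simp [PMF.pure_apply, hb]

theorem lexp_const (p : PMF α) (c : ℝ≥0∞) : lexp p (fun _ => c) = c := by
  rw [lexp, ENNReal.tsum_mul_right, PMF.tsum_coe, one_mul]

theorem lexp_mono {p : PMF α} {f f' : α → ℝ≥0∞} (h : ∀ a ∈ p.support, f a ≤ f' a) :
    lexp p f ≤ lexp p f' := by
  refine ENNReal.tsum_le_tsum fun a => ?_
  by_cases ha : p a = 0
  · simp [ha]
  · gcongr
    exact h a ((PMF.mem_support_iff _ _).2 ha)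

theorem lexp_mul_left (p : PMF α) (c : ℝ≥0∞) (f : α → ℝ≥0∞) :
    lexp p (fun a => c * f a) = c * lexp p f := by
  simp only [lexp, ← ENNReal.tsum_mul_left]
  congr 1; ext a; ring

theorem lexp_mul_right (p : PMF α) (c : ℝ≥0∞) (f : α → ℝ≥0∞) :
    lexp p (fun a => f a * c) = lexp p f * c := by
  simp only [lexp, ← ENNReal.tsum_mul_right, mul_assoc]

theorem lexp_add (p : PMF α) (f f' : α → ℝ≥0∞) :
    lexp p (fun a => f a + f' a) = lexp p f + lexp p f' := by
  simp only [lexp, mul_add, ENNReal.tsum_add]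

theorem toOuterMeasure_eq_lexp (p : PMF α) (s : Set α) :
    p.toOuterMeasure s = lexp p (s.indicator 1) := by
  rw [PMF.toOuterMeasure_apply, lexp]
  congr 1; ext a
  by_cases h : a ∈ s <;> simp [h]

theorem toOuterMeasure_add_compl (p : PMF α) (s : Set α) :
    p.toOuterMeasure s + p.toOuterMeasure sᶜ = 1 := by
  rw [toOuterMeasure_eq_lexp, toOuterMeasure_eq_lexp, ← lexp_add, ← lexp_const p 1]
  congr 1; ext a
  by_cases h : a ∈ s <;> simp [h]

/-- The expectation of a real function. -/
def expect (p : PMF α) (f : α → ℝ) : ℝ := ∑' a, (p a).toReal * f a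

theorem hasSum_toReal (p : PMF α) : HasSum (fun a => (p a).toReal) 1 := by
  have h := ENNReal.hasSum_toReal (f := p) (by simp [PMF.tsum_coe])
  rwa [← ENNReal.tsum_toReal_eq (PMF.apply_ne_top p), PMF.tsum_coe, ENNReal.toReal_one] at h

theorem expect_const (p : PMF α) (c : ℝ) : expect p (fun _ => c) = c := by
  simp [expect, tsum_mul_right, (hasSum_toReal p).tsum_eq]

/-- A divergent `tsum` has the default value 0, so additivity, monotonicity and Fubini for `expect`
are stated for bounded functions. -/
theorem summable_expect (p : PMF α) {f : α → ℝ} {C : ℝ} (hf : ∀ a, |f a| ≤ C) :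
    Summable fun a => (p a).toReal * f a := by
  refine Summable.of_norm_bounded ((hasSum_toReal p).summable.mul_right C) fun a => ?_
  rw [Real.norm_eq_abs, abs_mul, abs_of_nonneg ENNReal.toReal_nonneg]
  exact mul_le_mul_of_nonneg_left (hf a) ENNReal.toReal_nonneg

theorem expect_mul_left (p : PMF α) (c : ℝ) (f : α → ℝ) :
    expect p (fun a => c * f a) = c * expect p f := by
  simp only [expect, ← tsum_mul_left]
  congr 1; ext a; ring

theorem expect_add (p : PMF α) {f f' : α → ℝ} {C C' : ℝ} (hf : ∀ a, |f a| ≤ C)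
    (hf' : ∀ a, |f' a| ≤ C') : expect p (fun a => f a + f' a) = expect p f + expect p f' := by
  simp only [expect, mul_add]
  exact (summable_expect p hf).tsum_add (summable_expect p hf')

theorem expect_mono (p : PMF α) {f f' : α → ℝ} {C C' : ℝ} (hf : ∀ a, |f a| ≤ C)
    (hf' : ∀ a, |f' a| ≤ C') (h : ∀ a, f a ≤ f' a) : expect p f ≤ expect p f' :=
  (summable_expect p hf).tsum_le_tsum
    (fun a => mul_le_mul_of_nonneg_left (h a) ENNReal.toReal_nonneg) (summable_expect p hf')

theorem abs_expect_le (p : PMF α) {f : α → ℝ} {C : ℝ} (hf : ∀ a, |f a| ≤ C) :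
    |expect p f| ≤ C := by
  have hC : ∀ a : α, |C| ≤ |C| := fun _ => le_rfl
  have hC' : ∀ a : α, |-C| ≤ |C| := fun _ => (abs_neg C).le
  rw [abs_le]
  constructor
  · rw [← expect_const p (-C)]
    exact expect_mono p hC' hf fun a => (abs_le.1 (hf a)).1
  · rw [← expect_const p C]
    exact expect_mono p hf hC fun a => (abs_le.1 (hf a)).2

theorem expect_bind (p : PMF α) (q : α → PMF β) {f : β → ℝ} {C : ℝ} (hf : ∀ b, |f b| ≤ C) :
    expect (p.bind q) f = expect p fun a => expect (q a) f := by
  have h1 : ∀ b, ((p.bind q) b).toReal = ∑' a, (p a).toReal * (q a b).toReal := by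
    intro b
    rw [PMF.bind_apply, ENNReal.tsum_toReal_eq]
    · simp only [ENNReal.toReal_mul]
    · intro a
      exact ENNReal.mul_ne_top (PMF.apply_ne_top _ _) (PMF.apply_ne_top _ _)
  have hnn : ∀ x : α × β, 0 ≤ (p x.1).toReal * (q x.1 x.2).toReal := fun x =>
    mul_nonneg ENNReal.toReal_nonneg ENNReal.toReal_nonneg
  have hs : Summable fun x : α × β => (p x.1).toReal * (q x.1 x.2).toReal := by
    rw [summable_prod_of_nonneg hnn]
    constructor
    · intro a
      exact (hasSum_toReal (q a)).summable.mul_left (p a).toReal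
    · have : ∀ a, ∑' b, (p a).toReal * (q a b).toReal = (p a).toReal := fun a => by
        rw [tsum_mul_left, (hasSum_toReal (q a)).tsum_eq, mul_one]
      simp only [this]
      exact (hasSum_toReal p).summable
  have hs2 : Summable fun x : α × β => (p x.1).toReal * (q x.1 x.2).toReal * f x.2 := by
    refine Summable.of_norm_bounded (hs.mul_right C) fun x => ?_
    rw [Real.norm_eq_abs, abs_mul, abs_of_nonneg (hnn x)]
    exact mul_le_mul_of_nonneg_left (hf _) (hnn x)
  simp only [expect, h1, ← tsum_mul_right, ← tsum_mul_left]
  rw [Summable.tsum_comm (f := fun a b => (p a).toReal * (q a b).toReal * f b) hs2]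
  simp only [mul_assoc]

theorem expect_pure (a : α) (f : α → ℝ) : expect (PMF.pure a) f = f a := by
  classical
  rw [expect, tsum_eq_single a]
  · simp
  · intro b hb
    simp [PMF.pure_apply, hb]

theorem expect_fintype [Fintype α] (p : PMF α) (f : α → ℝ) :
    expect p f = ∑ a, (p a).toReal * f a := tsum_fintype _

theorem expect_uniform [Fintype α] [Nonempty α] (f : α → ℝ) :
    expect (PMF.uniformOfFintype α) f = (Fintype.card α : ℝ)⁻¹ * ∑ a, f a := by
  simp [expect_fintype, Finset.mul_sum]

theorem lexp_ofReal (p : PMF α) {f : α → ℝ} {C : ℝ} (hf : ∀ a, |f a| ≤ C) (h0 : ∀ a, 0 ≤ f a) :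
    lexp p (fun a => ENNReal.ofReal (f a)) = ENNReal.ofReal (expect p f) := by
  rw [expect, ENNReal.ofReal_tsum_of_nonneg _ (summable_expect p hf)]
  · simp only [lexp]
    congr 1; ext a
    rw [ENNReal.ofReal_mul ENNReal.toReal_nonneg, ENNReal.ofReal_toReal (PMF.apply_ne_top _ _)]
  · intro a
    exact mul_nonneg ENNReal.toReal_nonneg (h0 a)

/-- The chord of `exp` over `[-B, B]` lies above `exp`. -/
theorem exp_le_cosh_add {B y : ℝ} (hB : 0 < B) (hy : |y| ≤ B) :
    Real.exp y ≤ Real.cosh B + y / B * Real.sinh B := by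
  obtain ⟨h1, h2⟩ := abs_le.1 hy
  have ha : 0 ≤ (1 - y / B) / 2 := by
    have : y / B ≤ 1 := (div_le_one hB).2 h2
    linarith
  have hb : 0 ≤ (1 + y / B) / 2 := by
    have : -1 ≤ y / B := by rw [le_div_iff₀ hB]; linarith
    linarith
  have h := convexOn_exp.2 (Set.mem_univ (-B)) (Set.mem_univ B) ha hb (by ring)
  simp only [smul_eq_mul] at h
  have e : (1 - y / B) / 2 * -B + (1 + y / B) / 2 * B = y := by field_simp; ring
  rw [e] at h
  refine h.trans (le_of_eq ?_)
  rw [Real.cosh_eq, Real.sinh_eq]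
  ring

/-- A form of Hoeffding's lemma: centred bounded variables are subgaussian. -/
theorem lexp_exp_le (p : PMF α) {f : α → ℝ} {C : ℝ} (hC : 0 ≤ C) (hf : ∀ a, |f a| ≤ C)
    (h0 : expect p f = 0) (θ : ℝ) :
    lexp p (fun a => ENNReal.ofReal (Real.exp (θ * f a))) ≤
      ENNReal.ofReal (Real.exp (θ ^ 2 * C ^ 2 / 2)) := by
  rcases (mul_nonneg (abs_nonneg θ) hC).eq_or_lt with hB | hB
  · have : ∀ a, θ * f a = 0 := fun a => by
      refine abs_nonpos_iff.1 ?_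
      rw [abs_mul, hB]
      exact mul_le_mul_of_nonneg_left (hf a) (abs_nonneg θ)
    simp only [this, Real.exp_zero, lexp_const]
    exact ENNReal.ofReal_le_ofReal (Real.one_le_exp (by positivity))
  · set B := |θ| * C
    have hb : ∀ a, |θ * f a| ≤ B := fun a => by
      rw [abs_mul]
      exact mul_le_mul_of_nonneg_left (hf a) (abs_nonneg θ)
    have hle : ∀ a, Real.exp (θ * f a) ≤ Real.cosh B + (θ / B * Real.sinh B) * f a := fun a =>
      (exp_le_cosh_add hB (hb a)).trans (le_of_eq (by ring))
    have hexp : ∀ a, |Real.exp (θ * f a)| ≤ Real.exp B := fun a => by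
      rw [abs_of_pos (Real.exp_pos _)]
      exact Real.exp_le_exp.2 ((le_abs_self _).trans (hb a))
    have hlin : ∀ a, |(θ / B * Real.sinh B) * f a| ≤ |θ / B * Real.sinh B| * C := fun a => by
      rw [abs_mul]
      exact mul_le_mul_of_nonneg_left (hf a) (abs_nonneg _)
    have hcosh : ∀ a : α, |Real.cosh B| ≤ |Real.cosh B| := fun _ => le_rfl
    rw [lexp_ofReal p hexp fun a => (Real.exp_pos _).le]
    refine ENNReal.ofReal_le_ofReal ?_
    refine (expect_mono p hexp (fun a => (abs_add_le _ _).trans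
      (add_le_add (hcosh a) (hlin a))) hle).trans ?_
    -- The linear part of the chord has mean zero; what is left is `cosh B ≤ exp(B²/2)`.
    rw [expect_add p hcosh hlin, expect_const, expect_mul_left, h0, mul_zero, add_zero]
    refine (Real.cosh_le_exp_half_sq B).trans (le_of_eq ?_)
    rw [mul_pow, sq_abs]

end Expectation

/-! ### Transition operators and their resolvents -/

section Operators

variable {S : Type u} {A : Type v} [Fintype S] [Fintype A]

theorem exists_abs_le {α : Type*} [Finite α] (f : α → ℝ) : ∃ C, ∀ a, |f a| ≤ C := by
  obtain ⟨C, hC⟩ := (Set.finite_range fun a => |f a|).bddAbove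
  exact ⟨C, fun a => hC ⟨a, rfl⟩⟩

theorem expect_bind_fintype {α β : Type*} [Finite β] (p : PMF α) (q : α → PMF β) (f : β → ℝ) :
    expect (p.bind q) f = expect p fun a => expect (q a) f :=
  expect_bind p q (exists_abs_le f).choose_spec

/-- `s ↦ ∑_a f(s,a) w(s,a)`. -/
def dot (f w : S → A → ℝ) : S → ℝ := fun s => ∑ a, w s a * f s a

theorem dot_add (f w w' : S → A → ℝ) : dot f (w + w') = dot f w + dot f w' := by
  ext s; simp [dot, add_mul, Finset.sum_add_distrib]

theorem dot_smul (f w : S → A → ℝ) (c : ℝ) : dot f (c • w) = c • dot f w := by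
  ext s; simp [dot, mul_assoc, Finset.mul_sum]

theorem dot_sub (f w w' : S → A → ℝ) : dot f (w - w') = dot f w - dot f w' := by
  ext s; simp [dot, sub_mul, Finset.sum_sub_distrib]

theorem mat_nonneg (π : Policy S A) (s : S) (a : A) : 0 ≤ π.mat s a := (π s).2.1 a

theorem sum_mat (π : Policy S A) (s : S) : ∑ a, π.mat s a = 1 := (π s).2.2

theorem mat_le_one (π : Policy S A) (s : S) (a : A) : π.mat s a ≤ 1 := by
  rw [← sum_mat π s]
  exact Finset.single_le_sum (fun a _ => mat_nonneg π s a) (Finset.mem_univ a)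

theorem abs_sum_mul_le {w f : A → ℝ} {B C : ℝ} (hw : ∑ a, |w a| ≤ B) (hC : 0 ≤ C)
    (hf : ∀ a, |f a| ≤ C) : |∑ a, w a * f a| ≤ B * C := by
  refine (Finset.abs_sum_le_sum_abs _ _).trans ?_
  refine le_trans ?_ (mul_le_mul_of_nonneg_right hw hC)
  rw [Finset.sum_mul]
  refine Finset.sum_le_sum fun a _ => ?_
  rw [abs_mul]
  exact mul_le_mul_of_nonneg_left (hf a) (abs_nonneg _)

theorem sum_abs_mat (π : Policy S A) (s : S) : ∑ a, |π.mat s a| = 1 := by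
  rw [← sum_mat π s]
  exact Finset.sum_congr rfl fun a _ => abs_of_nonneg (mat_nonneg π s a)

theorem expect_linear_add {p : PMF S} (f f' : S → ℝ) :
    expect p (f + f') = expect p f + expect p f' := by
  simp [expect_fintype, mul_add, Finset.sum_add_distrib]

theorem expect_linear_smul {p : PMF S} (c : ℝ) (f : S → ℝ) :
    expect p (c • f) = c * expect p f := expect_mul_left p c f

theorem expect_linear_sub {p : PMF S} (f f' : S → ℝ) :
    expect p (f - f') = expect p f - expect p f' := by
  simp [expect_fintype, mul_sub, Finset.sum_sub_distrib]

theorem expect_nonneg {α : Type*} (p : PMF α) {f : α → ℝ} (h : ∀ a, 0 ≤ f a) : 0 ≤ expect p f :=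
  tsum_nonneg fun a => mul_nonneg ENNReal.toReal_nonneg (h a)

theorem expect_mono_fintype (p : PMF S) {f f' : S → ℝ} (h : ∀ s, f s ≤ f' s) :
    expect p f ≤ expect p f' :=
  expect_mono p (exists_abs_le f).choose_spec (exists_abs_le f').choose_spec h

theorem hasSum_expect {p : PMF S} {f : ℕ → S → ℝ} {g : S → ℝ}
    (h : ∀ s, HasSum (fun n => f n s) (g s)) : HasSum (fun n => expect p (f n)) (expect p g) := by
  simp only [expect_fintype]
  exact hasSum_sum fun s _ => (h s).mul_left _

variable (M : MDP S A) (γ : Discount)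

/-- `h ↦ (s ↦ ∑_a w(s,a) E_{s' ∼ P(·|s,a)} h(s'))`. -/
def stepOp (w : S → A → ℝ) : (S → ℝ) →L[ℝ] (S → ℝ) :=
  LinearMap.toContinuousLinearMap
    { toFun := fun h => dot (fun s a => expect (M.P s a) h) w
      map_add' := fun h h' => by
        ext s; simp [dot, expect_linear_add, mul_add, Finset.sum_add_distrib]
      map_smul' := fun c h => by
        ext s; simp [dot, expect_linear_smul, Finset.mul_sum, mul_left_comm] }

theorem stepOp_apply (w : S → A → ℝ) (h : S → ℝ) :
    stepOp M w h = dot (fun s a => expect (M.P s a) h) w := rfl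

theorem stepOp_sub (w w' : S → A → ℝ) : stepOp M (w - w') = stepOp M w - stepOp M w' := by
  ext1 h; simp [stepOp_apply, dot_sub]

theorem stepOp_smul (c : ℝ) (w : S → A → ℝ) : stepOp M (c • w) = c • stepOp M w := by
  ext1 h; simp [stepOp_apply, dot_smul]

theorem abs_stepOp_le {w : S → A → ℝ} {B C : ℝ} (hw : ∀ s, ∑ a, |w s a| ≤ B) {h : S → ℝ}
    (hC : 0 ≤ C) (hh : ∀ s, |h s| ≤ C) (s : S) : |stepOp M w h s| ≤ B * C :=
  abs_sum_mul_le (hw s) hC fun _ => abs_expect_le _ hh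

/-- The rows of a policy have `ℓ¹` norm one, so `P_π` does not increase the sup norm. This makes the
`Ring.inverse` in `res` a genuine inverse; at a non-unit it would be 0. -/
theorem norm_smul_stepOp_lt (π : Policy S A) : ‖(γ : ℝ) • stepOp M π.mat‖ < 1 := by
  have h1 : ‖stepOp M π.mat‖ ≤ 1 := by
    refine ContinuousLinearMap.opNorm_le_bound _ zero_le_one fun h => ?_
    refine (pi_norm_le_iff_of_nonneg (by positivity)).2 fun s => ?_
    exact abs_stepOp_le M (fun s => (sum_abs_mat π s).le) (norm_nonneg h)
      (fun s => norm_le_pi_norm h s) s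
  rw [norm_smul, Real.norm_eq_abs, abs_of_nonneg γ.2.1]
  exact lt_of_le_of_lt (mul_le_of_le_one_right γ.2.1 h1) γ.2.2

/-- The resolvent `(1 - γ P_w)⁻¹`. -/
def res (w : S → A → ℝ) : (S → ℝ) →L[ℝ] (S → ℝ) := Ring.inverse (1 - (γ : ℝ) • stepOp M w)

theorem isUnit_one_sub (π : Policy S A) : IsUnit (1 - (γ : ℝ) • stepOp M π.mat) :=
  ⟨Units.oneSub _ (norm_smul_stepOp_lt M γ π), rfl⟩

theorem res_mul (π : Policy S A) : res M γ π.mat * (1 - (γ : ℝ) • stepOp M π.mat) = 1 :=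
  Ring.inverse_mul_cancel _ (isUnit_one_sub M γ π)

theorem mul_res (π : Policy S A) : (1 - (γ : ℝ) • stepOp M π.mat) * res M γ π.mat = 1 :=
  Ring.mul_inverse_cancel _ (isUnit_one_sub M γ π)

theorem res_apply_sub (π : Policy S A) (h : S → ℝ) :
    res M γ π.mat (h - (γ : ℝ) • stepOp M π.mat h) = h :=
  DFunLike.congr_fun (res_mul M γ π) h

theorem res_apply_eq (π : Policy S A) (h : S → ℝ) :
    res M γ π.mat h = h + (γ : ℝ) • stepOp M π.mat (res M γ π.mat h) := by
  have := DFunLike.congr_fun (mul_res M γ π) h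
  exact sub_eq_iff_eq_add.1 this

/-- The Neumann series: the bridge between the algebraic resolvent and the sums over time that
define `Q` and `occ`. -/
theorem hasSum_res (π : Policy S A) (h : S → ℝ) (s : S) :
    HasSum (fun n : ℕ => (γ : ℝ) ^ n * (stepOp M π.mat ^ n) h s) (res M γ π.mat h s) := by
  have hn := norm_smul_stepOp_lt M γ π
  have h1 : HasSum (fun n : ℕ => ((γ : ℝ) • stepOp M π.mat) ^ n) (res M γ π.mat) := by
    rw [res, NormedRing.inverse_one_sub _ hn]
    exact (summable_geometric_of_norm_lt_one hn).hasSum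
  have h2 := (ContinuousLinearMap.apply ℝ (S → ℝ) h).hasSum h1
  have h3 := Pi.hasSum.1 h2 s
  simpa [smul_pow] using h3

theorem stepOp_nonneg (π : Policy S A) {h : S → ℝ} (hh : ∀ s, 0 ≤ h s) (s : S) :
    0 ≤ stepOp M π.mat h s :=
  Finset.sum_nonneg fun a _ => mul_nonneg (mat_nonneg π s a) (expect_nonneg _ hh)

theorem stepOp_pow_nonneg (π : Policy S A) {h : S → ℝ} (hh : ∀ s, 0 ≤ h s) (n : ℕ) (s : S) :
    0 ≤ (stepOp M π.mat ^ n) h s := by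
  induction n generalizing s with
  | zero => exact hh s
  | succ n ih =>
    rw [pow_succ']
    exact stepOp_nonneg M π ih s

theorem res_nonneg (π : Policy S A) {h : S → ℝ} (hh : ∀ s, 0 ≤ h s) (s : S) :
    0 ≤ res M γ π.mat h s :=
  (hasSum_res M γ π h s).nonneg fun n =>
    mul_nonneg (pow_nonneg γ.2.1 n) (stepOp_pow_nonneg M π hh n s)

/-- The identity is the time-zero part of the resolvent. In terms of occupancies this is `(1-γ) μ ≤
d^π_μ`, the second change of measure in gradient domination. -/
theorem le_res (π : Policy S A) {h : S → ℝ} (hh : ∀ s, 0 ≤ h s) (s : S) :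
    h s ≤ res M γ π.mat h s := by
  rw [res_apply_eq]
  exact le_add_of_nonneg_right (mul_nonneg γ.2.1 (stepOp_nonneg M π (res_nonneg M γ π hh) s))

theorem one_sub_pos : 0 < 1 - (γ : ℝ) := sub_pos.2 γ.2.2

/-- Constants are fixed by `P_π`. With the monotonicity of the resolvent this yields every sup bound
that loses a factor `1/(1-γ)`. -/
theorem res_const (π : Policy S A) (c : ℝ) :
    res M γ π.mat (fun _ => c) = fun _ => c / (1 - (γ : ℝ)) := by
  have hg := one_sub_pos γ
  have h1 : stepOp M π.mat (fun _ => c / (1 - (γ : ℝ))) = fun _ => c / (1 - (γ : ℝ)) := by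
    ext s
    simp only [stepOp_apply, dot, expect_const]
    rw [← Finset.sum_mul, sum_mat, one_mul]
  have := res_apply_sub M γ π (fun _ => c / (1 - (γ : ℝ)))
  rw [h1] at this
  convert this using 2
  ext s
  simp only [Pi.sub_apply, Pi.smul_apply, smul_eq_mul]
  field_simp

theorem res_mono (π : Policy S A) {h h' : S → ℝ} (hh : ∀ s, h s ≤ h' s) (s : S) :
    res M γ π.mat h s ≤ res M γ π.mat h' s := by
  have := res_nonneg M γ π (h := h' - h) (fun s => sub_nonneg.2 (hh s)) s
  rw [map_sub] at this
  exact sub_nonneg.1 this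

theorem abs_res_le (π : Policy S A) {h : S → ℝ} {C : ℝ} (hh : ∀ s, |h s| ≤ C) (s : S) :
    |res M γ π.mat h s| ≤ C / (1 - (γ : ℝ)) := by
  rw [abs_le]
  constructor
  · have := res_mono M γ π (h := fun _ => -C) (h' := h) (fun s => (abs_le.1 (hh s)).1) s
    rwa [res_const, neg_div] at this
  · have := res_mono M γ π (h := h) (h' := fun _ => C) (fun s => (abs_le.1 (hh s)).2) s
    rwa [res_const] at this

/-! ### Value functions through resolvents -/

/-- The state values of the policy with matrix `w`. -/
def val (w : S → A → ℝ) : S → ℝ := res M γ w (dot M.r w)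

/-- The state-action values of the policy with matrix `w`. -/
def qval (w : S → A → ℝ) : S → A → ℝ := fun s a => M.r s a + (γ : ℝ) * expect (M.P s a) (val M γ w)

theorem dot_qval (w w' : S → A → ℝ) :
    dot (qval M γ w) w' = dot M.r w' + (γ : ℝ) • stepOp M w' (val M γ w) := by
  ext s
  simp only [dot, qval, stepOp_apply, Pi.add_apply, Pi.smul_apply, smul_eq_mul, mul_add,
    Finset.sum_add_distrib, Finset.mul_sum]
  congr 1
  exact Finset.sum_congr rfl fun a _ => by ring

theorem val_eq (π : Policy S A) : val M γ π.mat = dot (qval M γ π.mat) π.mat := by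
  rw [dot_qval]
  exact res_apply_eq M γ π _

theorem dot_r_mem (π : Policy S A) (s : S) : 0 ≤ dot M.r π.mat s ∧ dot M.r π.mat s ≤ 1 := by
  constructor
  · exact Finset.sum_nonneg fun a _ => mul_nonneg (mat_nonneg π s a) (M.r_mem s a).1
  · rw [← sum_mat π s]
    exact Finset.sum_le_sum fun a _ =>
      mul_le_of_le_one_right (mat_nonneg π s a) (M.r_mem s a).2

theorem val_nonneg (π : Policy S A) (s : S) : 0 ≤ val M γ π.mat s :=
  res_nonneg M γ π (fun s => (dot_r_mem M π s).1) s

theorem val_le (π : Policy S A) (s : S) : val M γ π.mat s ≤ 1 / (1 - (γ : ℝ)) := by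
  have := res_mono M γ π (h' := fun _ => 1) (fun s => (dot_r_mem M π s).2) s
  rwa [res_const] at this

theorem qval_nonneg (π : Policy S A) (s : S) (a : A) : 0 ≤ qval M γ π.mat s a :=
  add_nonneg (M.r_mem s a).1 (mul_nonneg γ.2.1 (expect_nonneg _ (val_nonneg M γ π)))

theorem qval_le (π : Policy S A) (s : S) (a : A) : qval M γ π.mat s a ≤ 1 / (1 - (γ : ℝ)) := by
  have hg := one_sub_pos γ
  have h1 : expect (M.P s a) (val M γ π.mat) ≤ 1 / (1 - (γ : ℝ)) := by
    rw [← expect_const (M.P s a) (1 / (1 - (γ : ℝ)))]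
    exact expect_mono_fintype _ (val_le M γ π)
  have h2 : (1 : ℝ) + γ * (1 / (1 - (γ : ℝ))) = 1 / (1 - (γ : ℝ)) := by field_simp; ring
  rw [← h2]
  exact add_le_add (M.r_mem s a).2 (mul_le_mul_of_nonneg_left h1 γ.2.1)

theorem abs_qval_le (π : Policy S A) (s : S) (a : A) :
    |qval M γ π.mat s a| ≤ 1 / (1 - (γ : ℝ)) := by
  rw [abs_of_nonneg (qval_nonneg M γ π s a)]
  exact qval_le M γ π s a

theorem expect_actionLaw (π : Policy S A) (s : S) (f : A → ℝ) :
    expect (actionLaw π s) f = ∑ a, π.mat s a * f a := by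
  rw [expect_fintype]
  refine Finset.sum_congr rfl fun a _ => ?_
  rw [actionLaw, PMF.ofFintype_apply, ENNReal.toReal_ofReal (mat_nonneg π s a)]

theorem expect_startLaw (π : Policy S A) (ν : PMF S) (f : S → A → ℝ) :
    expect (startLaw π ν) (fun x => f x.1 x.2) = expect ν (dot f π.mat) := by
  rw [startLaw, expect_bind_fintype]
  congr 1; ext s
  rw [expect_bind_fintype]
  simp only [expect_pure, expect_actionLaw]
  rfl

/-- The expectation of `f` at the next state-action pair. -/
def nextMean (π : Policy S A) (f : S → A → ℝ) : S → A → ℝ := fun s a =>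
  expect (M.P s a) (dot f π.mat)

theorem dot_nextMean (π : Policy S A) (f : S → A → ℝ) :
    dot (nextMean M π f) π.mat = stepOp M π.mat (dot f π.mat) := rfl

theorem expect_pairLaw (π : Policy S A) (p : PMF (S × A)) (t : ℕ) (f : S → A → ℝ) :
    expect (pairLaw M π p t) (fun x => f x.1 x.2) =
      expect p fun x => ((nextMean M π)^[t] f) x.1 x.2 := by
  induction t generalizing f with
  | zero => rfl
  | succ t ih =>
    rw [pairLaw, expect_bind_fintype, Function.iterate_succ_apply, ← ih]
    simp only [expect_startLaw]
    rfl

/-- Averaging over the action intertwines the evolution of state-action pairs with that of states.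
-/
theorem dot_iterate_nextMean (π : Policy S A) (t : ℕ) (f : S → A → ℝ) :
    dot ((nextMean M π)^[t] f) π.mat = (stepOp M π.mat ^ t) (dot f π.mat) := by
  induction t with
  | zero => rfl
  | succ t ih =>
    rw [Function.iterate_succ_apply', dot_nextMean, ih, pow_succ']
    rfl

theorem expect_stateLaw (π : Policy S A) (ν : PMF S) (t : ℕ) (h : S → ℝ) :
    expect (stateLaw M π ν t) h = expect ν ((stepOp M π.mat ^ t) h) := by
  induction t generalizing h with
  | zero => rfl
  | succ t ih =>
    rw [stateLaw, expect_bind_fintype, pow_succ]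
    refine Eq.trans ?_ (ih (stepOp M π.mat h))
    congr 1; ext s
    rw [expect_bind_fintype, expect_actionLaw]
    rfl

theorem expect_geom (f : ℕ → ℝ) :
    expect (geom γ) f = (1 - (γ : ℝ)) * ∑' n : ℕ, (γ : ℝ) ^ n * f n := by
  rw [expect, ← tsum_mul_left]
  congr 1; ext n
  have : (geom γ n).toReal = (1 - (γ : ℝ)) * (γ : ℝ) ^ n :=
    ENNReal.toReal_ofReal (mul_nonneg (one_sub_pos γ).le (pow_nonneg γ.2.1 n))
  rw [this, mul_assoc]

/-- A geometric clock weighs time `t` by `(1-γ)γ^t`, so stopping at it samples the normalized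
Neumann series exactly. This is the source of unbiasedness. -/
theorem expect_geom_stateLaw (π : Policy S A) (ν : PMF S) (h : S → ℝ) :
    expect (geom γ) (fun t => expect (stateLaw M π ν t) h) =
      (1 - (γ : ℝ)) * expect ν (res M γ π.mat h) := by
  rw [expect_geom]
  congr 1
  simp only [expect_stateLaw, ← expect_linear_smul]
  exact (hasSum_expect fun s => hasSum_res M γ π h s).tsum_eq

theorem hasSum_qval (π : Policy S A) (s : S) (a : A) :
    HasSum (fun n : ℕ => (γ : ℝ) ^ n * expect (pairLaw M π (PMF.pure (s, a)) n)
      (fun x => M.r x.1 x.2)) (qval M γ π.mat s a) := by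
  simp only [expect_pairLaw, expect_pure]
  have h1 : HasSum (fun n : ℕ => (γ : ℝ) ^ n * expect (M.P s a)
      ((stepOp M π.mat ^ n) (dot M.r π.mat))) (expect (M.P s a) (val M γ π.mat)) := by
    simp only [← expect_linear_smul]
    exact hasSum_expect fun s => hasSum_res M γ π _ s
  -- Time zero is split off because the first action is prescribed rather than drawn from `π`.
  rw [← hasSum_nat_add_iff' 1]
  have e1 : (fun n : ℕ => (γ : ℝ) ^ (n + 1) * (nextMean M π)^[n + 1] M.r s a) = fun n : ℕ =>
      (γ : ℝ) * ((γ : ℝ) ^ n * expect (M.P s a) ((stepOp M π.mat ^ n) (dot M.r π.mat))) := by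
    ext n
    rw [Function.iterate_succ_apply', nextMean, dot_iterate_nextMean]
    ring
  have e2 : qval M γ π.mat s a - ∑ i ∈ Finset.range 1, (γ : ℝ) ^ i * (nextMean M π)^[i] M.r s a =
      (γ : ℝ) * expect (M.P s a) (val M γ π.mat) := by
    simp [qval]
  rw [e1, e2]
  exact h1.mul_left (γ : ℝ)

theorem Q_eq_qval (π : Policy S A) : Q M γ π = qval M γ π.mat := by
  ext s a
  rw [Q, ← (hasSum_qval M γ π s a).tsum_eq]
  simp only [expect_fintype]

theorem expect_geom_pairLaw (π : Policy S A) (s : S) (a : A) :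
    expect (geom γ) (fun n => expect (pairLaw M π (PMF.pure (s, a)) n) (fun x => M.r x.1 x.2)) =
      (1 - (γ : ℝ)) * qval M γ π.mat s a := by
  rw [expect_geom, (hasSum_qval M γ π s a).tsum_eq]

theorem V_eq (π : Policy S A) (ν : PMF S) : V M γ π ν = expect ν (val M γ π.mat) := by
  rw [V, expect_fintype]
  refine Finset.sum_congr rfl fun s _ => ?_
  rw [Vstate, Q_eq_qval, val_eq]
  rfl

theorem summable_occPair (π : Policy S A) (ν : PMF S) (s : S) (a : A) :
    Summable fun t : ℕ => (γ : ℝ) ^ t * (pairLaw M π (startLaw π ν) t (s, a)).toReal := by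
  refine Summable.of_norm_bounded (summable_geometric_of_lt_one γ.2.1 γ.2.2) fun t => ?_
  rw [Real.norm_eq_abs, abs_of_nonneg (mul_nonneg (pow_nonneg γ.2.1 t) ENNReal.toReal_nonneg)]
  exact mul_le_of_le_one_right (pow_nonneg γ.2.1 t)
    (ENNReal.toReal_mono ENNReal.one_ne_top (PMF.coe_le_one _ _))

theorem sum_occ_mul (π : Policy S A) (ν : PMF S) (h : S → ℝ) :
    ∑ s, occ M γ π ν s * h s = (1 - (γ : ℝ)) * expect ν (res M γ π.mat h) := by
  have h1 : ∀ t, expect (pairLaw M π (startLaw π ν) t) (fun x => h x.1) =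
      expect ν ((stepOp M π.mat ^ t) h) := by
    intro t
    rw [expect_pairLaw M π _ t fun s _ => h s, expect_startLaw, dot_iterate_nextMean]
    congr 2; ext s
    rw [dot, ← Finset.sum_mul, sum_mat, one_mul]
  have h2 : HasSum (fun t : ℕ => (γ : ℝ) ^ t * expect ν ((stepOp M π.mat ^ t) h))
      (expect ν (res M γ π.mat h)) := by
    simp only [← expect_linear_smul]
    exact hasSum_expect fun s => hasSum_res M γ π h s
  simp only [occ, occPair, ← Finset.mul_sum, mul_assoc]
  rw [← h2.tsum_eq]
  simp only [← h1, expect_fintype]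
  simp only [Fintype.sum_prod_type, Finset.mul_sum, Finset.sum_mul, ← tsum_mul_left,
    ← tsum_mul_right]
  rw [Summable.tsum_finsetSum]
  · refine Finset.sum_congr rfl fun s _ => ?_
    rw [Summable.tsum_finsetSum]
    · refine Finset.sum_congr rfl fun a _ => ?_
      congr 1; ext t; ring
    · intro a _
      have := ((summable_occPair M γ π ν s a).mul_right (h s)).mul_left (1 - (γ : ℝ))
      simpa [mul_assoc] using this
  · intro s _
    refine summable_sum fun a _ => ?_
    have := ((summable_occPair M γ π ν s a).mul_right (h s)).mul_left (1 - (γ : ℝ))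
    simpa [mul_assoc] using this

end Operators

/-! ### The policy gradient, its derivative, and the samplers -/

section Gradient

variable {S : Type u} {A : Type v} [Fintype S] [Fintype A] (M : MDP S A) (γ : Discount) (μ : PMF S)

/-- The derivative of `w ↦ V^w_μ` at `w` in the direction `w'`. -/
def grad (w w' : S → A → ℝ) : ℝ := expect μ (res M γ w (dot (qval M γ w) w'))

/-- The bilinear form whose symmetrization is the second derivative of `w ↦ V^w_μ`,
up to the factor `γ`. -/
def hess (w w₁ w₂ : S → A → ℝ) : ℝ :=
  expect μ (res M γ w (stepOp M w₁ (res M γ w (dot (qval M γ w) w₂))))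

theorem grad_add (w w₁ w₂ : S → A → ℝ) :
    grad M γ μ w (w₁ + w₂) = grad M γ μ w w₁ + grad M γ μ w w₂ := by
  simp only [grad, dot_add, map_add, expect_linear_add]

theorem grad_sub (w w₁ w₂ : S → A → ℝ) :
    grad M γ μ w (w₁ - w₂) = grad M γ μ w w₁ - grad M γ μ w w₂ := by
  simp only [grad, dot_sub, map_sub, expect_linear_sub]

theorem grad_smul (w w₁ : S → A → ℝ) (c : ℝ) :
    grad M γ μ w (c • w₁) = c * grad M γ μ w w₁ := by
  simp only [grad, dot_smul, map_smul, expect_linear_smul]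

theorem abs_dot_qval_le (π : Policy S A) {w : S → A → ℝ} {B : ℝ} (hw : ∀ s, ∑ a, |w s a| ≤ B)
    (s : S) : |dot (qval M γ π.mat) w s| ≤ B * (1 / (1 - (γ : ℝ))) :=
  abs_sum_mul_le (hw s) (by have := one_sub_pos γ; positivity) (abs_qval_le M γ π s)

theorem abs_grad_le (π : Policy S A) {w : S → A → ℝ} {B : ℝ} (hw : ∀ s, ∑ a, |w s a| ≤ B) :
    |grad M γ μ π.mat w| ≤ B / (1 - (γ : ℝ)) ^ 2 := by
  have := one_sub_pos γ
  refine (abs_expect_le μ (abs_res_le M γ π (abs_dot_qval_le M γ π hw))).trans (le_of_eq ?_)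
  field_simp

/-- The matrices on the segment from `π` to `π'`. -/
def segMat (π π' : Policy S A) (b : ℝ) : S → A → ℝ := π.mat - b • (π.mat - π'.mat)

theorem mat_mix (b : unitInterval) (π π' : Policy S A) :
    (mix b π π').mat = segMat π π' b := by
  ext s a
  simp only [mix, Policy.mat, segMat, Pi.add_apply, Pi.sub_apply, Pi.smul_apply, smul_eq_mul]
  ring

variable (π π' : Policy S A)

/-- The operator to be inverted is affine in `b` with slope `γ P_Δ`, and the derivative of inversion
is `-R (·) R`. For `b ∈ [0,1]` the matrix belongs to a mixed policy, which makes the operator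
invertible. -/
theorem hasDerivAt_res_seg (b : unitInterval) :
    HasDerivAt (fun b : ℝ => res M γ (segMat π π' b))
      (-(res M γ (segMat π π' b) * ((γ : ℝ) • stepOp M (π.mat - π'.mat)) *
        res M γ (segMat π π' b))) (b : ℝ) := by
  have e : ∀ x : ℝ, 1 - (γ : ℝ) • stepOp M (segMat π π' x) =
      (1 - (γ : ℝ) • stepOp M π.mat) + x • ((γ : ℝ) • stepOp M (π.mat - π'.mat)) := by
    intro x
    rw [segMat, stepOp_sub, stepOp_smul, smul_sub, smul_comm (γ : ℝ) x]
    abel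
  have h1 : HasDerivAt (fun x : ℝ => 1 - (γ : ℝ) • stepOp M (segMat π π' x))
      ((γ : ℝ) • stepOp M (π.mat - π'.mat)) (b : ℝ) := by
    simp only [e]
    simpa using ((hasDerivAt_id (b : ℝ)).smul_const
      ((γ : ℝ) • stepOp M (π.mat - π'.mat))).const_add (1 - (γ : ℝ) • stepOp M π.mat)
  obtain ⟨x, hx⟩ := isUnit_one_sub M γ (mix b π π')
  rw [mat_mix] at hx
  have h2 : HasFDerivAt Ring.inverse _ (1 - (γ : ℝ) • stepOp M (segMat π π' b)) :=
    hx ▸ hasFDerivAt_ringInverse (𝕜 := ℝ) x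
  have h3 := h2.comp_hasDerivAt (b : ℝ) h1
  have h4 : res M γ (segMat π π' b) = ((x⁻¹ : ((S → ℝ) →L[ℝ] (S → ℝ))ˣ) : (S → ℝ) →L[ℝ] (S → ℝ)) := by
    rw [res, ← hx, Ring.inverse_unit]
  rw [h4]
  simpa using! h3

theorem hasDerivAt_dot_seg (f : S → A → ℝ) (b : ℝ) :
    HasDerivAt (fun b : ℝ => dot f (segMat π π' b)) (-dot f (π.mat - π'.mat)) b := by
  have e : (fun b : ℝ => dot f (segMat π π' b)) =
      fun b : ℝ => dot f π.mat - b • dot f (π.mat - π'.mat) := by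
    ext1 b
    rw [segMat, dot_sub, dot_smul]
  rw [e]
  exact (((hasDerivAt_id b).smul_const (dot f (π.mat - π'.mat))).const_sub
    (dot f π.mat)).congr_deriv (by rw [one_smul])

/-- The policy gradient theorem along a segment: the derivatives of the resolvent and of the reward
combine, by `dot_qval`, into the resolvent of `Q·Δ`. -/
theorem hasDerivAt_val_seg (b : unitInterval) :
    HasDerivAt (fun b : ℝ => val M γ (segMat π π' b))
      (-res M γ (segMat π π' b) (dot (qval M γ (segMat π π' b)) (π.mat - π'.mat))) (b : ℝ) := by
  have h := (hasDerivAt_res_seg M γ π π' b).clm_apply (hasDerivAt_dot_seg π π' M.r b)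
  refine h.congr_deriv ?_
  rw [dot_qval, map_add, map_neg, neg_add, add_comm]
  rfl

theorem hasDerivAt_dot_qval_seg (w : S → A → ℝ) (b : unitInterval) :
    HasDerivAt (fun b : ℝ => dot (qval M γ (segMat π π' b)) w)
      (-((γ : ℝ) • stepOp M w (res M γ (segMat π π' b)
        (dot (qval M γ (segMat π π' b)) (π.mat - π'.mat))))) (b : ℝ) := by
  simp only [dot_qval M γ _ w]
  have h := (((stepOp M w).hasFDerivAt.comp_hasDerivAt (b : ℝ)
    (hasDerivAt_val_seg M γ π π' b)).const_smul (γ : ℝ)).const_add (dot M.r w)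
  refine h.congr_deriv ?_
  rw [map_neg, smul_neg]

/-- The expectation as a continuous linear functional. -/
def expectL : (S → ℝ) →L[ℝ] ℝ :=
  LinearMap.toContinuousLinearMap
    { toFun := expect μ
      map_add' := expect_linear_add
      map_smul' := expect_linear_smul }

/-- The base point enters `grad` through the resolvent and through `Q`. The product rule yields one
ordering of the bilinear form `hess` from each, so the symmetrized form appears. -/
theorem hasDerivAt_grad_seg (w : S → A → ℝ) (b : unitInterval) :
    HasDerivAt (fun b : ℝ => grad M γ μ (segMat π π' b) w)
      (-((γ : ℝ) * (hess M γ μ (segMat π π' b) (π.mat - π'.mat) w +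
        hess M γ μ (segMat π π' b) w (π.mat - π'.mat)))) (b : ℝ) := by
  have h := (expectL μ).hasFDerivAt.comp_hasDerivAt (b : ℝ)
    ((hasDerivAt_res_seg M γ π π' b).clm_apply (hasDerivAt_dot_qval_seg M γ π π' w b))
  refine h.congr_deriv ?_
  rw [map_add]
  set R := res M γ (segMat π π' b)
  set Δ := π.mat - π'.mat
  have e1 : expectL μ ((-(R * ((γ : ℝ) • stepOp M Δ) * R)) (dot (qval M γ (segMat π π' b)) w)) =
      -(γ * hess M γ μ (segMat π π' b) Δ w) := by
    change expectL μ (-(R ((γ : ℝ) • stepOp M Δ (R (dot (qval M γ (segMat π π' b)) w))))) = _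
    rw [map_neg, map_smul, map_smul]
    rfl
  have e2 : expectL μ (R (-((γ : ℝ) • stepOp M w (R (dot (qval M γ (segMat π π' b)) Δ))))) =
      -(γ * hess M γ μ (segMat π π' b) w Δ) := by
    rw [map_neg, map_neg, map_smul, map_smul]
    rfl
  rw [e1, e2]
  ring

theorem continuousOn_hess_seg (w : S → A → ℝ) :
    ContinuousOn (fun b : ℝ => hess M γ μ (segMat π π' b) (π.mat - π'.mat) w +
        hess M γ μ (segMat π π' b) w (π.mat - π'.mat)) (Set.Icc 0 1) := by
  intro b hb
  refine ContinuousAt.continuousWithinAt ?_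
  have hr : ContinuousAt (fun b : ℝ => res M γ (segMat π π' b)) b :=
    (hasDerivAt_res_seg M γ π π' ⟨b, hb⟩).continuousAt
  have key : ∀ w₁ w₂ : S → A → ℝ,
      ContinuousAt (fun b : ℝ => hess M γ μ (segMat π π' b) w₁ w₂) b := by
    intro w₁ w₂
    have hq : ContinuousAt (fun b : ℝ => dot (qval M γ (segMat π π' b)) w₂) b :=
      (hasDerivAt_dot_qval_seg M γ π π' w₂ ⟨b, hb⟩).continuousAt
    exact (expectL μ).continuous.continuousAt.comp
      (hr.clm_apply ((stepOp M w₁).continuous.continuousAt.comp (hr.clm_apply hq)))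
  exact (key _ _).add (key _ _)

/-- The fundamental theorem of calculus on the segment. Averaging over a uniform `b` gives the exact
increment of the gradient, where the Hessian at one endpoint would leave a bias. -/
theorem integral_hess_seg (w : S → A → ℝ) :
    ∫ b : unitInterval, (γ : ℝ) * (hess M γ μ (segMat π π' b) (π.mat - π'.mat) w +
        hess M γ μ (segMat π π' b) w (π.mat - π'.mat)) =
      grad M γ μ π.mat w - grad M γ μ π'.mat w := by
  have hI : Set.uIcc (0 : ℝ) 1 = Set.Icc 0 1 := Set.uIcc_of_le zero_le_one
  have h1 := intervalIntegral.integral_eq_sub_of_hasDerivAt (a := 0) (b := 1)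
    (f := fun b : ℝ => grad M γ μ (segMat π π' b) w)
    (f' := fun b : ℝ => -((γ : ℝ) * (hess M γ μ (segMat π π' b) (π.mat - π'.mat) w +
        hess M γ μ (segMat π π' b) w (π.mat - π'.mat))))
    (fun x hx => hasDerivAt_grad_seg M γ μ π π' w ⟨x, by rwa [hI] at hx⟩)
    (by
      refine ContinuousOn.intervalIntegrable ?_
      rw [hI]
      exact (continuousOn_const.mul (continuousOn_hess_seg M γ μ π π' w)).neg)
  have h2 : ∫ b : unitInterval, (γ : ℝ) * (hess M γ μ (segMat π π' b) (π.mat - π'.mat) w +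
        hess M γ μ (segMat π π' b) w (π.mat - π'.mat)) =
      ∫ b in (0 : ℝ)..1, (γ : ℝ) * (hess M γ μ (segMat π π' b) (π.mat - π'.mat) w +
        hess M γ μ (segMat π π' b) w (π.mat - π'.mat)) := by
    rw [intervalIntegral.integral_of_le zero_le_one,
      ← MeasureTheory.integral_Icc_eq_integral_Ioc]
    exact MeasureTheory.integral_subtype_comap measurableSet_Icc
      (fun b : ℝ => (γ : ℝ) * (hess M γ μ (segMat π π' b) (π.mat - π'.mat) w +
        hess M γ μ (segMat π π' b) w (π.mat - π'.mat)))
  rw [h2]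
  rw [intervalIntegral.integral_neg] at h1
  have e0 : segMat π π' 0 = π.mat := by simp [segMat]
  have e1 : segMat π π' 1 = π'.mat := by simp [segMat]
  simp only [e0, e1] at h1
  linarith

variable [Nonempty A]

theorem abs_r_le (s : S) (a : A) : |M.r s a| ≤ 1 := by
  rw [abs_of_nonneg (M.r_mem s a).1]
  exact (M.r_mem s a).2

/-- Each of the two clocks contributes `1-γ` and the uniform action `1/A`; the factors in `Q̂` and
in the appended loss undo exactly this normalization. -/
theorem expect_qSampler (w : S → A → ℝ) :
    expect (qSampler M γ π μ) (fun e => w e.s e.a * M.r e.sEnd e.aEnd) =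
      (1 - (γ : ℝ)) ^ 2 / Fintype.card A * grad M γ μ π.mat w := by
  obtain ⟨C, hC⟩ := exists_abs_le fun x : S × A => w x.1 x.2
  have hf : ∀ e : QEpisode S A, |w e.s e.a * M.r e.sEnd e.aEnd| ≤ C * 1 := fun e => by
    rw [abs_mul]
    exact mul_le_mul (hC (e.s, e.a)) (abs_r_le M _ _) (abs_nonneg _)
      ((abs_nonneg _).trans (hC (e.s, e.a)))
  simp only [qSampler, expect_bind _ _ hf, expect_pure, expect_mul_left, expect_geom_pairLaw,
    expect_uniform]
  have e : ∀ s, ∑ a, w s a * ((1 - (γ : ℝ)) * qval M γ π.mat s a) =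
      (1 - (γ : ℝ)) * dot (qval M γ π.mat) w s := fun s => by
    simp only [dot, Finset.mul_sum]
    exact Finset.sum_congr rfl fun a _ => by ring
  simp only [e, expect_mul_left, expect_geom_stateLaw]
  rw [grad]
  ring

/-- The three clocks produce, in order, the outer resolvent, the inner resolvent and `Q`. The free
action at `s₁` lets `w₁` act as a signed weight on the transition, and the one at `s₂` does the same
for `w₂` on `Q`. -/
theorem expect_hSampler (w₁ w₂ : S → A → ℝ) :
    expect (hSampler M γ π μ)
        (fun e => w₁ e.s₁ e.a₁ * (w₂ e.s₂ e.a₂ * M.r e.sEnd e.aEnd)) =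
      (1 - (γ : ℝ)) ^ 3 / (Fintype.card A : ℝ) ^ 2 * hess M γ μ π.mat w₁ w₂ := by
  obtain ⟨C₁, hC₁⟩ := exists_abs_le fun x : S × A => w₁ x.1 x.2
  obtain ⟨C₂, hC₂⟩ := exists_abs_le fun x : S × A => w₂ x.1 x.2
  have hf : ∀ e : HEpisode S A,
      |w₁ e.s₁ e.a₁ * (w₂ e.s₂ e.a₂ * M.r e.sEnd e.aEnd)| ≤ C₁ * (C₂ * 1) := fun e => by
    rw [abs_mul, abs_mul]
    have h2 := (abs_nonneg _).trans (hC₂ (e.s₂, e.a₂))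
    refine mul_le_mul (hC₁ (e.s₁, e.a₁)) (mul_le_mul (hC₂ (e.s₂, e.a₂)) (abs_r_le M _ _)
      (abs_nonneg _) h2) (by positivity) ((abs_nonneg _).trans (hC₁ (e.s₁, e.a₁)))
  simp only [hSampler, expect_bind _ _ hf, expect_pure, expect_mul_left, expect_geom_pairLaw,
    expect_uniform]
  have e : ∀ s, ∑ a, w₂ s a * ((1 - (γ : ℝ)) * qval M γ π.mat s a) =
      (1 - (γ : ℝ)) * dot (qval M γ π.mat) w₂ s := fun s => by
    simp only [dot, Finset.mul_sum]
    exact Finset.sum_congr rfl fun a _ => by ring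
  simp only [e, expect_mul_left, fun s a => expect_geom_stateLaw M γ π (M.P s a)]
  have e' : ∀ s, ∑ a, w₁ s a * ((Fintype.card A : ℝ)⁻¹ * ((1 - (γ : ℝ)) * ((1 - (γ : ℝ)) *
      expect (M.P s a) (res M γ π.mat (dot (qval M γ π.mat) w₂))))) =
      ((Fintype.card A : ℝ)⁻¹ * (1 - (γ : ℝ)) ^ 2) *
        stepOp M w₁ (res M γ π.mat (dot (qval M γ π.mat) w₂)) s := fun s => by
    simp only [stepOp_apply, dot, Finset.mul_sum]
    exact Finset.sum_congr rfl fun a _ => by ring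
  simp only [e', expect_mul_left, expect_geom_stateLaw]
  rw [hess]
  ring

theorem expect_hSamplerMixed {f : HEpisode S A → ℝ} {C : ℝ} (hf : ∀ e, |f e| ≤ C) :
    expect (hSamplerMixed M γ π π' μ) f =
      ∫ b : unitInterval, expect (hSampler M γ (mix b π π') μ) f := by
  have h1 : ∀ e, (hSamplerMixed M γ π π' μ e).toReal =
      ∫ b : unitInterval, (hSampler M γ (mix b π π') μ e).toReal := fun e =>
    (MeasureTheory.integral_toReal (meas_hSampler M γ π π' μ e).aemeasurable
      (Filter.Eventually.of_forall fun b => (PMF.apply_ne_top _ _).lt_top)).symm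
  simp only [expect, h1, ← MeasureTheory.integral_mul_const]
  rw [MeasureTheory.integral_tsum]
  · intro e
    exact ((meas_hSampler M γ π π' μ e).ennreal_toReal.mul_const _).aestronglyMeasurable
  · have hle : ∀ e, ∫⁻ b : unitInterval, ‖(hSampler M γ (mix b π π') μ e).toReal * f e‖ₑ ≤
        hSamplerMixed M γ π π' μ e * ENNReal.ofReal C := fun e => by
      change _ ≤ (∫⁻ b : unitInterval, hSampler M γ (mix b π π') μ e) * _
      rw [← MeasureTheory.lintegral_mul_const _ (meas_hSampler M γ π π' μ e)]
      refine MeasureTheory.lintegral_mono fun b => ?_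
      rw [enorm_mul, Real.enorm_of_nonneg ENNReal.toReal_nonneg,
        ENNReal.ofReal_toReal (PMF.apply_ne_top _ _), Real.enorm_eq_ofReal_abs]
      gcongr
      exact hf e
    refine ne_top_of_le_ne_top ?_ (ENNReal.tsum_le_tsum hle)
    rw [ENNReal.tsum_mul_right, PMF.tsum_coe, one_mul]
    exact ENNReal.ofReal_ne_top

/-- The two products are the two orderings of the symmetrized Hessian, which is why the algorithm
appends two examples per H-episode. -/
theorem expect_hSamplerMixed_eq (w : S → A → ℝ) :
    expect (hSamplerMixed M γ π π' μ) (fun e =>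
        (w e.s₁ e.a₁ * (π.mat - π'.mat) e.s₂ e.a₂ + (π.mat - π'.mat) e.s₁ e.a₁ * w e.s₂ e.a₂) *
          M.r e.sEnd e.aEnd) * (γ * (Fintype.card A : ℝ) ^ 2 / (1 - (γ : ℝ)) ^ 3) =
      grad M γ μ π.mat w - grad M γ μ π'.mat w := by
  have hg := one_sub_pos γ
  have hA : (0 : ℝ) < Fintype.card A := Nat.cast_pos.2 Fintype.card_pos
  set Δ := π.mat - π'.mat
  obtain ⟨C₁, hC₁⟩ := exists_abs_le fun x : S × A => w x.1 x.2
  obtain ⟨C₂, hC₂⟩ := exists_abs_le fun x : S × A => Δ x.1 x.2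
  have hf : ∀ e : HEpisode S A, |w e.s₁ e.a₁ * (Δ e.s₂ e.a₂ * M.r e.sEnd e.aEnd)| ≤
      C₁ * (C₂ * 1) := fun e => by
    rw [abs_mul, abs_mul]
    have h2 := (abs_nonneg _).trans (hC₂ (e.s₂, e.a₂))
    refine mul_le_mul (hC₁ (e.s₁, e.a₁)) (mul_le_mul (hC₂ (e.s₂, e.a₂)) (abs_r_le M _ _)
      (abs_nonneg _) h2) (by positivity) ((abs_nonneg _).trans (hC₁ (e.s₁, e.a₁)))
  have hf' : ∀ e : HEpisode S A, |Δ e.s₁ e.a₁ * (w e.s₂ e.a₂ * M.r e.sEnd e.aEnd)| ≤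
      C₂ * (C₁ * 1) := fun e => by
    rw [abs_mul, abs_mul]
    have h2 := (abs_nonneg _).trans (hC₁ (e.s₂, e.a₂))
    refine mul_le_mul (hC₂ (e.s₁, e.a₁)) (mul_le_mul (hC₁ (e.s₂, e.a₂)) (abs_r_le M _ _)
      (abs_nonneg _) h2) (by positivity) ((abs_nonneg _).trans (hC₂ (e.s₁, e.a₁)))
  simp only [add_mul, mul_assoc]
  rw [expect_hSamplerMixed M γ μ π π' fun e => (abs_add_le _ _).trans (add_le_add (hf e) (hf' e)),
    ← integral_hess_seg, ← MeasureTheory.integral_mul_const]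
  congr 1; ext b
  rw [expect_add _ hf hf', expect_hSampler, expect_hSampler, mat_mix]
  field_simp
  ring

end Gradient

/-! ### Performance differences -/

section Performance

variable {S : Type u} {A : Type v} [Fintype S] [Fintype A] (M : MDP S A) (γ : Discount) (μ : PMF S)

theorem sum_abs_mat_sub_le (π π' : Policy S A) (s : S) :
    ∑ a, |(π'.mat - π.mat) s a| ≤ 2 := by
  have h : ∑ a, |(π'.mat - π.mat) s a| ≤ ∑ a, (|π'.mat s a| + |π.mat s a|) :=
    Finset.sum_le_sum fun a _ => abs_sub _ _
  rw [Finset.sum_add_distrib, sum_abs_mat, sum_abs_mat] at h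
  linarith

/-- The performance difference lemma. -/
theorem val_sub_val (π π' : Policy S A) :
    val M γ π'.mat - val M γ π.mat =
      res M γ π'.mat (dot (qval M γ π.mat) (π'.mat - π.mat)) := by
  rw [dot_sub, ← val_eq, dot_qval]
  have h := res_apply_sub M γ π' (val M γ π.mat)
  rw [map_sub] at h
  rw [map_sub, map_add, add_sub_assoc, ← neg_sub (res M γ π'.mat (val M γ π.mat)), h]
  rw [← sub_eq_add_neg]
  rfl

/-- The resolvent identity `R' = R + R' γ(P' - P) R`, obtained by applying `R'` to `h = (1 - γP')Rh
+ γ(P' - P)Rh`. -/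
theorem res_apply_eq_res_add (π π' : Policy S A) (h : S → ℝ) :
    res M γ π'.mat h = res M γ π.mat h +
      res M γ π'.mat ((γ : ℝ) • stepOp M (π'.mat - π.mat) (res M γ π.mat h)) := by
  set y := res M γ π.mat h with hy
  have h1 : h = (y - (γ : ℝ) • stepOp M π'.mat y) +
      (γ : ℝ) • stepOp M (π'.mat - π.mat) y := by
    have := res_apply_eq M γ π h
    rw [← hy] at this
    rw [stepOp_sub]
    change h = y - (γ : ℝ) • stepOp M π'.mat y +
      (γ : ℝ) • (stepOp M π'.mat y - stepOp M π.mat y)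
    rw [smul_sub, sub_add_sub_cancel]
    exact eq_sub_of_add_eq this.symm
  conv_lhs => rw [h1]
  rw [map_add, res_apply_sub]

theorem mat_mix_sub (c : unitInterval) (π π' : Policy S A) :
    (mix c π π').mat - π.mat = (c : ℝ) • (π'.mat - π.mat) := by
  rw [mat_mix, segMat]
  module

/-- By the performance difference lemma the gain is exactly `η E_μ R_mix h` with `h = Q·(π' - π)`.
Replacing `R_mix` by `R_π` gives the gradient; by the resolvent identity it costs at most
`4η/(1-γ)³`: `2/(1-γ)` for `h`, `1/(1-γ)` for each of two resolvents, and `2η` for the change of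
transition operator. -/
theorem V_mix_ge (η : unitInterval) (π π' : Policy S A) :
    V M γ π μ + η * grad M γ μ π.mat (π'.mat - π.mat) - 4 * (η : ℝ) ^ 2 / (1 - (γ : ℝ)) ^ 3 ≤
      V M γ (mix η π π') μ := by
  have hg := one_sub_pos γ
  have hη := η.2.1
  have hγ := γ.2.1
  have hγ1 := γ.2.2
  set h := dot (qval M γ π.mat) (π'.mat - π.mat)
  have hb : ∀ s, |h s| ≤ 2 * (1 / (1 - (γ : ℝ))) := abs_dot_qval_le M γ π (sum_abs_mat_sub_le π π')
  have hy := abs_res_le M γ π hb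
  have hstep : ∀ s, |((γ : ℝ) • stepOp M ((mix η π π').mat - π.mat) (res M γ π.mat h)) s| ≤
      η * (2 * (2 * (1 / (1 - (γ : ℝ))) / (1 - (γ : ℝ)))) := by
    intro s
    have h1 := abs_stepOp_le M (sum_abs_mat_sub_le π π') (by positivity) hy s
    rw [mat_mix_sub, stepOp_smul]
    change |(γ : ℝ) * ((η : ℝ) * stepOp M (π'.mat - π.mat) (res M γ π.mat h) s)| ≤ _
    rw [abs_mul, abs_mul, abs_of_nonneg hγ, abs_of_nonneg hη]
    refine (mul_le_of_le_one_left (by positivity) hγ1.le).trans ?_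
    gcongr
  have hD := abs_expect_le μ (abs_res_le M γ (mix η π π') hstep)
  have e1 : V M γ (mix η π π') μ - V M γ π μ = η * expect μ (res M γ (mix η π π').mat h) := by
    rw [V_eq, V_eq, ← expect_linear_sub, val_sub_val, mat_mix_sub, dot_smul, map_smul,
      expect_linear_smul]
  rw [res_apply_eq_res_add M γ π, expect_linear_add] at e1
  have e2 : grad M γ μ π.mat (π'.mat - π.mat) = expect μ (res M γ π.mat h) := rfl
  rw [e2]
  have h3 := mul_le_mul_of_nonneg_left (abs_le.1 hD).1 hη
  have e3 : (η : ℝ) * -(η * (2 * (2 * (1 / (1 - (γ : ℝ))) / (1 - (γ : ℝ)))) / (1 - (γ : ℝ))) =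
      -(4 * (η : ℝ) ^ 2 / (1 - (γ : ℝ)) ^ 3) := by
    field_simp; ring
  rw [e3] at h3
  rw [mul_add] at e1
  linarith

theorem V_nonneg (π : Policy S A) : 0 ≤ V M γ π μ := by
  rw [V_eq]
  exact expect_nonneg _ (val_nonneg M γ π)

theorem V_le (π : Policy S A) : V M γ π μ ≤ 1 / (1 - (γ : ℝ)) := by
  rw [V_eq, ← expect_const μ (1 / (1 - (γ : ℝ)))]
  exact expect_mono_fintype _ (val_le M γ π)

variable [Nonempty A]

theorem dot_qval_le_iSup (π π' : Policy S A) (s : S) :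
    dot (qval M γ π.mat) π'.mat s ≤ ⨆ a, qval M γ π.mat s a := by
  rw [← one_mul (⨆ a, _), ← sum_mat π' s, Finset.sum_mul]
  exact Finset.sum_le_sum fun a _ => mul_le_mul_of_nonneg_left
    (le_ciSup (Set.finite_range (qval M γ π.mat s)).bddAbove a) (mat_nonneg π' s a)

theorem iSup_qval_le (π : Policy S A) (s : S) :
    ⨆ a, qval M γ π.mat s a ≤ 1 / (1 - (γ : ℝ)) :=
  ciSup_le (qval_le M γ π s)

theorem dot_qval_nonneg (π π' : Policy S A) (s : S) : 0 ≤ dot (qval M γ π.mat) π'.mat s :=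
  Finset.sum_nonneg fun a _ => mul_nonneg (mat_nonneg π' s a) (qval_nonneg M γ π s a)

theorem sum_occ_regret (π π' : Policy S A) :
    ∑ s, occ M γ π μ s * ((⨆ a, Q M γ π s a) - ∑ a, Q M γ π s a * Policy.mat π' s a) =
      (1 - (γ : ℝ)) * expect μ (res M γ π.mat
        ((fun s => ⨆ a, qval M γ π.mat s a) - dot (qval M γ π.mat) π'.mat)) := by
  rw [← sum_occ_mul, Q_eq_qval]
  simp only [dot, Pi.sub_apply, mul_comm]

theorem sum_occ_regret_nonneg (π π' : Policy S A) :
    0 ≤ ∑ s, occ M γ π μ s * ((⨆ a, Q M γ π s a) - ∑ a, Q M γ π s a * Policy.mat π' s a) := by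
  rw [sum_occ_regret]
  exact mul_nonneg (one_sub_pos γ).le (expect_nonneg _ (res_nonneg M γ π fun s =>
    sub_nonneg.2 (dot_qval_le_iSup M γ π π' s)))

theorem sum_occ_regret_le (π π' : Policy S A) :
    ∑ s, occ M γ π μ s * ((⨆ a, Q M γ π s a) - ∑ a, Q M γ π s a * Policy.mat π' s a) ≤
      1 / (1 - (γ : ℝ)) := by
  have hg := one_sub_pos γ
  rw [sum_occ_regret]
  have h : ∀ s, ((fun s => ⨆ a, qval M γ π.mat s a) - dot (qval M γ π.mat) π'.mat) s ≤
      1 / (1 - (γ : ℝ)) := fun s =>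
    (sub_le_self _ (dot_qval_nonneg M γ π π' s)).trans (iSup_qval_le M γ π s)
  have h2 := expect_mono_fintype μ (res_mono M γ π h)
  rw [res_const, expect_const] at h2
  calc _ ≤ (1 - (γ : ℝ)) * (1 / (1 - (γ : ℝ)) / (1 - (γ : ℝ))) := by gcongr
    _ = _ := by field_simp

theorem completeness_nonneg (Pi : Set (Policy S A)) : 0 ≤ completeness M γ Pi μ :=
  Real.iSup_nonneg fun π => Real.iInf_nonneg fun π' => sum_occ_regret_nonneg M γ μ π.1 π'.1

/-- A real supremum dominates its terms only for a family bounded above; the regrets lie in `[0,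
1/(1-γ)]`. -/
theorem iInf_le_completeness {Pi : Set (Policy S A)} (hPi : Pi.Nonempty) {π : Policy S A}
    (hπ : π ∈ convHull Pi) :
    (⨅ π' : Pi, ∑ s, occ M γ π μ s *
      ((⨆ a, Q M γ π s a) - ∑ a, Q M γ π s a * Policy.mat π'.1 s a)) ≤ completeness M γ Pi μ := by
  obtain ⟨π₀, hπ₀⟩ := hPi
  refine le_ciSup (f := fun π : convHull Pi => ⨅ π' : Pi, ∑ s, occ M γ π.1 μ s *
    ((⨆ a, Q M γ π.1 s a) - ∑ a, Q M γ π.1 s a * Policy.mat π'.1 s a)) ?_ ⟨π, hπ⟩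
  refine ⟨1 / (1 - (γ : ℝ)), ?_⟩
  rintro _ ⟨π₁, rfl⟩
  refine (ciInf_le ⟨0, ?_⟩ (⟨π₀, hπ₀⟩ : Pi)).trans (sum_occ_regret_le M γ μ π₁.1 π₀)
  rintro _ ⟨π', rfl⟩
  exact sum_occ_regret_nonneg M γ μ π₁.1 π'.1

theorem occ_le_mismatch {πstar : Policy S A} (hm : mismatch M γ πstar μ ≠ ⊤) (s : S) :
    occ M γ πstar M.ρ s ≤ (mismatch M γ πstar μ).toReal * (μ s).toReal := by
  have h1 : ENNReal.ofReal (occ M γ πstar M.ρ s) / μ s ≤ mismatch M γ πstar μ :=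
    le_iSup (fun s => ENNReal.ofReal (occ M γ πstar M.ρ s) / μ s) s
  have h2 : ENNReal.ofReal (occ M γ πstar M.ρ s) ≤ mismatch M γ πstar μ * μ s :=
    (ENNReal.div_le_iff_le_mul (Or.inr hm) (Or.inl (PMF.apply_ne_top _ _))).1 h1
  have h3 := ENNReal.toReal_mono (ENNReal.mul_ne_top hm (PMF.apply_ne_top μ s)) h2
  rw [ENNReal.toReal_mul] at h3
  exact (le_max_left _ _).trans (ENNReal.toReal_ofReal' ▸ h3)

/-- The suboptimality of a policy is controlled by its Frank-Wolfe gap over the class. -/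
theorem V_sub_V_le {Pi : Set (Policy S A)} (hPi : Pi.Nonempty) {π πstar : Policy S A}
    (hπ : π ∈ convHull Pi) (hm : mismatch M γ πstar μ ≠ ⊤) {G : ℝ}
    (hG : ∀ π' ∈ Pi, grad M γ μ π.mat (π'.mat - π.mat) ≤ G) :
    V M γ πstar M.ρ - V M γ π M.ρ ≤ (mismatch M γ πstar μ).toReal * completeness M γ Pi μ
      / (1 - (γ : ℝ)) ^ 2 + (mismatch M γ πstar μ).toReal * G / (1 - (γ : ℝ)) := by
  have hg := one_sub_pos γ
  set m := (mismatch M γ πstar μ).toReal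
  have hm0 : 0 ≤ m := ENNReal.toReal_nonneg
  set adv : S → ℝ := (fun s => ⨆ a, qval M γ π.mat s a) - val M γ π.mat with hadv
  have hadv0 : ∀ s, 0 ≤ adv s := fun s => by
    rw [hadv, val_eq]
    exact sub_nonneg.2 (dot_qval_le_iSup M γ π π s)
  have h1 : V M γ πstar M.ρ - V M γ π M.ρ ≤ expect M.ρ (res M γ πstar.mat adv) := by
    rw [V_eq, V_eq, ← expect_linear_sub, val_sub_val]
    refine expect_mono_fintype _ (res_mono M γ πstar fun s => ?_)
    rw [dot_sub, ← val_eq]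
    exact sub_le_sub_right (dot_qval_le_iSup M γ π πstar s) _
  have h2 : (1 - (γ : ℝ)) * expect M.ρ (res M γ πstar.mat adv) ≤ m * expect μ adv := by
    rw [← sum_occ_mul, expect_fintype, Finset.mul_sum]
    refine Finset.sum_le_sum fun s _ => ?_
    rw [← mul_assoc]
    exact mul_le_mul_of_nonneg_right (occ_le_mismatch M γ μ hm s) (hadv0 s)
  have h3 : expect μ adv ≤ expect μ (res M γ π.mat adv) :=
    expect_mono_fintype _ (le_res M γ π hadv0)
  have h4 : expect μ (res M γ π.mat adv) ≤ completeness M γ Pi μ / (1 - (γ : ℝ)) + G := by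
    rw [← sub_le_iff_le_add, le_div_iff₀ hg]
    refine le_trans ?_ (iInf_le_completeness M γ μ hPi hπ)
    have : Nonempty Pi := hPi.to_subtype
    refine le_ciInf fun π' => ?_
    rw [sum_occ_regret, mul_comm]
    refine mul_le_mul_of_nonneg_left ?_ hg.le
    have h5 := hG π'.1 π'.2
    rw [grad, dot_sub, ← val_eq] at h5
    -- The advantage of the greedy action splits into the regret of `π'`, which completeness bounds,
    -- and the advantage of `π'`, whose discounted expectation is the directional derivative bounded
    -- by `G`.
    have h6 : adv = ((fun s => ⨆ a, qval M γ π.mat s a) - dot (qval M γ π.mat) π'.1.mat) +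
        (dot (qval M γ π.mat) π'.1.mat - val M γ π.mat) := by
      rw [hadv]; abel
    rw [h6, map_add, expect_linear_add]
    linarith
  have h7 : (1 - (γ : ℝ)) * (V M γ πstar M.ρ - V M γ π M.ρ) ≤
      m * (completeness M γ Pi μ / (1 - (γ : ℝ)) + G) :=
    calc _ ≤ (1 - (γ : ℝ)) * expect M.ρ (res M γ πstar.mat adv) := by gcongr
      _ ≤ m * expect μ adv := h2
      _ ≤ _ := by gcongr; exact h3.trans h4
  rw [← sub_nonneg] at h7 ⊢
  have e : m * completeness M γ Pi μ / (1 - (γ : ℝ)) ^ 2 + m * G / (1 - (γ : ℝ)) -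
      (V M γ πstar M.ρ - V M γ π M.ρ) = (m * (completeness M γ Pi μ / (1 - (γ : ℝ)) + G) -
        (1 - (γ : ℝ)) * (V M γ πstar M.ρ - V M γ π M.ρ)) / (1 - (γ : ℝ)) := by
    field_simp
  rw [e]
  exact div_nonneg h7 hg.le

end Performance

/-! ### Convex hulls of policy classes -/

section ConvHull

variable {S : Type u} {A : Type v} [Fintype A] {Pi : Set (Policy S A)}

theorem subset_convHull {π : Policy S A} (h : π ∈ Pi) : π ∈ convHull Pi :=
  subset_convexHull ℝ _ ⟨π, h, rfl⟩

theorem mix_mem_convHull {π π' : Policy S A} (h : π ∈ convHull Pi) (h' : π' ∈ convHull Pi)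
    (c : unitInterval) : mix c π π' ∈ convHull Pi :=
  convex_convexHull ℝ (Policy.mat '' Pi) h h' (sub_nonneg.2 c.2.2) c.2.1 (by ring)

/-- A slab is convex. Since the estimation error is linear, a uniform bound over `Π` covers all
iterates, although these are only in `CH(Π)`; hence only `|Π_ε|` enters the sample size. -/
theorem abs_le_of_mem_convHull {L : (S → A → ℝ) →ₗ[ℝ] ℝ} {e : ℝ}
    (h : ∀ π ∈ Pi, |L π.mat| ≤ e) {π : Policy S A} (hπ : π ∈ convHull Pi) : |L π.mat| ≤ e := by
  have hc : Convex ℝ (L ⁻¹' Set.Icc (-e) e) := (convex_Icc _ _).linear_preimage L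
  have hs : Policy.mat '' Pi ⊆ L ⁻¹' Set.Icc (-e) e := by
    rintro _ ⟨π', hπ', rfl⟩
    exact abs_le.1 (h π' hπ')
  exact abs_le.2 (convexHull_min hs hc hπ)

end ConvHull

/-! ### Datasets as linear functionals -/

section Datasets

variable {S : Type u} {A : Type v} [Fintype A]

/-- The score of a dataset, as a linear functional on matrices. -/
def Dataset.scoreL (D : Dataset S A) : (S → A → ℝ) →ₗ[ℝ] ℝ where
  toFun w := (D.map fun x => ∑ a, x.2 a * w x.1 a).sum
  map_add' w w' := by
    simp only [Pi.add_apply, mul_add, Finset.sum_add_distrib]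
    exact List.sum_map_add
  map_smul' c w := by
    simp only [Pi.smul_apply, smul_eq_mul, mul_left_comm _ c, ← Finset.mul_sum]
    exact List.sum_map_mul_left _ _ _

theorem Dataset.scoreL_append (D D' : Dataset S A) (w : S → A → ℝ) :
    Dataset.scoreL (D ++ D') w = D.scoreL w + D'.scoreL w := by
  simp [Dataset.scoreL]

theorem Dataset.scoreL_scale (D : Dataset S A) (c : ℝ) (w : S → A → ℝ) :
    Dataset.scoreL (D.map fun x => (x.1, c • x.2)) w = c * D.scoreL w := by
  simp only [Dataset.scoreL, LinearMap.coe_mk, AddHom.coe_mk, List.map_map, Function.comp_def,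
    Pi.smul_apply, smul_eq_mul, mul_assoc, ← Finset.mul_sum]
  exact List.sum_map_mul_left _ _ _

/-- The total size of the losses in a dataset. -/
def Dataset.mass (D : Dataset S A) : ℝ := (D.map fun x => ‖x.2‖).sum

theorem Dataset.mass_append (D D' : Dataset S A) :
    Dataset.mass (D ++ D') = D.mass + D'.mass := by
  simp [Dataset.mass]

theorem Dataset.mass_scale (D : Dataset S A) {c : ℝ} (hc : 0 ≤ c) :
    Dataset.mass (D.map fun x => (x.1, c • x.2)) = c * D.mass := by
  simp only [Dataset.mass, List.map_map, Function.comp_def, norm_smul, Real.norm_of_nonneg hc]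
  exact List.sum_map_mul_left _ _ _

theorem Dataset.abs_scoreL_le (D : Dataset S A) {w : S → A → ℝ} {B : ℝ}
    (hw : ∀ s, ∑ a, |w s a| ≤ B) : |D.scoreL w| ≤ B * D.mass := by
  induction D with
  | nil => simp [Dataset.scoreL, Dataset.mass]
  | cons x D ih =>
    have e1 : Dataset.scoreL (x :: D) w = ∑ a, x.2 a * w x.1 a + Dataset.scoreL D w := rfl
    have e2 : Dataset.mass (x :: D) = ‖x.2‖ + Dataset.mass D := rfl
    rw [e1, e2, mul_add]
    refine (abs_add_le _ _).trans (add_le_add ?_ ih)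
    simp only [mul_comm (x.2 _)]
    exact abs_sum_mul_le (hw x.1) (norm_nonneg _) fun a => norm_le_pi_norm x.2 a

end Datasets

/-! ### One iteration of the algorithm -/

section Iteration

variable {S : Type u} {A : Type v} [Fintype S] [Fintype A] [Nonempty A]
  (M : MDP S A) (γ : Discount) (μ : PMF S)

theorem card_pos_real : (0 : ℝ) < Fintype.card A := Nat.cast_pos.2 Fintype.card_pos

theorem one_le_card : (1 : ℝ) ≤ Fintype.card A := Nat.one_le_cast.2 Fintype.card_pos

theorem Qhat_apply (q : QEpisode S A) (a : A) [Decidable (a = q.a)] :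
    q.Qhat M γ a = if a = q.a then
      (Fintype.card A : ℝ) * (M.r q.sEnd q.aEnd / (1 - (γ : ℝ))) else 0 := by
  unfold QEpisode.Qhat
  congr

theorem sum_Qhat_mul (q : QEpisode S A) (w : A → ℝ) :
    ∑ a, q.Qhat M γ a * w a =
      Fintype.card A / (1 - (γ : ℝ)) * (w q.a * M.r q.sEnd q.aEnd) := by
  classical
  simp only [Qhat_apply, ite_mul, zero_mul, Finset.sum_ite_eq', Finset.mem_univ, if_true]
  ring

theorem Hhat_apply (h : HEpisode S A) (b₁ b₂ : A) [Decidable (b₁ = h.a₁)] [Decidable (b₂ = h.a₂)] :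
    h.Hhat M γ b₁ b₂ = if b₁ = h.a₁ then (if b₂ = h.a₂ then
      (Fintype.card A : ℝ) ^ 2 * (M.r h.sEnd h.aEnd / (1 - (γ : ℝ))) else 0) else 0 := by
  unfold HEpisode.Hhat
  split_ifs <;> simp_all

theorem Hhat_mulVec (h : HEpisode S A) (v : A → ℝ) (b : A) [Decidable (b = h.a₁)] :
    (h.Hhat M γ).mulVec v b = if b = h.a₁ then
      (Fintype.card A : ℝ) ^ 2 * (M.r h.sEnd h.aEnd / (1 - (γ : ℝ))) * v h.a₂ else 0 := by
  classical
  simp only [Matrix.mulVec, dotProduct, Hhat_apply]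
  split_ifs <;> simp

theorem Hhat_transpose_mulVec (h : HEpisode S A) (v : A → ℝ) (b : A) [Decidable (b = h.a₂)] :
    (h.Hhat M γ).transpose.mulVec v b = if b = h.a₂ then
      (Fintype.card A : ℝ) ^ 2 * (M.r h.sEnd h.aEnd / (1 - (γ : ℝ))) * v h.a₁ else 0 := by
  classical
  simp only [Matrix.mulVec, dotProduct, Matrix.transpose_apply, Hhat_apply]
  split_ifs <;> simp

/-- The random part of the contribution of the Q-sampler to a score. -/
def qTerm (w : S → A → ℝ) (q : QEpisode S A) : ℝ := w q.s q.a * M.r q.sEnd q.aEnd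

/-- The random part of the contribution of the H-sampler to a score. -/
def hTerm (w Δ : S → A → ℝ) (h : HEpisode S A) : ℝ :=
  (w h.s₁ h.a₁ * Δ h.s₂ h.a₂ + Δ h.s₁ h.a₁ * w h.s₂ h.a₂) * M.r h.sEnd h.aEnd

variable (η lam : unitInterval) (erm : Dataset S A → Policy S A)

/-- The rescaling and the three new examples implement the momentum recursion `G_t = (1-λ)(G_{t-1} +
Hessian correction) + λ · fresh estimate`. -/
theorem scoreL_update (t : ℕ) (σ : State S A) (q : QEpisode S A) (h : HEpisode S A)
    (w : S → A → ℝ) :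
    (update M γ η lam erm t σ q h).data.scoreL w =
      (1 - (lam : ℝ)) * σ.data.scoreL w +
      (lam : ℝ) * (Fintype.card A / (1 - (γ : ℝ)) ^ 2 * qTerm M w q) +
      (1 - (lam : ℝ)) * (hTerm M w (σ.cur.mat - σ.prev.mat) h *
        (γ * (Fintype.card A : ℝ) ^ 2 / (1 - (γ : ℝ)) ^ 3)) := by
  classical
  have hg := (one_sub_pos γ).ne'
  simp only [update]
  rw [Dataset.scoreL_append, Dataset.scoreL_scale, add_assoc]
  congr 1
  simp only [Dataset.scoreL, LinearMap.coe_mk, AddHom.coe_mk, List.map_cons, List.map_nil,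
    List.sum_cons, List.sum_nil, Pi.smul_apply, smul_eq_mul, mul_assoc, ← Finset.mul_sum,
    sum_Qhat_mul, Hhat_mulVec, Hhat_transpose_mulVec, ite_mul, zero_mul, Finset.sum_ite_eq',
    Finset.mem_univ, if_true, qTerm, hTerm]
  field_simp
  simp only [Pi.sub_apply]
  ring

theorem norm_ite_le {p : A → Prop} [DecidablePred p] {x B : ℝ} (hB : 0 ≤ B) (hx : |x| ≤ B)
    {f : A → ℝ} (hf : ∀ a, f a = if p a then x else 0) : ‖f‖ ≤ B := by
  refine (pi_norm_le_iff_of_nonneg hB).2 fun a => ?_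
  rw [hf a, Real.norm_eq_abs]
  split_ifs
  · exact hx
  · simpa using hB

/-- The coupling of `λ` and `η` gives each of the three new losses norm at most `λA/(1-γ)²`, and
`(1-λ)·3 + 3λ = 3`, so the bound is invariant. -/
theorem mass_update_le (hlam : (lam : ℝ) * (1 - (γ : ℝ)) = η * Fintype.card A) (t : ℕ)
    (σ : State S A) (hσ : ∀ s a, |(σ.cur.mat - σ.prev.mat) s a| ≤ η)
    (hm : σ.data.mass ≤ 3 * Fintype.card A / (1 - (γ : ℝ)) ^ 2)
    (q : QEpisode S A) (h : HEpisode S A) :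
    (update M γ η lam erm t σ q h).data.mass ≤ 3 * Fintype.card A / (1 - (γ : ℝ)) ^ 2 := by
  classical
  have hg := one_sub_pos γ
  have hA := card_pos_real (A := A)
  have hl0 := lam.2.1
  have hl1 : 0 ≤ 1 - (lam : ℝ) := sub_nonneg.2 lam.2.2
  have hη0 := η.2.1
  have hγ0 := γ.2.1
  have hγ1 : (γ : ℝ) ≤ 1 := γ.2.2.le
  have hc1 : (γ : ℝ) * (1 - (lam : ℝ)) ≤ 1 := mul_le_one₀ hγ1 hl1 (sub_le_self _ hl0)
  have hc0 : 0 ≤ (γ : ℝ) * (1 - (lam : ℝ)) / (1 - (γ : ℝ)) ^ 2 := by positivity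
  have hr : ∀ s a, |M.r s a / (1 - (γ : ℝ))| ≤ 1 / (1 - (γ : ℝ)) := fun s a => by
    rw [abs_div, abs_of_pos hg]
    exact div_le_div_of_nonneg_right (abs_r_le M s a) hg.le
  have e : (η : ℝ) = lam * (1 - (γ : ℝ)) / Fintype.card A := by
    rw [hlam]; field_simp
  have hQ : ‖((lam : ℝ) / (1 - (γ : ℝ))) • q.Qhat M γ‖ ≤
      lam * Fintype.card A / (1 - (γ : ℝ)) ^ 2 := by
    have h1 : ‖q.Qhat M γ‖ ≤ Fintype.card A * (1 / (1 - (γ : ℝ))) := by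
      refine norm_ite_le (p := fun a => a = q.a) (by positivity) ?_ (fun a => Qhat_apply M γ q a)
      rw [abs_mul, abs_of_pos hA]
      exact mul_le_mul_of_nonneg_left (hr _ _) hA.le
    rw [norm_smul, Real.norm_of_nonneg (by positivity)]
    calc _ ≤ (lam : ℝ) / (1 - (γ : ℝ)) * (Fintype.card A * (1 / (1 - (γ : ℝ)))) := by gcongr
      _ = _ := by field_simp
  have hH : ∀ f : A → ℝ, ‖f‖ ≤ (Fintype.card A : ℝ) ^ 2 * (1 / (1 - (γ : ℝ))) * η →
      ‖((γ : ℝ) * (1 - (lam : ℝ)) / (1 - (γ : ℝ)) ^ 2) • f‖ ≤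
        lam * Fintype.card A / (1 - (γ : ℝ)) ^ 2 := by
    intro f hf
    rw [norm_smul, Real.norm_of_nonneg hc0]
    calc _ ≤ 1 / (1 - (γ : ℝ)) ^ 2 * ((Fintype.card A : ℝ) ^ 2 * (1 / (1 - (γ : ℝ))) * η) := by
          gcongr
      _ = _ := by rw [e]; field_simp
  have hx : ∀ s a, |(Fintype.card A : ℝ) ^ 2 * (M.r h.sEnd h.aEnd / (1 - (γ : ℝ))) *
      (σ.cur.mat - σ.prev.mat) s a| ≤ (Fintype.card A : ℝ) ^ 2 * (1 / (1 - (γ : ℝ))) * η := by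
    intro s a
    rw [abs_mul, abs_mul, abs_of_nonneg (a := (Fintype.card A : ℝ) ^ 2) (by positivity)]
    have := hr h.sEnd h.aEnd
    have := hσ s a
    gcongr
  have h1 := hH _ (norm_ite_le (p := fun a => a = h.a₁) (by positivity) (hx h.s₂ h.a₂)
    fun b => Hhat_mulVec M γ h ((σ.cur.mat - σ.prev.mat) h.s₂) b)
  have h2 := hH _ (norm_ite_le (p := fun a => a = h.a₂) (by positivity) (hx h.s₁ h.a₁)
    fun b => Hhat_transpose_mulVec M γ h ((σ.cur.mat - σ.prev.mat) h.s₁) b)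
  simp only [update]
  rw [Dataset.mass_append, Dataset.mass_scale _ hl1]
  simp only [Dataset.mass, List.map_cons, List.map_nil, List.sum_cons, List.sum_nil] at hm ⊢
  have h3 := mul_le_mul_of_nonneg_left hm hl1
  have e3 : (1 - (lam : ℝ)) * (3 * Fintype.card A / (1 - (γ : ℝ)) ^ 2) +
      3 * (lam * Fintype.card A / (1 - (γ : ℝ)) ^ 2) =
      3 * Fintype.card A / (1 - (γ : ℝ)) ^ 2 := by ring
  simp only [Pi.sub_def] at h1 h2
  simp only [Pi.sub_def]
  linarith

/-- The error of the gradient estimate carried by a state of the algorithm. -/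
def err (σ : State S A) (w : S → A → ℝ) : ℝ := σ.data.scoreL w - grad M γ μ σ.prev.mat w

/-- The noise added by the Q-sampler. -/
def qNoise (σ : State S A) (w : S → A → ℝ) (q : QEpisode S A) : ℝ :=
  (lam : ℝ) * (Fintype.card A / (1 - (γ : ℝ)) ^ 2 * qTerm M w q) +
    -((lam : ℝ) * grad M γ μ σ.cur.mat w)

/-- The noise added by the H-sampler. -/
def hNoise (σ : State S A) (w : S → A → ℝ) (h : HEpisode S A) : ℝ :=
  (1 - (lam : ℝ)) * (γ * (Fintype.card A : ℝ) ^ 2 / (1 - (γ : ℝ)) ^ 3 *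
    hTerm M w (σ.cur.mat - σ.prev.mat) h) +
    -((1 - (lam : ℝ)) * (grad M γ μ σ.cur.mat w - grad M γ μ σ.prev.mat w))

/-- After the update `prev` holds the policy whose gradient the new dataset estimates. The drift of
that target is exactly the mean removed in `hNoise`, so the error only contracts and collects noise.
-/
theorem err_update (t : ℕ) (σ : State S A) (q : QEpisode S A) (h : HEpisode S A)
    (w : S → A → ℝ) :
    err M γ μ (update M γ η lam erm t σ q h) w =
      (1 - (lam : ℝ)) * err M γ μ σ w + qNoise M γ μ lam σ w q + hNoise M γ μ lam σ w h := by
  rw [err, scoreL_update, err, qNoise, hNoise]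
  simp only [update]
  ring

theorem abs_mul_r_le {x B : ℝ} (hx : |x| ≤ B) (s : S) (a : A) : |x * M.r s a| ≤ B := by
  rw [abs_mul]
  exact (mul_le_of_le_one_right (abs_nonneg _) (abs_r_le M s a)).trans hx

theorem abs_mat_le_one (π : Policy S A) (s : S) (a : A) : |π.mat s a| ≤ 1 := by
  rw [abs_of_nonneg (mat_nonneg π s a)]
  exact mat_le_one π s a

theorem abs_qTerm_le (π : Policy S A) (q : QEpisode S A) : |qTerm M π.mat q| ≤ 1 :=
  abs_mul_r_le M (abs_mat_le_one π _ _) _ _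

theorem abs_hTerm_le (π : Policy S A) {Δ : S → A → ℝ} {B : ℝ} (hΔ : ∀ s a, |Δ s a| ≤ B)
    (h : HEpisode S A) : |hTerm M π.mat Δ h| ≤ 2 * B := by
  refine abs_mul_r_le M ((abs_add_le _ _).trans ?_) _ _
  rw [abs_mul, abs_mul, two_mul]
  exact add_le_add
    ((mul_le_of_le_one_left (abs_nonneg _) (abs_mat_le_one π _ _)).trans (hΔ _ _))
    ((mul_le_of_le_one_right (abs_nonneg _) (abs_mat_le_one π _ _)).trans (hΔ _ _))

theorem expect_add_neg {α : Type*} (p : PMF α) {f : α → ℝ} {C m : ℝ} (hf : ∀ a, |f a| ≤ C)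
    (hm : expect p f = m) :
    expect p (fun a => f a + -m) = 0 ∧ ∀ a, |f a + -m| ≤ 2 * C := by
  have h := abs_expect_le p hf
  rw [hm] at h
  refine ⟨?_, fun a => ?_⟩
  · rw [expect_add p hf (C' := |-m|) fun _ => le_rfl, expect_const, hm, add_neg_cancel]
  · refine (abs_add_le _ _).trans ?_
    rw [abs_neg]
    linarith [hf a]

theorem qNoise_centred (σ : State S A) (π : Policy S A) :
    expect (qSampler M γ σ.cur μ) (qNoise M γ μ lam σ π.mat) = 0 ∧
      ∀ q, |qNoise M γ μ lam σ π.mat q| ≤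
        2 * (lam * (Fintype.card A / (1 - (γ : ℝ)) ^ 2 * 1)) := by
  have hg := one_sub_pos γ
  have hA := card_pos_real (A := A)
  have hl0 := lam.2.1
  refine expect_add_neg (qSampler M γ σ.cur μ)
    (f := fun q => (lam : ℝ) * (Fintype.card A / (1 - (γ : ℝ)) ^ 2 * qTerm M π.mat q))
    (m := (lam : ℝ) * grad M γ μ σ.cur.mat π.mat) (fun q => ?_) ?_
  · rw [abs_mul, abs_of_nonneg hl0, abs_mul, abs_of_nonneg (a := _ / _) (by positivity)]
    have := abs_qTerm_le M π q
    gcongr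
  · rw [expect_mul_left, expect_mul_left]
    have : expect (qSampler M γ σ.cur μ) (qTerm M π.mat) = _ :=
      expect_qSampler M γ μ σ.cur π.mat
    rw [this]
    field_simp

/-- The inner factor 2 counts the two products in `hTerm`, the outer one comes from centring. The
bound is proportional to `η`: this is the variance reduction. -/
theorem hNoise_centred (σ : State S A) (hσ : ∀ s a, |(σ.cur.mat - σ.prev.mat) s a| ≤ η)
    (π : Policy S A) :
    expect (hSamplerMixed M γ σ.cur σ.prev μ) (hNoise M γ μ lam σ π.mat) = 0 ∧
      ∀ h, |hNoise M γ μ lam σ π.mat h| ≤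
        2 * (1 * ((Fintype.card A : ℝ) ^ 2 / (1 - (γ : ℝ)) ^ 3 * (2 * η))) := by
  have hg := one_sub_pos γ
  have hA := card_pos_real (A := A)
  have hl0 := lam.2.1
  have hl1 : 0 ≤ 1 - (lam : ℝ) := sub_nonneg.2 lam.2.2
  have hγ0 := γ.2.1
  refine expect_add_neg (hSamplerMixed M γ σ.cur σ.prev μ)
    (f := fun h => (1 - (lam : ℝ)) * (γ * (Fintype.card A : ℝ) ^ 2 / (1 - (γ : ℝ)) ^ 3 *
      hTerm M π.mat (σ.cur.mat - σ.prev.mat) h))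
    (m := (1 - (lam : ℝ)) * (grad M γ μ σ.cur.mat π.mat - grad M γ μ σ.prev.mat π.mat))
    (fun h => ?_) ?_
  · rw [abs_mul, abs_of_nonneg hl1, abs_mul, abs_of_nonneg (a := _ / _) (by positivity)]
    have h1 := abs_hTerm_le M π hσ h
    have h2 : (γ : ℝ) * (Fintype.card A : ℝ) ^ 2 ≤ (Fintype.card A : ℝ) ^ 2 :=
      mul_le_of_le_one_left (by positivity) γ.2.2.le
    have h3 : 1 - (lam : ℝ) ≤ 1 := sub_le_self _ hl0
    gcongr
  · rw [expect_mul_left, expect_mul_left, mul_comm (_ / _)]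
    congr 1
    exact expect_hSamplerMixed_eq M γ μ σ.cur σ.prev π.mat

/-- The conditional exponential moment of the error after one more iteration. -/
theorem lexp_step_le (hlam : (lam : ℝ) * (1 - (γ : ℝ)) = η * Fintype.card A) (t : ℕ)
    (σ : State S A) (hσ : ∀ s a, |(σ.cur.mat - σ.prev.mat) s a| ≤ η) (π : Policy S A) (θ : ℝ) :
    lexp (qSampler M γ σ.cur μ) (fun q => lexp (hSamplerMixed M γ σ.cur σ.prev μ) fun h =>
      ENNReal.ofReal (Real.exp (θ * err M γ μ (update M γ η lam erm t σ q h) π.mat))) ≤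
    ENNReal.ofReal (Real.exp (θ * (1 - (lam : ℝ)) * err M γ μ σ π.mat)) *
      ENNReal.ofReal (Real.exp (10 * θ ^ 2 * (lam * Fintype.card A / (1 - (γ : ℝ)) ^ 2) ^ 2)) := by
  have hg := one_sub_pos γ
  have hA := card_pos_real (A := A)
  have hl0 := lam.2.1
  have hη0 := η.2.1
  have e : (η : ℝ) = lam * (1 - (γ : ℝ)) / Fintype.card A := by
    rw [hlam]; field_simp
  simp only [err_update, mul_add, Real.exp_add, ENNReal.ofReal_mul (Real.exp_pos _).le,
    lexp_mul_left, lexp_mul_right, mul_assoc]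
  refine mul_le_mul_right ?_ _
  obtain ⟨hq0, hq⟩ := qNoise_centred M γ μ lam σ π
  obtain ⟨hh0, hh⟩ := hNoise_centred M γ μ η lam σ hσ π
  have h1 := lexp_exp_le _ (by positivity) hq hq0 θ
  have h2 := lexp_exp_le _ (by positivity) hh hh0 θ
  -- With `b = λA/(1-γ)²` the noises are bounded by `2b` and, through the coupling, `4b`; Hoeffding
  -- contributes `2²/2 + 4²/2 = 10`.
  refine (mul_le_mul' h1 h2).trans (le_of_eq ?_)
  rw [← ENNReal.ofReal_mul (Real.exp_pos _).le, ← Real.exp_add]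
  congr 2
  rw [e]
  field_simp
  ring

end Iteration

/-! ### The run of the algorithm -/

section Run

variable {S : Type u} {A : Type v} [Fintype S] [Fintype A] [Nonempty A]
  (M : MDP S A) (γ : Discount) (μ : PMF S) (η lam : unitInterval)
  (erm : Dataset S A → Policy S A) (π₁ : Policy S A)

theorem run_induction {P : ℕ → State S A → Prop} (h0 : P 0 ⟨π₁, π₁, [], [], []⟩)
    (hs : ∀ t σ, P t σ → ∀ q h, P (t + 1) (update M γ η lam erm (t + 1) σ q h)) (t : ℕ) :
    ∀ σ ∈ (run M γ η lam erm μ π₁ t).support, P t σ := by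
  induction t with
  | zero =>
    intro σ hσ
    rw [run, PMF.mem_support_pure_iff] at hσ
    exact hσ ▸ h0
  | succ t ih =>
    intro σ hσ
    simp only [run, PMF.mem_support_bind_iff, PMF.mem_support_pure_iff] at hσ
    obtain ⟨σ', h1, q, -, h, -, rfl⟩ := hσ
    exact hs t σ' (ih σ' h1) q h

theorem lexp_run_succ (t : ℕ) (f : State S A → ℝ≥0∞) :
    lexp (run M γ η lam erm μ π₁ (t + 1)) f =
      lexp (run M γ η lam erm μ π₁ t) fun σ => lexp (qSampler M γ σ.cur μ) fun q =>
        lexp (hSamplerMixed M γ σ.cur σ.prev μ) fun h =>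
          f (update M γ η lam erm (t + 1) σ q h) := by
  simp only [run, lexp_bind, lexp_pure]

/-- Properties of the states that the algorithm can reach in `t` iterations. -/
structure Reachable {S : Type u} {A : Type v} [Fintype A] (γ : Discount) (η : unitInterval)
    (Pi : Set (Policy S A)) (t : ℕ) (σ : State S A) : Prop where
  prev_mem : σ.prev ∈ convHull Pi
  cur_mem : σ.cur ∈ convHull Pi
  diff : ∀ s a, |(σ.cur.mat - σ.prev.mat) s a| ≤ η
  mass : σ.data.mass ≤ 3 * Fintype.card A / (1 - (γ : ℝ)) ^ 2
  lens : σ.lens.length = 2 * t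
  log : 1 ≤ t → ∃ π adv, (t, π, adv) ∈ σ.log

theorem abs_mix_sub_le (π π' : Policy S A) (s : S) (a : A) :
    |((mix η π π').mat - π.mat) s a| ≤ η := by
  rw [mat_mix_sub]
  change |(η : ℝ) * (π'.mat s a - π.mat s a)| ≤ η
  rw [abs_mul, abs_of_nonneg η.2.1]
  refine mul_le_of_le_one_right η.2.1 (abs_le.2 ⟨?_, ?_⟩)
  · linarith [mat_nonneg π' s a, mat_le_one π s a]
  · linarith [mat_nonneg π s a, mat_le_one π' s a]

variable {Pi : Set (Policy S A)}

theorem reachable_run (hlam : (lam : ℝ) * (1 - (γ : ℝ)) = η * Fintype.card A)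
    (herm : ∀ D, erm D ∈ Pi) (hπ₁ : π₁ ∈ Pi) (t : ℕ) :
    ∀ σ ∈ (run M γ η lam erm μ π₁ t).support, Reachable γ η Pi t σ := by
  have hg := one_sub_pos γ
  refine run_induction M γ μ η lam erm π₁ ?_ ?_ t
  · refine ⟨subset_convHull hπ₁, subset_convHull hπ₁, fun s a => ?_, ?_, rfl, by simp⟩
    · simpa using η.2.1
    · simp only [Dataset.mass, List.map_nil, List.sum_nil]
      positivity
  · intro t σ hσ q h
    refine ⟨hσ.cur_mem, ?_, ?_, mass_update_le M γ η lam erm hlam (t + 1) σ hσ.diff hσ.mass q h,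
      ?_, fun _ => ⟨_, _, List.mem_cons_self⟩⟩
    · exact mix_mem_convHull hσ.cur_mem (subset_convHull (herm _)) η
    · exact abs_mix_sub_le η _ _
    · simp only [update, List.length_cons, hσ.lens]
      ring

/-- The exponential moments of the gradient estimation error. -/
theorem lexp_run_exp_err_le (hlam : (lam : ℝ) * (1 - (γ : ℝ)) = η * Fintype.card A)
    (herm : ∀ D, erm D ∈ Pi) (hπ₁ : π₁ ∈ Pi) (π : Policy S A) (t : ℕ) (θ : ℝ) :
    lexp (run M γ η lam erm μ π₁ t)
      (fun σ => ENNReal.ofReal (Real.exp (θ * err M γ μ σ π.mat))) ≤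
    ENNReal.ofReal (Real.exp (|θ| * ((1 - (lam : ℝ)) ^ t / (1 - (γ : ℝ)) ^ 2) +
      θ ^ 2 * (10 * lam * (Fintype.card A : ℝ) ^ 2 / (1 - (γ : ℝ)) ^ 4))) := by
  have hg := one_sub_pos γ
  have hA := card_pos_real (A := A)
  have hl0 := lam.2.1
  have hl1 : 0 ≤ 1 - (lam : ℝ) := sub_nonneg.2 lam.2.2
  induction t generalizing θ with
  | zero =>
    rw [run, lexp_pure]
    refine ENNReal.ofReal_le_ofReal (Real.exp_le_exp.2 ?_)
    have h1 := abs_grad_le M γ μ π₁ (fun s => (sum_abs_mat π s).le)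
    have h2 : err M γ μ (⟨π₁, π₁, [], [], []⟩ : State S A) π.mat =
        -grad M γ μ π₁.mat π.mat := by
      simp [err, Dataset.scoreL]
    rw [h2, pow_zero]
    refine le_trans (le_abs_self _) ?_
    rw [abs_mul, abs_neg]
    refine le_add_of_le_of_nonneg (mul_le_mul_of_nonneg_left h1 (abs_nonneg θ)) (by positivity)
  | succ t ih =>
    rw [lexp_run_succ]
    refine (lexp_mono fun σ hσ => lexp_step_le M γ μ η lam erm hlam (t + 1) σ
      (reachable_run M γ μ η lam erm π₁ hlam herm hπ₁ t σ hσ).diff π θ).trans ?_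
    rw [lexp_mul_right]
    -- The contraction of the old error is absorbed into the exponential parameter, so the induction
    -- hypothesis is used at `θ(1-λ)`.
    refine (mul_le_mul_left (ih (θ * (1 - (lam : ℝ)))) _).trans ?_
    rw [← ENNReal.ofReal_mul (Real.exp_pos _).le, ← Real.exp_add]
    refine ENNReal.ofReal_le_ofReal (Real.exp_le_exp.2 ?_)
    rw [abs_mul, abs_of_nonneg hl1, ← sub_nonneg]
    -- With `v = 10λA²/(1-γ)⁴` the new noise adds `λv`, and `(1-λ)²v + λv ≤ v`; the difference is
    -- the right-hand side below.
    have e : |θ| * ((1 - (lam : ℝ)) ^ (t + 1) / (1 - (γ : ℝ)) ^ 2) +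
        θ ^ 2 * (10 * lam * (Fintype.card A : ℝ) ^ 2 / (1 - (γ : ℝ)) ^ 4) -
        (|θ| * (1 - (lam : ℝ)) * ((1 - (lam : ℝ)) ^ t / (1 - (γ : ℝ)) ^ 2) +
          (θ * (1 - (lam : ℝ))) ^ 2 * (10 * lam * (Fintype.card A : ℝ) ^ 2 / (1 - (γ : ℝ)) ^ 4) +
          10 * θ ^ 2 * (lam * Fintype.card A / (1 - (γ : ℝ)) ^ 2) ^ 2) =
        10 * θ ^ 2 * (lam : ℝ) ^ 2 * (1 - lam) * (Fintype.card A : ℝ) ^ 2 / (1 - (γ : ℝ)) ^ 4 := by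
      field_simp
      ring
    rw [e]
    positivity

/-- A subgaussian tail bound from exponential moments. -/
theorem toOuterMeasure_abs_le {α : Type*} (p : PMF α) (f : α → ℝ) {a v u : ℝ} (hv : 0 < v)
    (hu : 0 ≤ u)
    (h : ∀ θ, lexp p (fun x => ENNReal.ofReal (Real.exp (θ * f x))) ≤
      ENNReal.ofReal (Real.exp (|θ| * a + θ ^ 2 * v))) :
    p.toOuterMeasure {x | ¬ |f x| ≤ a + u} ≤
      ENNReal.ofReal (2 * Real.exp (-(u ^ 2 / (4 * v)))) := by
  -- The minimizer of the Chernoff exponent `-θu + θ²v`, with minimum `-u²/(4v)`.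
  set θ := u / (2 * v) with hθ
  have hθ0 : 0 ≤ θ := by positivity
  set c := ENNReal.ofReal (Real.exp (-(θ * (a + u)))) with hc
  have hb : ∀ θ', |θ'| = θ → c * lexp p (fun x => ENNReal.ofReal (Real.exp (θ' * f x))) ≤
      ENNReal.ofReal (Real.exp (-(u ^ 2 / (4 * v)))) := by
    intro θ' h'
    refine (mul_le_mul_right (h θ') c).trans ?_
    rw [hc, ← ENNReal.ofReal_mul (Real.exp_pos _).le, ← Real.exp_add, h', ← sq_abs θ', h']
    refine ENNReal.ofReal_le_ofReal (Real.exp_le_exp.2 (le_of_eq ?_))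
    rw [hθ]
    field_simp
    ring
  have h1 := hb θ (abs_of_nonneg hθ0)
  have h2 := hb (-θ) (by rw [abs_neg, abs_of_nonneg hθ0])
  rw [two_mul, ENNReal.ofReal_add (Real.exp_pos _).le (Real.exp_pos _).le]
  refine le_trans ?_ (add_le_add h1 h2)
  rw [toOuterMeasure_eq_lexp, ← lexp_mul_left, ← lexp_mul_left, ← lexp_add]
  refine lexp_mono fun x _ => ?_
  by_cases hx' : |f x| ≤ a + u
  · rw [Set.indicator_of_notMem (s := {x | ¬ |f x| ≤ a + u}) (not_not.2 hx')]
    exact zero_le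
  rw [Set.indicator_of_mem (s := {x | ¬ |f x| ≤ a + u}) hx']
  have hx := lt_abs.1 (not_le.1 hx')
  simp only [hc, ← ENNReal.ofReal_mul (Real.exp_pos _).le, ← Real.exp_add, Pi.one_apply]
  rcases hx with hx | hx
  · refine le_add_right (ENNReal.one_le_ofReal.2 (Real.one_le_exp ?_))
    nlinarith
  · refine le_add_left (ENNReal.one_le_ofReal.2 (Real.one_le_exp ?_))
    nlinarith

/-- A union bound over policies fixed before the run. The oracle's choices depend on the noise, so
they are reached only through uniformity over the cover. -/
theorem toOuterMeasure_err_le (hlam : (lam : ℝ) * (1 - (γ : ℝ)) = η * Fintype.card A)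
    (hlam0 : 0 < (lam : ℝ)) (herm : ∀ D, erm D ∈ Pi) (hπ₁ : π₁ ∈ Pi) (W : Finset (Policy S A))
    (t : ℕ) {u : ℝ} (hu : 0 ≤ u) :
    (run M γ η lam erm μ π₁ t).toOuterMeasure {σ | ¬ ∀ π ∈ W, |err M γ μ σ π.mat| ≤
      (1 - (lam : ℝ)) ^ t / (1 - (γ : ℝ)) ^ 2 + u} ≤
    W.card * ENNReal.ofReal (2 * Real.exp (-(u ^ 2 /
      (4 * (10 * lam * (Fintype.card A : ℝ) ^ 2 / (1 - (γ : ℝ)) ^ 4))))) := by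
  have hg := one_sub_pos γ
  have hA := card_pos_real (A := A)
  have e : {σ : State S A | ¬ ∀ π ∈ W, |err M γ μ σ π.mat| ≤
      (1 - (lam : ℝ)) ^ t / (1 - (γ : ℝ)) ^ 2 + u} = ⋃ π ∈ W, {σ | ¬ |err M γ μ σ π.mat| ≤
      (1 - (lam : ℝ)) ^ t / (1 - (γ : ℝ)) ^ 2 + u} := by
    ext σ; simp
  rw [e, ← nsmul_eq_mul]
  refine (MeasureTheory.measure_biUnion_finset_le W _).trans (Finset.sum_le_card_nsmul _ _ _ ?_)
  intro π _
  exact toOuterMeasure_abs_le _ _ (by positivity) hu fun θ =>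
    lexp_run_exp_err_le M γ μ η lam erm π₁ hlam herm hπ₁ π t θ

/-- A property that propagates as long as some event happens at every iteration. -/
theorem toOuterMeasure_run_le {Good Conc : ℕ → State S A → Prop}
    (h0 : Good 0 ⟨π₁, π₁, [], [], []⟩)
    (hs : ∀ t, ∀ σ ∈ (run M γ η lam erm μ π₁ t).support, Good t σ → ∀ q h,
      Conc (t + 1) (update M γ η lam erm (t + 1) σ q h) →
      Good (t + 1) (update M γ η lam erm (t + 1) σ q h))
    {p : ℝ≥0∞} (hp : ∀ t, (run M γ η lam erm μ π₁ t).toOuterMeasure {σ | ¬ Conc t σ} ≤ p)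
    (t : ℕ) : (run M γ η lam erm μ π₁ t).toOuterMeasure {σ | ¬ Good t σ} ≤ t * p := by
  induction t with
  | zero =>
    rw [toOuterMeasure_eq_lexp, run, lexp_pure]
    simp [h0]
  | succ t ih =>
    have h1 := hp (t + 1)
    rw [toOuterMeasure_eq_lexp, lexp_run_succ] at h1
    rw [toOuterMeasure_eq_lexp] at ih
    rw [toOuterMeasure_eq_lexp, lexp_run_succ, Nat.cast_add, Nat.cast_one, add_mul, one_mul]
    refine le_trans ?_ (add_le_add ih h1)
    rw [← lexp_add]
    refine lexp_mono fun σ hσ => ?_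
    -- A failure is charged to the induction hypothesis if it occurred before, and otherwise to the
    -- concentration event of the current iteration.
    by_cases hG : Good t σ
    · refine le_add_left (lexp_mono fun q _ => lexp_mono fun h _ => ?_)
      by_cases hC : Conc (t + 1) (update M γ η lam erm (t + 1) σ q h)
      · have hG' := hs t σ hσ hG q h hC
        rw [Set.indicator_of_notMem (s := {σ | ¬ Good (t + 1) σ}) (not_not.2 hG')]
        exact zero_le
      · rw [Set.indicator_of_mem (s := {σ | ¬ Conc (t + 1) σ}) hC]
        exact Set.indicator_le_self' (fun _ _ => zero_le) _
    · have : ({σ | ¬ Good t σ} : Set (State S A)).indicator (1 : State S A → ℝ≥0∞) σ = 1 :=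
        Set.indicator_of_mem hG _
      rw [this]
      refine le_add_right ?_
      rw [← lexp_const (qSampler M γ σ.cur μ) 1]
      refine lexp_mono fun q _ => ?_
      rw [← lexp_const (hSamplerMixed M γ σ.cur σ.prev μ) 1]
      exact lexp_mono fun h _ => Set.indicator_le_self' (fun _ _ => zero_le) _

end Run

/-! ### Success of the algorithm -/

section Success

variable {S : Type u} {A : Type v} [Fintype S] [Fintype A] [Nonempty A]
  (M : MDP S A) (γ : Discount) (μ : PMF S) (η lam : unitInterval)
  (erm : Dataset S A → Policy S A) (π₁ : Policy S A) (Pi : Set (Policy S A))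

/-- In the second half of `T` iterations, the recorded advantages control the Frank-Wolfe gaps up
to `e₂`, and every iteration increases the value by its recorded advantage up to `e₁`. -/
structure Progress (T : ℕ) (e₁ e₂ : ℝ) (t : ℕ) (σ : State S A) : Prop where
  gap : ∀ x ∈ σ.log, T ≤ 2 * x.1 → x.2.1 ∈ convHull Pi ∧
    ∀ π' ∈ Pi, grad M γ μ x.2.1.mat (π'.mat - x.2.1.mat) ≤ x.2.2 + e₂
  value : ∀ m : ℝ, (∀ x ∈ σ.log, T ≤ 2 * x.1 → m ≤ x.2.2) →
    0 ≤ η * (m - 2 * e₁) - 4 * (η : ℝ) ^ 2 / (1 - (γ : ℝ)) ^ 3 →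
    (t - (T : ℝ) / 2) * (η * (m - 2 * e₁) - 4 * (η : ℝ) ^ 2 / (1 - (γ : ℝ)) ^ 3) ≤ V M γ σ.cur μ

variable {Pi}

theorem err_sub (σ : State S A) (w w' : S → A → ℝ) :
    err M γ μ σ (w - w') = err M γ μ σ w - err M γ μ σ w' := by
  rw [err, err, err, map_sub, grad_sub]
  ring

theorem abs_err_le_of_mem_convHull {σ : State S A} {e : ℝ}
    (h : ∀ π ∈ Pi, |err M γ μ σ π.mat| ≤ e) {π : Policy S A} (hπ : π ∈ convHull Pi) :
    |err M γ μ σ π.mat| ≤ e := by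
  let L : (S → A → ℝ) →ₗ[ℝ] ℝ :=
    { toFun := err M γ μ σ
      map_add' := fun w w' => by
        rw [err, err, err, map_add, grad_add]
        ring
      map_smul' := fun c w => by
        simp only [err, map_smul, grad_smul, smul_eq_mul, RingHom.id_apply]
        ring }
  exact abs_le_of_mem_convHull (L := L) h hπ

/-- The score differs from the gradient by at most `e₁` both at a candidate and at the current
policy, so differences of scores are accurate to `2e₁`. The gap also pays the oracle's tolerance
times the mass of the dataset; the value grows by `V_mix_ge`. -/
theorem Progress.step (hlam : (lam : ℝ) * (1 - (γ : ℝ)) = η * Fintype.card A) {tol : ℝ}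
    (htol : 0 ≤ tol) (herm : IsERM Pi tol erm) {T : ℕ} {e₁ : ℝ} {t : ℕ} {σ : State S A}
    (hσ : Reachable γ η Pi t σ)
    (hP : Progress M γ μ η Pi T e₁ (2 * e₁ + tol * (3 * Fintype.card A / (1 - (γ : ℝ)) ^ 2)) t σ)
    (q : QEpisode S A) (h : HEpisode S A)
    (hC : T ≤ 2 * (t + 1) → ∀ π ∈ Pi,
      |err M γ μ (update M γ η lam erm (t + 1) σ q h) π.mat| ≤ e₁) :
    Progress M γ μ η Pi T e₁ (2 * e₁ + tol * (3 * Fintype.card A / (1 - (γ : ℝ)) ^ 2)) (t + 1)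
      (update M γ η lam erm (t + 1) σ q h) := by
  have hmass := mass_update_le M γ η lam erm hlam (t + 1) σ hσ.diff hσ.mass q h
  set σ' := update M γ η lam erm (t + 1) σ q h with hσ'
  set π' := erm σ'.data with hπ'
  have hlog : σ'.log = (t + 1, σ.cur, σ'.data.score π' - σ'.data.score σ.cur) :: σ.log := rfl
  have hcur : σ'.cur = mix η σ.cur π' := rfl
  have herr : ∀ π : Policy S A, err M γ μ σ' π.mat =
      σ'.data.score π - grad M γ μ σ.cur.mat π.mat := fun π => rfl
  have hC1 : T ≤ 2 * (t + 1) → ∀ π ∈ convHull Pi,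
      |σ'.data.score π - grad M γ μ σ.cur.mat π.mat| ≤ e₁ := fun hT π hπ => by
    rw [← herr]
    exact abs_err_le_of_mem_convHull M γ μ (hC hT) hπ
  constructor
  · intro x hx hT
    rw [hlog, List.mem_cons] at hx
    rcases hx with rfl | hx
    · refine ⟨hσ.cur_mem, fun π hπ => ?_⟩
      have h1 := abs_le.1 (hC1 hT π (subset_convHull hπ))
      have h2 := abs_le.1 (hC1 hT σ.cur hσ.cur_mem)
      have h3 := (herm σ'.data).2 π hπ
      have h4 : tol * (σ'.data.map fun x => ‖x.2‖).sum ≤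
          tol * (3 * Fintype.card A / (1 - (γ : ℝ)) ^ 2) := mul_le_mul_of_nonneg_left hmass htol
      rw [← hπ'] at h3
      simp only [grad_sub]
      linarith [h1.1, h2.2]
    · exact hP.gap x hx hT
  · intro m hm h0
    set x := η * (m - 2 * e₁) - 4 * (η : ℝ) ^ 2 / (1 - (γ : ℝ)) ^ 3 with hx
    by_cases hT : T ≤ 2 * (t + 1)
    · have h1 := hP.value m (fun y hy => hm y (hlog ▸ List.mem_cons_of_mem _ hy)) h0
      rw [← hx] at h1
      have h2 : m ≤ σ'.data.score π' - σ'.data.score σ.cur :=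
        hm _ (hlog ▸ List.mem_cons_self) hT
      have h3 := abs_le.1 (hC1 hT π' (subset_convHull (herm _).1))
      have h4 := abs_le.1 (hC1 hT σ.cur hσ.cur_mem)
      have h5 := V_mix_ge M γ μ η σ.cur π'
      rw [grad_sub] at h5
      have h6 : (η : ℝ) * (m - 2 * e₁) ≤
          η * (grad M γ μ σ.cur.mat π'.mat - grad M γ μ σ.cur.mat σ.cur.mat) :=
        mul_le_mul_of_nonneg_left (by linarith [h3.2, h4.1]) η.2.1
      rw [hcur]
      push_cast
      linarith
    -- In the first half the factor `t + 1 - T/2` is nonpositive, so nonnegativity of values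
    -- suffices.
    · refine le_trans (mul_nonpos_of_nonpos_of_nonneg ?_ h0) (V_nonneg M γ μ _)
      have : ((2 * (t + 1) : ℕ) : ℝ) ≤ T := Nat.cast_le.2 (not_le.1 hT).le
      push_cast at this ⊢
      linarith

theorem progress_zero (T : ℕ) (e₁ e₂ : ℝ) :
    Progress M γ μ η Pi T e₁ e₂ 0 ⟨π₁, π₁, [], [], []⟩ := by
  refine ⟨fun x hx => absurd hx List.not_mem_nil, fun m _ h0 => ?_⟩
  refine le_trans (mul_nonpos_of_nonpos_of_nonneg ?_ h0) (V_nonneg M γ μ _)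
  have : (0 : ℝ) ≤ T := Nat.cast_nonneg _
  push_cast
  linarith

theorem exists_isOutput {T : ℕ} {σ : State S A} {π : Policy S A} {adv : ℝ}
    (h : (T, π, adv) ∈ σ.log) : ∃ π, IsOutput T σ π := by
  have hf : {x | x ∈ σ.log ∧ T ≤ 2 * x.1}.Finite := σ.log.finite_toSet.subset fun x hx => hx.1
  obtain ⟨⟨i, π', adv'⟩, ⟨h1, h2⟩, h3⟩ := Set.exists_min_image _ (fun x => x.2.2) hf
    ⟨(T, π, adv), h, by dsimp; omega⟩
  exact ⟨π', i, adv', h1, h2, fun x hx hT => h3 x ⟨hx, hT⟩⟩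

/-- The returned advantage is a lower bound for all those of the second half. If it forces a
nonnegative gain per step, at least `T/2` gains fit into the range `1/(1-γ)` of the value, which
bounds it; otherwise it is already small. -/
theorem Progress.gap_le {T : ℕ} (hT : 1 ≤ T) (hη : 0 < (η : ℝ)) {e₁ e₂ : ℝ}
    {σ : State S A} (hP : Progress M γ μ η Pi T e₁ e₂ T σ) {π : Policy S A}
    (hπ : IsOutput T σ π) : π ∈ convHull Pi ∧
      ∀ π' ∈ Pi, grad M γ μ π.mat (π'.mat - π.mat) ≤
        2 / ((η : ℝ) * T * (1 - (γ : ℝ))) + 4 * (η : ℝ) / (1 - (γ : ℝ)) ^ 3 + 2 * e₁ + e₂ := by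
  have hg := one_sub_pos γ
  have hT0 : (0 : ℝ) < T := Nat.cast_pos.2 hT
  obtain ⟨i, adv, h1, h2, h3⟩ := hπ
  obtain ⟨h4, h5⟩ := hP.gap _ h1 h2
  refine ⟨h4, fun π' hπ' => (h5 π' hπ').trans (add_le_add_left ?_ _)⟩
  have hpos : 0 ≤ 2 / ((η : ℝ) * T * (1 - (γ : ℝ))) := by positivity
  rcases le_total 0 (η * (adv - 2 * e₁) - 4 * (η : ℝ) ^ 2 / (1 - (γ : ℝ)) ^ 3) with h0 | h0
  · have h6 := (hP.value adv h3 h0).trans (V_le M γ μ σ.cur)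
    have e : (T - (T : ℝ) / 2) * (η * (adv - 2 * e₁) - 4 * (η : ℝ) ^ 2 / (1 - (γ : ℝ)) ^ 3) =
        (η * T / 2) * (adv - 2 * e₁ - 4 * η / (1 - (γ : ℝ)) ^ 3) := by
      field_simp; ring
    rw [e, ← le_div_iff₀' (by positivity)] at h6
    have e2 : 1 / (1 - (γ : ℝ)) / (η * T / 2) = 2 / ((η : ℝ) * T * (1 - (γ : ℝ))) := by
      field_simp
    rw [e2] at h6
    linarith
  · have e : η * (adv - 2 * e₁) - 4 * (η : ℝ) ^ 2 / (1 - (γ : ℝ)) ^ 3 =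
        η * (adv - 2 * e₁ - 4 * η / (1 - (γ : ℝ)) ^ 3) := by
      field_simp
    rw [e] at h0
    have := nonpos_of_mul_nonpos_right h0 hη
    linarith

/-- The error is Lipschitz in `‖·‖_{∞,1}`: the losses have total mass at most `3A/(1-γ)²`, the
gradient contributes `1/(1-γ)²`, and `A ≥ 1`. -/
theorem abs_err_le_of_cover {t : ℕ} {σ : State S A} (hσ : Reachable γ η Pi t σ) {e r : ℝ}
    {π π' : Policy S A} (h : |err M γ μ σ π'.mat| ≤ e)
    (hr : ∀ s, ∑ a, |(π.mat - π'.mat) s a| ≤ r) (hr0 : 0 ≤ r) :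
    |err M γ μ σ π.mat| ≤ e + 4 * Fintype.card A * r / (1 - (γ : ℝ)) ^ 2 := by
  have hg := one_sub_pos γ
  have hA := one_le_card (A := A)
  have e1 : err M γ μ σ π.mat = err M γ μ σ π'.mat + err M γ μ σ (π.mat - π'.mat) := by
    rw [err_sub]; ring
  have h1 : |err M γ μ σ (π.mat - π'.mat)| ≤
      r * (3 * Fintype.card A / (1 - (γ : ℝ)) ^ 2) + r / (1 - (γ : ℝ)) ^ 2 := by
    refine (abs_sub _ _).trans (add_le_add ?_ (abs_grad_le M γ μ σ.prev hr))
    exact (Dataset.abs_scoreL_le _ hr).trans (mul_le_mul_of_nonneg_left hσ.mass hr0)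
  have h2 : r * (3 * Fintype.card A / (1 - (γ : ℝ)) ^ 2) + r / (1 - (γ : ℝ)) ^ 2 ≤
      4 * Fintype.card A * r / (1 - (γ : ℝ)) ^ 2 := by
    rw [← mul_div_assoc, ← add_div]
    gcongr
    nlinarith
  rw [e1]
  exact (abs_add_le _ _).trans (add_le_add h (h1.trans h2))

/-- The success guarantee in terms of all parameters of the algorithm and of its analysis. -/
theorem success_probability (hlam : (lam : ℝ) * (1 - (γ : ℝ)) = η * Fintype.card A)
    (hη : 0 < (η : ℝ)) {tol : ℝ} (htol : 0 ≤ tol) (herm : IsERM Pi tol erm) (hπ₁ : π₁ ∈ Pi)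
    {T : ℕ} (hT : 1 ≤ T) (W : Finset (Policy S A)) {r d u δ ε D : ℝ} (hr0 : 0 ≤ r) (hu : 0 ≤ u)
    (hW : ∀ π ∈ Pi, ∃ π' ∈ W, ∀ s, ∑ a, |(π.mat - π'.mat) s a| ≤ r)
    (hd : ∀ t : ℕ, T ≤ 2 * t → (1 - (lam : ℝ)) ^ t / (1 - (γ : ℝ)) ^ 2 ≤ d)
    (hδ : T * (W.card * (2 * Real.exp (-(u ^ 2 /
      (4 * (10 * lam * (Fintype.card A : ℝ) ^ 2 / (1 - (γ : ℝ)) ^ 4)))))) ≤ δ)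
    {πstar : Policy S A} (hD0 : 0 ≤ D) (hD : mismatch M γ πstar μ ≤ ENNReal.ofReal D)
    (hε : D * (2 / ((η : ℝ) * T * (1 - (γ : ℝ))) + 4 * (η : ℝ) / (1 - (γ : ℝ)) ^ 3 +
      4 * (d + u + 4 * Fintype.card A * r / (1 - (γ : ℝ)) ^ 2) +
      tol * (3 * Fintype.card A / (1 - (γ : ℝ)) ^ 2)) / (1 - (γ : ℝ)) ≤ ε) :
    ENNReal.ofReal (1 - δ) ≤ (run M γ η lam erm μ π₁ T).toOuterMeasure
      {σ | (∃ π, IsOutput T σ π) ∧ ∀ π, IsOutput T σ π →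
        V M γ πstar M.ρ - V M γ π M.ρ ≤
          ε + (mismatch M γ πstar μ).toReal * completeness M γ Pi μ / (1 - (γ : ℝ)) ^ 2} := by
  have hg := one_sub_pos γ
  have hA := card_pos_real (A := A)
  have hlam0 : 0 < (lam : ℝ) := by
    have : 0 < (lam : ℝ) * (1 - (γ : ℝ)) := by rw [hlam]; positivity
    exact (mul_pos_iff_of_pos_right hg).1 this
  -- Remaining bias of the initial estimate, stochastic deviation, and discretization by the cover.
  set e₁ := d + u + 4 * Fintype.card A * r / (1 - (γ : ℝ)) ^ 2 with he₁
  set e₂ := 2 * e₁ + tol * (3 * Fintype.card A / (1 - (γ : ℝ)) ^ 2) with he₂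
  set X := 2 * Real.exp (-(u ^ 2 /
      (4 * (10 * lam * (Fintype.card A : ℝ) ^ 2 / (1 - (γ : ℝ)) ^ 4)))) with hX
  have hreach := reachable_run M γ μ η lam erm π₁ hlam (fun D => (herm D).1) hπ₁
  have hconc : ∀ t, (run M γ η lam erm μ π₁ t).toOuterMeasure
      {σ | ¬ (T ≤ 2 * t → ∀ π ∈ Pi, |err M γ μ σ π.mat| ≤ e₁)} ≤
        W.card * ENNReal.ofReal X := fun t => by
    refine le_trans (PMF.toOuterMeasure_mono _ ?_) (toOuterMeasure_err_le M γ μ η lam erm π₁ hlam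
      hlam0 (fun D => (herm D).1) hπ₁ W t hu)
    rintro σ ⟨h1, h2⟩ h3
    refine h1 fun hTt π hπ => ?_
    obtain ⟨π', h4, h5⟩ := hW π hπ
    refine (abs_err_le_of_cover M γ μ η (hreach t σ h2) (h3 π' h4) h5 hr0).trans ?_
    rw [he₁]
    gcongr
    exact hd t hTt
  have hbad := toOuterMeasure_run_le M γ μ η lam erm π₁
    (Good := Progress M γ μ η Pi T e₁ e₂)
    (Conc := fun t σ => T ≤ 2 * t → ∀ π ∈ Pi, |err M γ μ σ π.mat| ≤ e₁)
    (progress_zero M γ μ η π₁ T e₁ e₂)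
    (fun t σ hσ hG q h hC => Progress.step M γ μ η lam erm hlam htol herm (hreach t σ hσ) hG q h hC)
    hconc T
  have hbad' : (run M γ η lam erm μ π₁ T).toOuterMeasure
      {σ | Progress M γ μ η Pi T e₁ e₂ T σ}ᶜ ≤ ENNReal.ofReal δ := by
    refine hbad.trans (le_trans (le_of_eq ?_) (ENNReal.ofReal_le_ofReal hδ))
    rw [ENNReal.ofReal_mul (Nat.cast_nonneg _), ENNReal.ofReal_mul (Nat.cast_nonneg _),
      ENNReal.ofReal_natCast, ENNReal.ofReal_natCast]
  have hgood : ENNReal.ofReal (1 - δ) ≤ (run M γ η lam erm μ π₁ T).toOuterMeasure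
      {σ | Progress M γ μ η Pi T e₁ e₂ T σ} := by
    have hδ0 : 0 ≤ δ := le_trans (by positivity) hδ
    rw [ENNReal.ofReal_sub _ hδ0, ENNReal.ofReal_one, tsub_le_iff_right,
      ← toOuterMeasure_add_compl (run M γ η lam erm μ π₁ T)
        {σ | Progress M γ μ η Pi T e₁ e₂ T σ}]
    exact add_le_add_right hbad' _
  refine hgood.trans (PMF.toOuterMeasure_mono _ ?_)
  rintro σ ⟨hP, hσ⟩
  obtain ⟨π₀, adv, hlog⟩ := (hreach T σ hσ).log hT
  refine ⟨exists_isOutput hlog, fun π hπ => ?_⟩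
  obtain ⟨h1, h2⟩ := Progress.gap_le M γ μ η hT hη hP hπ
  refine (V_sub_V_le M γ μ ⟨π₁, hπ₁⟩ h1 (ne_top_of_le_ne_top ENNReal.ofReal_ne_top hD) h2).trans ?_
  rw [add_comm]
  refine add_le_add_left (le_trans ?_ hε) _
  -- Only the optimization term is enlarged from the true mismatch to `D`; the completeness term
  -- keeps the true one.
  have hm : (mismatch M γ πstar μ).toReal ≤ D := ENNReal.toReal_le_of_le_ofReal hD0 hD
  have hd0 : 0 ≤ d := le_trans (div_nonneg (pow_nonneg (sub_nonneg.2 lam.2.2) T) (by positivity))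
    (hd T (by omega))
  have he₁0 : 0 ≤ e₁ := by positivity
  have eG : 2 / ((η : ℝ) * T * (1 - (γ : ℝ))) + 4 * (η : ℝ) / (1 - (γ : ℝ)) ^ 3 + 2 * e₁ + e₂ =
    2 / ((η : ℝ) * T * (1 - (γ : ℝ))) + 4 * (η : ℝ) / (1 - (γ : ℝ)) ^ 3 + 4 * e₁ +
      tol * (3 * Fintype.card A / (1 - (γ : ℝ)) ^ 2) := by rw [he₂]; ring
  rw [eG]
  gcongr

end Success

/-! ### Covers of policy classes -/

section Covers

variable {S : Type u} {A : Type v} [Fintype S] [Fintype A]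

/-- A policy as a point of the space in which covering numbers are taken. -/
def policyPoint (π : Policy S A) (s : S) : PiLp 1 (fun _ : A => ℝ) := WithLp.toLp 1 (π s).1

theorem sum_abs_sub_le_dist (π π' : Policy S A) (s : S) :
    ∑ a, |(π.mat - π'.mat) s a| ≤ dist (policyPoint π) (policyPoint π') := by
  refine le_trans (le_of_eq ?_) (dist_le_pi_dist (policyPoint π) (policyPoint π') s)
  rw [PiLp.dist_eq_of_L1]
  rfl

/-- Policies lie in a compact ball. Finiteness matters because `covNum` would read `⊤` as 0. -/
theorem externalCoveringNumber_ne_top (Pi : Set (Policy S A)) {ε : ℝ} (hε : 0 < ε) :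
    Metric.externalCoveringNumber ε.toNNReal (policyPoint '' Pi) ≠ ⊤ := by
  have hcpt : IsCompact (Metric.closedBall (0 : S → PiLp 1 (fun _ : A => ℝ)) 1) :=
    isCompact_closedBall _ _
  obtain ⟨N, -, hN, hcov⟩ := Metric.exists_finite_isCover_of_isCompact
    (ε := ε.toNNReal) (Real.toNNReal_pos.2 hε).ne' hcpt
  refine ne_top_of_le_ne_top (Set.encard_ne_top_iff.2 hN)
    (Metric.IsCover.externalCoveringNumber_le_encard (hcov.anti ?_))
  rintro _ ⟨π, -, rfl⟩
  rw [mem_closedBall_zero_iff]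
  refine (pi_norm_le_iff_of_nonneg zero_le_one).2 fun s => ?_
  rw [PiLp.norm_eq_of_L1]
  exact (sum_abs_mat π s).le

theorem coe_covNum (Pi : Set (Policy S A)) {ε : ℝ} (hε : 0 < ε) :
    (covNum Pi ε : ℕ∞) = Metric.externalCoveringNumber ε.toNNReal (policyPoint '' Pi) :=
  ENat.natCast_toNat (externalCoveringNumber_ne_top Pi hε)

theorem one_le_covNum {Pi : Set (Policy S A)} (hPi : Pi.Nonempty) {ε : ℝ} (hε : 0 < ε) :
    1 ≤ covNum Pi ε := by
  have h : 0 < Metric.externalCoveringNumber ε.toNNReal (policyPoint '' Pi) :=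
    Metric.externalCoveringNumber_pos_iff.2 (hPi.image _)
  rw [← coe_covNum Pi hε] at h
  exact_mod_cast h

/-- A policy class has a finite cover by policies, of twice the radius. -/
theorem exists_cover {Pi : Set (Policy S A)} (hPi : Pi.Nonempty) {ε : ℝ} (hε : 0 < ε) :
    ∃ W : Finset (Policy S A), W.card ≤ covNum Pi ε ∧
      ∀ π ∈ Pi, ∃ π' ∈ W, ∀ s, ∑ a, |(π.mat - π'.mat) s a| ≤ 2 * ε := by
  classical
  -- External centres are arbitrary matrices, while the noise bounds need policies; doubling the
  -- radius moves the centres into the class.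
  have hle := Metric.coveringNumber_two_mul_le_externalCoveringNumber ε.toNNReal (policyPoint '' Pi)
  have hfin : Metric.coveringNumber (2 * ε.toNNReal) (policyPoint '' Pi) ≠ ⊤ :=
    ne_top_of_le_ne_top (externalCoveringNumber_ne_top Pi hε) hle
  have hcov := Metric.isCover_minimalCover hfin
  have hcard := Metric.encard_minimalCover hfin
  have hsub : ∀ y ∈ Metric.minimalCover (2 * ε.toNNReal) (policyPoint '' Pi),
      ∃ π : Policy S A, π ∈ Pi ∧ policyPoint π = y := fun y hy =>
    (Set.mem_image _ _ _).1 (Metric.minimalCover_subset hy)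
  have hF := Metric.finite_minimalCover (ε := 2 * ε.toNNReal) (A := policyPoint '' Pi)
  have : Nonempty (Policy S A) := ⟨hPi.some⟩
  choose! f hf using hsub
  refine ⟨hF.toFinset.image f, ?_, fun π hπ => ?_⟩
  · refine Finset.card_image_le.trans ?_
    rw [← coe_covNum Pi hε, ← hcard, hF.encard_eq_coe_toFinset_card] at hle
    exact_mod_cast hle
  · obtain ⟨y, hy, hd⟩ := hcov ⟨π, hπ, rfl⟩
    refine ⟨f y, Finset.mem_image_of_mem f (hF.mem_toFinset.2 hy), fun s => ?_⟩
    refine (sum_abs_sub_le_dist π (f y) s).trans ?_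
    rw [(hf y hy).2]
    have hd' : edist (policyPoint π) y ≤ ((2 * ε.toNNReal : ℝ≥0) : ℝ≥0∞) := hd
    rw [edist_le_coe] at hd'
    have h2 : dist (policyPoint π) y ≤ ((2 * ε.toNNReal : ℝ≥0) : ℝ) := NNReal.coe_le_coe.2 hd'
    rwa [NNReal.coe_mul, Real.coe_toNNReal _ hε.le] at h2

end Covers

/-! ### Lengths of episodes -/

section Lengths

variable {S : Type u} {A : Type v} [Fintype S] [Fintype A] [Nonempty A]
  (M : MDP S A) (γ : Discount) (μ : PMF S)

theorem lexp_geom_le : lexp (geom γ) (fun n => (n : ℝ≥0∞)) ≤ ENNReal.ofReal (1 / (1 - (γ : ℝ))) := by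
  have hg := one_sub_pos γ
  have hγ := γ.2.1
  have h1 := (hasSum_coe_mul_geometric_of_norm_lt_one (r := (γ : ℝ)) (by
    rw [Real.norm_of_nonneg hγ]; exact γ.2.2)).mul_left (1 - (γ : ℝ))
  have h2 : lexp (geom γ) (fun n => (n : ℝ≥0∞)) =
      ENNReal.ofReal ((1 - (γ : ℝ)) * (γ / (1 - (γ : ℝ)) ^ 2)) := by
    rw [← h1.tsum_eq, ENNReal.ofReal_tsum_of_nonneg (fun n => by positivity) h1.summable, lexp]
    congr 1; ext n
    have : geom γ n = ENNReal.ofReal ((1 - (γ : ℝ)) * (γ : ℝ) ^ n) := rfl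
    rw [this, ← ENNReal.ofReal_natCast, ← ENNReal.ofReal_mul (by positivity)]
    congr 1; ring
  rw [h2]
  refine ENNReal.ofReal_le_ofReal ?_
  have : (1 - (γ : ℝ)) * (γ / (1 - (γ : ℝ)) ^ 2) = γ / (1 - (γ : ℝ)) := by field_simp
  rw [this]
  exact div_le_div_of_nonneg_right γ.2.2.le hg.le

theorem one_le_ofReal_inv : (1 : ℝ≥0∞) ≤ ENNReal.ofReal (1 / (1 - (γ : ℝ))) := by
  refine ENNReal.one_le_ofReal.2 ?_
  rw [le_div_iff₀ (one_sub_pos γ)]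
  linarith [γ.2.1]

theorem lexp_qSampler_len_le (π : Policy S A) :
    lexp (qSampler M γ π μ) (fun e => (e.len : ℝ≥0∞)) ≤
      5 * ENNReal.ofReal (1 / (1 - (γ : ℝ))) := by
  have h1 := lexp_geom_le γ
  have h2 := one_le_ofReal_inv γ
  simp only [qSampler, lexp_bind, lexp_pure, Nat.cast_add, Nat.cast_one, lexp_add, lexp_const]
  set x := ENNReal.ofReal (1 / (1 - (γ : ℝ)))
  calc _ ≤ x + x + x := by gcongr
    _ = 3 * x := by ring
    _ ≤ 5 * x := by gcongr; norm_num

theorem lexp_hSampler_len_le (π : Policy S A) :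
    lexp (hSampler M γ π μ) (fun e => (e.len : ℝ≥0∞)) ≤
      5 * ENNReal.ofReal (1 / (1 - (γ : ℝ))) := by
  have h1 := lexp_geom_le γ
  have h2 := one_le_ofReal_inv γ
  simp only [hSampler, lexp_bind, lexp_pure, Nat.cast_add, Nat.cast_one, lexp_add, lexp_const]
  set x := ENNReal.ofReal (1 / (1 - (γ : ℝ)))
  calc _ ≤ x + x + x + x + x := by gcongr
    _ = 5 * x := by ring

theorem lexp_hSamplerMixed (π π' : Policy S A) (f : HEpisode S A → ℝ≥0∞) :
    lexp (hSamplerMixed M γ π π' μ) f =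
      ∫⁻ b : unitInterval, lexp (hSampler M γ (mix b π π') μ) f := by
  simp only [lexp]
  rw [MeasureTheory.lintegral_tsum fun e =>
    ((meas_hSampler M γ π π' μ e).mul_const _).aemeasurable]
  congr 1; ext e
  rw [MeasureTheory.lintegral_mul_const _ (meas_hSampler M γ π π' μ e)]
  rfl

theorem lexp_hSamplerMixed_len_le (π π' : Policy S A) :
    lexp (hSamplerMixed M γ π π' μ) (fun e => (e.len : ℝ≥0∞)) ≤
      5 * ENNReal.ofReal (1 / (1 - (γ : ℝ))) := by
  rw [lexp_hSamplerMixed]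
  refine (MeasureTheory.lintegral_mono fun b =>
    lexp_hSampler_len_le M γ μ (mix b π π')).trans ?_
  simp

theorem lexp_run_lens_le (η lam : unitInterval) (erm : Dataset S A → Policy S A)
    (π₁ : Policy S A) (t i : ℕ) :
    lexp (run M γ η lam erm μ π₁ t) (fun σ => ((σ.lens.getD i 0 : ℕ) : ℝ≥0∞)) ≤
      5 * ENNReal.ofReal (1 / (1 - (γ : ℝ))) := by
  induction t generalizing i with
  | zero => rw [run, lexp_pure]; simp
  | succ t ih =>
    rw [lexp_run_succ]
    -- The newest H-episode has index 0, the newest Q-episode index 1, and older ones are shifted by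
    -- two; indices past the end read as length 0.
    match i with
    | 0 =>
      simp only [update, List.getD_cons_zero]
      rw [← lexp_const (run M γ η lam erm μ π₁ t) (5 * ENNReal.ofReal (1 / (1 - (γ : ℝ))))]
      refine lexp_mono fun σ _ => ?_
      rw [lexp_const]
      exact lexp_hSamplerMixed_len_le M γ μ _ _
    | 1 =>
      simp only [update, List.getD_cons_succ, List.getD_cons_zero, lexp_const]
      rw [← lexp_const (run M γ η lam erm μ π₁ t) (5 * ENNReal.ofReal (1 / (1 - (γ : ℝ))))]
      exact lexp_mono fun σ _ => lexp_qSampler_len_le M γ μ _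
    | i + 2 =>
      simp only [update, List.getD_cons_succ, lexp_const]
      exact ih i

end Lengths

/-! ### The choice of the parameters -/

section Parameters

variable {a D ε g δ N : ℝ}

theorem log_two_ge : (2 : ℝ) / 3 ≤ Real.log 2 := by
  have := Real.log_two_gt_d9
  linarith

/-- The ratio inside the logarithmic factor dominates `a D / g`. -/
theorem div_le_ratio (ha : 1 ≤ a) (hD : 1 ≤ D) (hε : 0 < ε) (hg0 : 0 < g) (hεg : ε * g < 1) :
    a * D / g ≤ a * D / (g ^ 2 * ε) := by
  have haD : 0 < a * D := by positivity
  gcongr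
  nlinarith

theorem one_le_log_ratio (ha : 1 ≤ a) (hD : 1 ≤ D) (hε : 0 < ε) (hg0 : 0 < g) (hg1 : g ≤ 1)
    (hεg : ε * g < 1) : 1 ≤ Real.log (2 + a * D / (g ^ 2 * ε)) := by
  have h1 := div_le_ratio ha hD hε hg0 hεg
  have h2 : 1 ≤ a * D / g := by
    rw [one_le_div hg0]
    exact hg1.trans (one_le_mul_of_one_le_of_one_le ha hD)
  rw [Real.le_log_iff_exp_le (by positivity)]
  have := Real.exp_one_lt_d9
  linarith

theorem two_thirds_le_log (hδ0 : 0 < δ) (hδ1 : δ < 1) (hN : 1 ≤ N) :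
    2 / 3 ≤ Real.log (2 * N / δ) := by
  refine log_two_ge.trans (Real.log_le_log two_pos ?_)
  rw [le_div_iff₀ hδ0]
  nlinarith

/-- The logarithm of the number of events in the union bound. -/
theorem log_union_le (ha : 1 ≤ a) (hD : 1 ≤ D) (hε : 0 < ε) (hg0 : 0 < g) (hg1 : g ≤ 1)
    (hεg : ε * g < 1) {ℓ L X : ℝ} (hℓ : 2 / 3 ≤ ℓ) (hL : L = Real.log (2 + a * D / (g ^ 2 * ε)))
    (hX : X = a ^ 3 * D ^ 3 / (g ^ 9 * ε ^ 3)) :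
    ℓ + Real.log (2 ^ 20 * (X * (100 * ℓ * L))) ≤ 100 * ℓ * L := by
  have hL1 : 1 ≤ L := hL ▸ one_le_log_ratio ha hD hε hg0 hg1 hεg
  have hX0 : 0 < X := by rw [hX]; positivity
  -- With `y = aD/(g²ε)` one has `X = y³ (1/g)³` and `1/g ≤ y`.
  have hX6 : Real.log X ≤ 6 * L := by
    set y := a * D / (g ^ 2 * ε) with hy
    have hy0 : 0 < y := by positivity
    have h1 : 1 / g ≤ y := by
      refine le_trans ?_ (div_le_ratio ha hD hε hg0 hεg)
      gcongr
      exact one_le_mul_of_one_le_of_one_le ha hD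
    have h2 : X = y ^ 3 * (1 / g) ^ 3 := by
      rw [hX, hy]; field_simp
    have h3 : X ≤ (2 + y) ^ 6 := by
      calc X ≤ y ^ 3 * y ^ 3 := by rw [h2]; gcongr
        _ = y ^ 6 := by ring
        _ ≤ (2 + y) ^ 6 := by gcongr; linarith
    calc Real.log X ≤ Real.log ((2 + y) ^ 6) := Real.log_le_log hX0 h3
      _ = 6 * L := by rw [Real.log_pow, hL]; norm_num
  have hlogℓ := Real.log_le_sub_one_of_pos (x := ℓ) (by linarith)
  have hlogL := Real.log_le_sub_one_of_pos (x := L) (by linarith)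
  have h100 : Real.log 100 ≤ 5 := by
    have h : Real.log 100 ≤ Real.log ((2 : ℝ) ^ 7) := Real.log_le_log (by norm_num) (by norm_num)
    rw [Real.log_pow] at h
    have := Real.log_two_lt_d9
    push_cast at h
    linarith
  have h20 : Real.log ((2 : ℝ) ^ 20) ≤ 14 := by
    rw [Real.log_pow]
    have := Real.log_two_lt_d9
    push_cast
    linarith
  have hℓ0 : 0 < ℓ := by linarith
  have hL0 : 0 < L := by linarith
  rw [Real.log_mul (by positivity) (by positivity), Real.log_mul hX0.ne' (by positivity),
    Real.log_mul (by positivity) hL0.ne', Real.log_mul (by norm_num) hℓ0.ne']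
  -- The logarithms sum to at most `17 + 7L + 2ℓ`, and `1`, `L` and `ℓ` are each at most `(3/2) ℓL`.
  have p1 : ℓ ≤ ℓ * L := le_mul_of_one_le_right hℓ0.le hL1
  have p2 : 2 / 3 * L ≤ ℓ * L := mul_le_mul_of_nonneg_right hℓ hL0.le
  linarith

/-- Polynomial decay is enough: with it the initial bias is no larger than the optimization term
`2/(ηTg)`. -/
theorem one_sub_pow_le {x : ℝ} (hx0 : 0 < x) (hx1 : x ≤ 1) {t : ℕ} {T : ℝ} (hT : 0 < T)
    (h : T ≤ 2 * t) : (1 - x) ^ t ≤ 2 / (x * T) := by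
  have h1 : (1 - x) ^ t ≤ Real.exp (-(x * t)) := by
    rw [show -(x * t) = (t : ℝ) * -x by ring, Real.exp_nat_mul]
    exact pow_le_pow_left₀ (sub_nonneg.2 hx1) (Real.one_sub_le_exp_neg x) t
  have ht : (0 : ℝ) < t := by linarith
  have h2 : Real.exp (-(x * t)) ≤ 1 / (x * t) := by
    rw [Real.exp_neg, ← one_div]
    have := Real.add_one_le_exp (x * t)
    exact one_div_le_one_div_of_le (by positivity) (by linarith)
  refine h1.trans (h2.trans ?_)
  rw [div_le_div_iff₀ (by positivity) (by positivity)]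
  nlinarith

/-- Parameters for which the guarantee of the algorithm meets the accuracy `ε`. -/
theorem exists_parameters (ha : 1 ≤ a) (hD : 1 ≤ D) (hε : 0 < ε) (hg0 : 0 < g) (hg1 : g ≤ 1)
    (hεg : ε * g < 1) (hδ0 : 0 < δ) (hδ1 : δ < 1) (hN : 1 ≤ N) :
    ∃ (η lam : unitInterval) (T : ℕ), 0 < (η : ℝ) ∧ (lam : ℝ) * g = η * a ∧ 1 ≤ T ∧
      (∀ t : ℕ, T ≤ 2 * t → (1 - (lam : ℝ)) ^ t / g ^ 2 ≤ ε * g / (20 * D)) ∧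
      T * (N * (2 * Real.exp (-((ε * g / (20 * D)) ^ 2 / (4 * (10 * lam * a ^ 2 / g ^ 4)))))) ≤ δ ∧
      D * (2 / ((η : ℝ) * T * g) + 4 * (η : ℝ) / g ^ 3 +
        4 * (ε * g / (20 * D) + ε * g / (20 * D) +
          4 * a * (2 * (1 / 200 * (ε * g ^ 3 / (a * D)))) / g ^ 2) +
        1 / 200 * (ε * g ^ 3 / (a * D)) * (3 * a / g ^ 2)) / g ≤ ε ∧
      2 * (T : ℝ) ≤ 10 ^ 9 * (1 + a ^ 3 * D ^ 3 / (g ^ 9 * ε ^ 3) * Real.log (2 * N / δ) *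
        Real.log (2 + a * D / (g ^ 2 * ε))) := by
  set L := Real.log (2 + a * D / (g ^ 2 * ε)) with hL
  set ℓ := Real.log (2 * N / δ) with hℓ
  set X := a ^ 3 * D ^ 3 / (g ^ 9 * ε ^ 3) with hX
  have hL1 : 1 ≤ L := one_le_log_ratio ha hD hε hg0 hg1 hεg
  have hℓ1 : 2 / 3 ≤ ℓ := two_thirds_le_log hδ0 hδ1 hN
  have hU := log_union_le ha hD hε hg0 hg1 hεg hℓ1 hL hX
  set Λ := 100 * ℓ * L with hΛ
  have hΛ1 : 1 ≤ Λ := by rw [hΛ]; nlinarith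
  have hX1 : 1 ≤ X := by
    have h1 : (ε * g) ^ 3 ≤ 1 := pow_le_one₀ (by positivity) hεg.le
    have h2 : g ^ 6 ≤ 1 := pow_le_one₀ hg0.le hg1
    have h3 : g ^ 9 * ε ^ 3 ≤ 1 := by
      calc g ^ 9 * ε ^ 3 = (ε * g) ^ 3 * g ^ 6 := by ring
        _ ≤ 1 := mul_le_one₀ h1 (by positivity) h2
    rw [hX, one_le_div (by positivity)]
    exact h3.trans (one_le_mul_of_one_le_of_one_le (one_le_pow₀ ha) (one_le_pow₀ hD))
  have ha0 : 0 < a := by linarith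
  have hD0 : 0 < D := by linarith
  have hΛ0 : 0 < Λ := by linarith
  have hX0 : 0 < X := by linarith
  -- `lam` is chosen so that the tail exponent `u²/(4v)` at deviation `u = εg/(20D)` equals `Λ`;
  -- then `η = lam·g/a` by the coupling.
  set η := ε ^ 2 * g ^ 7 / (16000 * D ^ 2 * a ^ 3 * Λ) with hη
  set lam := ε ^ 2 * g ^ 6 / (16000 * D ^ 2 * a ^ 2 * Λ) with hlam
  have hη0 : 0 < η := by positivity
  have hlam0 : 0 < lam := by positivity
  have hlamg : lam * g = η * a := by
    rw [hlam, hη]; field_simp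
  have hεg2 : (ε * g) ^ 2 ≤ 1 := pow_le_one₀ (by positivity) hεg.le
  have hden : ∀ k : ℕ, (1 : ℝ) ≤ 16000 * D ^ 2 * a ^ k * Λ := fun k => by
    have h1 : (1 : ℝ) ≤ D ^ 2 := one_le_pow₀ hD
    have h2 : (1 : ℝ) ≤ a ^ k := one_le_pow₀ ha
    exact one_le_mul_of_one_le_of_one_le (one_le_mul_of_one_le_of_one_le
      (one_le_mul_of_one_le_of_one_le (by norm_num) h1) h2) hΛ1
  have hη1 : η ≤ 1 := by
    rw [hη, div_le_one (by positivity)]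
    refine le_trans ?_ (hden 3)
    calc ε ^ 2 * g ^ 7 = (ε * g) ^ 2 * g ^ 5 := by ring
      _ ≤ 1 := mul_le_one₀ hεg2 (by positivity) (pow_le_one₀ hg0.le hg1)
  have hlam1 : lam ≤ 1 := by
    rw [hlam, div_le_one (by positivity)]
    refine le_trans ?_ (hden 2)
    calc ε ^ 2 * g ^ 6 = (ε * g) ^ 2 * g ^ 4 := by ring
      _ ≤ 1 := mul_le_one₀ hεg2 (by positivity) (pow_le_one₀ hg0.le hg1)
  -- The constant is `40 · 16000`, so that `ηT ≥ 40D/(εg²)`, which brings `2/(ηTg)` below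
  -- `εg/(20D)`.
  set T := ⌈640000 * (X * Λ)⌉₊ with hT
  have hXΛ : 1 ≤ X * Λ := one_le_mul_of_one_le_of_one_le hX1 hΛ1
  have hTle : 640000 * (X * Λ) ≤ (T : ℝ) := Nat.le_ceil _
  have hTlt : (T : ℝ) < 640000 * (X * Λ) + 1 := Nat.ceil_lt_add_one (by positivity)
  have hT0 : (0 : ℝ) < T := by linarith
  have hηT : 40 * D / (ε * g ^ 2) ≤ η * T := by
    refine le_trans (le_of_eq ?_) (mul_le_mul_of_nonneg_left hTle hη0.le)
    rw [hη, hX]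
    field_simp
    norm_num
  set E := ε * g / D with hE
  have hE0 : 0 < E := by positivity
  have hE20 : ε * g / (20 * D) = E / 20 := by rw [hE]; field_simp
  have b1 : 2 / (η * T * g) ≤ E / 20 := by
    calc 2 / (η * T * g) ≤ 2 / (40 * D / (ε * g ^ 2) * g) := by gcongr
      _ = E / 20 := by rw [hE]; field_simp; norm_num
  refine ⟨⟨η, hη0.le, hη1⟩, ⟨lam, hlam0.le, hlam1⟩, T, hη0, hlamg, ?_, ?_, ?_, ?_, ?_⟩
  · exact Nat.one_le_iff_ne_zero.2 fun h => by simp [h] at hT0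
  · intro t ht
    have ht' : (T : ℝ) ≤ 2 * t := by exact_mod_cast ht
    rw [hE20]
    refine le_trans ?_ b1
    rw [div_le_iff₀ (by positivity)]
    refine (one_sub_pow_le hlam0 hlam1 hT0 ht').trans ?_
    have e : lam = η * a / g := by rw [← hlamg]; field_simp
    rw [e]
    have e' : 2 / (η * a / g * T) = 2 / (η * T * g) * g ^ 2 / a := by field_simp
    rw [e']
    exact div_le_self (by positivity) ha
  · have e : (ε * g / (20 * D)) ^ 2 / (4 * (10 * lam * a ^ 2 / g ^ 4)) = Λ := by
      rw [hlam]
      field_simp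
      norm_num
    change (T : ℝ) * (N * (2 * Real.exp (-((ε * g / (20 * D)) ^ 2 /
      (4 * (10 * lam * a ^ 2 / g ^ 4)))))) ≤ δ
    rw [e]
    -- The union bound asks for `ℓ + log T ≤ Λ`; the ceiling costs at most one more `X Λ`, and
    -- `640001 ≤ 2^20`.
    have hT2 : (T : ℝ) ≤ 2 ^ 20 * (X * Λ) := by norm_num; linarith
    have h1 : Real.log (2 * N / δ * T) ≤ Λ := by
      rw [Real.log_mul (by positivity) hT0.ne']
      exact (add_le_add_right (Real.log_le_log hT0 hT2) _).trans hU
    have h2 : 2 * N / δ * T ≤ Real.exp Λ := (Real.log_le_iff_le_exp (by positivity)).1 h1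
    rw [Real.exp_neg]
    have h3 := Real.exp_pos Λ
    have e2 : (T : ℝ) * (N * (2 * (Real.exp Λ)⁻¹)) = δ * ((2 * N / δ * T) / Real.exp Λ) := by
      field_simp
    rw [e2]
    exact mul_le_of_le_one_right hδ0.le ((div_le_one h3).2 h2)
  · have b2 : 4 * η / g ^ 3 ≤ E / 20 := by
      have e : 4 * η / g ^ 3 = E * ((ε * g) * g ^ 2) * (80 / (16000 * D ^ 1 * a ^ 3 * Λ)) / 20 := by
        rw [hη, hE]; field_simp; ring
      rw [e]
      have h1 : ε * g * g ^ 2 ≤ 1 := mul_le_one₀ hεg.le (by positivity) (pow_le_one₀ hg0.le hg1)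
      have h2 : 80 / (16000 * D ^ 1 * a ^ 3 * Λ) ≤ 1 := by
        rw [div_le_one (by positivity)]
        have : (1 : ℝ) ≤ D ^ 1 * a ^ 3 * Λ := one_le_mul_of_one_le_of_one_le
          (one_le_mul_of_one_le_of_one_le (one_le_pow₀ hD) (one_le_pow₀ ha)) hΛ1
        nlinarith
      have h3 : E * (ε * g * g ^ 2) ≤ E := mul_le_of_le_one_right hE0.le h1
      have h4 := mul_le_of_le_one_right (show 0 ≤ E * (ε * g * g ^ 2) by positivity) h2
      linarith
    have e3 : 4 * a * (2 * (1 / 200 * (ε * g ^ 3 / (a * D)))) / g ^ 2 = E / 25 := by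
      rw [hE]; field_simp; norm_num
    have e4 : 1 / 200 * (ε * g ^ 3 / (a * D)) * (3 * a / g ^ 2) = 3 * E / 200 := by
      rw [hE]; field_simp
    change D * (2 / (η * T * g) + 4 * η / g ^ 3 + 4 * (ε * g / (20 * D) + ε * g / (20 * D) +
      4 * a * (2 * (1 / 200 * (ε * g ^ 3 / (a * D)))) / g ^ 2) +
      1 / 200 * (ε * g ^ 3 / (a * D)) * (3 * a / g ^ 2)) / g ≤ ε
    -- The bracket must be at most `E`. Its terms sum to at most `E/20 + E/20 + 4(E/20 + E/20 +
    -- E/25) + 3E/200 = 0.675 E`.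
    rw [e3, e4, hE20]
    have e5 : ε = D * E / g := by rw [hE]; field_simp
    conv_rhs => rw [e5]
    gcongr
    linarith
  · have h1 : X * Λ = 100 * (X * ℓ * L) := by rw [hΛ]; ring
    have h2 : 0 ≤ X * ℓ * L := by positivity
    rw [h1] at hTlt
    linarith

/-- The logarithmic scaling of covering numbers transfers the sample complexity to scale `ε`. -/
theorem log_covering_le (ha : 1 ≤ a) (hD : 1 ≤ D) (hε : 0 < ε) (hg0 : 0 < g) (hg1 : g ≤ 1)
    (hεg : ε * g < 1) (hδ0 : 0 < δ) (hδ1 : δ < 1) (hN : 1 ≤ N) {N' κ : ℝ} (hN' : 1 ≤ N')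
    (hκ : 1 ≤ κ) (h : Real.log N' ≤ κ * (1 + Real.log (ε / (1 / 200 * (ε * g ^ 3 / (a * D))))) *
      (1 + Real.log N)) :
    Real.log (2 * N' / δ) ≤
      30 * κ * Real.log (2 + a * D / (g ^ 2 * ε)) * Real.log (2 * N / δ) := by
  have hL1 := one_le_log_ratio ha hD hε hg0 hg1 hεg
  have hy := div_le_ratio ha hD hε hg0 hεg
  set y := a * D / (g ^ 2 * ε) with hy'
  set L := Real.log (2 + y) with hL
  have hℓ1 := two_thirds_le_log hδ0 hδ1 hN
  set ℓ := Real.log (2 * N / δ) with hℓ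
  have haD1 : 1 ≤ a * D := one_le_mul_of_one_le_of_one_le ha hD
  have hlogN : 0 ≤ Real.log N := Real.log_nonneg hN
  have hlogδ : Real.log δ ≤ 0 := (Real.log_neg hδ0 hδ1).le
  have e1 : Real.log (2 * N' / δ) = Real.log 2 + Real.log N' - Real.log δ := by
    rw [Real.log_div (by positivity) hδ0.ne', Real.log_mul two_ne_zero (by positivity)]
  have e2 : ℓ = Real.log 2 + Real.log N - Real.log δ := by
    rw [hℓ, Real.log_div (by positivity) hδ0.ne', Real.log_mul two_ne_zero (by positivity)]
  have hratio : Real.log (ε / (1 / 200 * (ε * g ^ 3 / (a * D)))) ≤ 6 + 3 * L := by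
    have e3 : ε / (1 / 200 * (ε * g ^ 3 / (a * D))) = 200 * (a * D / g ^ 3) := by
      field_simp
    have h1 : a * D / g ^ 3 ≤ (2 + y) ^ 3 := by
      calc a * D / g ^ 3 ≤ (a * D) ^ 3 / g ^ 3 := by
            gcongr
            exact le_self_pow₀ haD1 (by norm_num)
        _ = (a * D / g) ^ 3 := by rw [div_pow]
        _ ≤ (2 + y) ^ 3 := by gcongr; linarith
    have h200 : Real.log 200 ≤ 6 := by
      have h : Real.log 200 ≤ Real.log ((2 : ℝ) ^ 8) := Real.log_le_log (by norm_num) (by norm_num)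
      rw [Real.log_pow] at h
      have := Real.log_two_lt_d9
      push_cast at h
      linarith
    rw [e3, Real.log_mul (by norm_num) (by positivity)]
    refine add_le_add h200 ((Real.log_le_log (by positivity) h1).trans (le_of_eq ?_))
    rw [Real.log_pow]
    norm_num [hL]
  have h2 : 1 + Real.log (ε / (1 / 200 * (ε * g ^ 3 / (a * D)))) ≤ 10 * L := by linarith
  -- Together with the ratio bound `10L` this gives `25κLℓ` for `log N'`; the remaining `log 2 - log
  -- δ` is at most `ℓ ≤ κLℓ`.
  have h3 : 1 + Real.log N ≤ 5 / 2 * ℓ := by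
    have := log_two_ge
    linarith
  have hL0 : 0 < L := by linarith
  have hℓ0 : 0 < ℓ := by linarith
  have h4 : Real.log N' ≤ κ * (10 * L) * (5 / 2 * ℓ) := by
    refine h.trans ?_
    gcongr
  have h5 : ℓ ≤ κ * L * ℓ :=
    le_mul_of_one_le_left hℓ0.le (one_le_mul_of_one_le_of_one_le hκ hL1)
  rw [e1]
  linarith

end Parameters

/-! ### The trivial regime `ε ≥ 1/(1-γ)` -/

section LargeAccuracy

variable {S : Type u} {A : Type v} [Fintype S] [Fintype A] [Nonempty A]
  (M : MDP S A) (γ : Discount) (μ : PMF S)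

/-- One iteration suffices when the accuracy exceeds the range of the value function. -/
theorem success_of_large_accuracy {ε δ : ℝ} (hδ : 0 < δ) (hε : 1 / (1 - (γ : ℝ)) ≤ ε)
    {Pi : Set (Policy S A)} {erm : Dataset S A → Policy S A} (herm : ∀ D, erm D ∈ Pi)
    {π₁ : Policy S A} (hπ₁ : π₁ ∈ Pi) (πstar : Policy S A) :
    ENNReal.ofReal (1 - δ) ≤ (run M γ 0 0 erm μ π₁ 1).toOuterMeasure
      {σ | (∃ π, IsOutput 1 σ π) ∧ ∀ π, IsOutput 1 σ π →
        V M γ πstar M.ρ - V M γ π M.ρ ≤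
          ε + (mismatch M γ πstar μ).toReal * completeness M γ Pi μ / (1 - (γ : ℝ)) ^ 2} := by
  have h1 : ENNReal.ofReal (1 - δ) ≤ 1 := ENNReal.ofReal_le_one.2 (by linarith)
  refine h1.trans (le_of_eq ((PMF.toOuterMeasure_apply_eq_one_iff _ _).2 fun σ hσ => ?_).symm)
  obtain ⟨π₀, adv, hlog⟩ :=
    (reachable_run M γ μ 0 0 erm π₁ (by simp) herm hπ₁ 1 σ hσ).log le_rfl
  refine ⟨exists_isOutput hlog, fun π _ => ?_⟩
  have h2 := V_le M γ M.ρ πstar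
  have h3 := V_nonneg M γ M.ρ π
  have h4 : 0 ≤ (mismatch M γ πstar μ).toReal * completeness M γ Pi μ / (1 - (γ : ℝ)) ^ 2 :=
    div_nonneg (mul_nonneg ENNReal.toReal_nonneg (completeness_nonneg M γ μ Pi)) (sq_nonneg _)
  linarith

end LargeAccuracy

end VRCPI
end

/-! ### Assembly of the main theorem -/

theorem mainTheorem2 :
    -- universal constants
    ∃ (C c : ℝ) (k : ℕ), 0 < C ∧ 0 < c ∧ c ≤ 1 ∧
    -- what the parameters of the algorithm may depend on
    ∀ (S : Type u) (A : Type v) [Fintype S] [Fintype A] [Nonempty A]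
      (Pi : Set (VRCPI.Policy S A)) (_ : Pi.Nonempty) (γ : VRCPI.Discount)
      (ε δ D : ℝ) (_ : 0 < ε) (_ : 0 < δ) (_ : δ < 1) (_ : 1 ≤ D),
    ∃ (η lam : unitInterval) (T : ℕ),
    -- the unknown environment, the restart distribution, the oracle and the initial policy
    ∀ (M : VRCPI.MDP S A) (μ : PMF S) (πstar : VRCPI.Policy S A)
      (_ : VRCPI.IsOptimal M γ πstar)
      (_ : VRCPI.mismatch M γ πstar μ ≤ ENNReal.ofReal D)
      (erm : VRCPI.Dataset S A → VRCPI.Policy S A)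
      (_ : VRCPI.IsERM Pi (c * (ε * (1 - (γ : ℝ)) ^ 3 / (Fintype.card A * D))) erm)
      (π₁ : VRCPI.Policy S A) (_ : π₁ ∈ Pi),
    -- with probability at least `1 - δ`, the output is nearly optimal
    ENNReal.ofReal (1 - δ) ≤ (VRCPI.run M γ η lam erm μ π₁ T).toOuterMeasure
      {σ | (∃ π, VRCPI.IsOutput T σ π) ∧ ∀ π, VRCPI.IsOutput T σ π →
        VRCPI.V M γ πstar M.ρ - VRCPI.V M γ π M.ρ ≤
          ε + (VRCPI.mismatch M γ πstar μ).toReal * VRCPI.completeness M γ Pi μ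
            / (1 - (γ : ℝ)) ^ 2} ∧
    -- number of episodes, through the covering number at the scale of the analysis
    (∀ σ ∈ (VRCPI.run M γ η lam erm μ π₁ T).support, (σ.lens.length : ℝ) ≤
      C * (1 + (Fintype.card A : ℝ) ^ 3 * D ^ 3 / ((1 - (γ : ℝ)) ^ 9 * ε ^ 3)
        * Real.log (2 * VRCPI.covNum Pi (c * (ε * (1 - (γ : ℝ)) ^ 3 / (Fintype.card A * D))) / δ)
        * Real.log (2 + Fintype.card A * D / ((1 - (γ : ℝ)) ^ 2 * ε)) ^ k)) ∧
    -- number of episodes, through `|Π_ε|`, when covering numbers scale logarithmically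
    (∀ κ : ℝ, 1 ≤ κ → VRCPI.LogScaling Pi ε κ →
      ∀ σ ∈ (VRCPI.run M γ η lam erm μ π₁ T).support, (σ.lens.length : ℝ) ≤
        C * (1 + κ * ((Fintype.card A : ℝ) ^ 3 * D ^ 3 / ((1 - (γ : ℝ)) ^ 9 * ε ^ 3))
          * Real.log (2 * VRCPI.covNum Pi ε / δ)
          * Real.log (2 + Fintype.card A * D / ((1 - (γ : ℝ)) ^ 2 * ε)) ^ k)) ∧
    -- every episode has expected length `O(1 / (1 - γ))`
    (∀ i : ℕ, ∑' σ, VRCPI.run M γ η lam erm μ π₁ T σ * ((σ.lens.getD i 0 : ℕ) : ENNReal) ≤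
      ENNReal.ofReal (C / (1 - (γ : ℝ)))) := by
  -- One power of `L` comes from `Λ`, the second from passing to the covering number at scale `ε`;
  -- that passage also costs a factor 30 on top of `10^9`, which `10^11` absorbs.
  refine ⟨10 ^ 11, 1 / 200, 2, by norm_num, by norm_num, by norm_num, ?_⟩
  intro S A _ _ _ Pi hPi γ ε δ D hε hδ0 hδ1 hD
  have hg := VRCPI.one_sub_pos γ
  have hg1 : 1 - (γ : ℝ) ≤ 1 := sub_le_self _ γ.2.1
  have ha := VRCPI.one_le_card (A := A)
  have ha0 := VRCPI.card_pos_real (A := A)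
  have hc : 0 < 1 / 200 * (ε * (1 - (γ : ℝ)) ^ 3 / (Fintype.card A * D)) := by positivity
  have hN : (1 : ℝ) ≤ VRCPI.covNum Pi ε := Nat.one_le_cast.2 (VRCPI.one_le_covNum hPi hε)
  have hN' : (1 : ℝ) ≤ VRCPI.covNum Pi
      (1 / 200 * (ε * (1 - (γ : ℝ)) ^ 3 / (Fintype.card A * D))) :=
    Nat.one_le_cast.2 (VRCPI.one_le_covNum hPi hc)
  have hℓ := VRCPI.two_thirds_le_log hδ0 hδ1 hN
  have hℓ' := VRCPI.two_thirds_le_log hδ0 hδ1 hN'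
  have hlen : ∀ (M : VRCPI.MDP S A) (μ : PMF S) (η lam : unitInterval)
      (erm : VRCPI.Dataset S A → VRCPI.Policy S A) (π₁ : VRCPI.Policy S A) (T i : ℕ),
      ∑' σ, VRCPI.run M γ η lam erm μ π₁ T σ * ((σ.lens.getD i 0 : ℕ) : ENNReal) ≤
        ENNReal.ofReal (10 ^ 11 / (1 - (γ : ℝ))) := by
    intro M μ η lam erm π₁ T i
    refine (VRCPI.lexp_run_lens_le M γ μ η lam erm π₁ T i).trans ?_
    rw [← ENNReal.ofReal_ofNat 5, ← ENNReal.ofReal_mul (by norm_num)]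
    refine ENNReal.ofReal_le_ofReal ?_
    rw [mul_one_div]
    gcongr
    norm_num
  set X := (Fintype.card A : ℝ) ^ 3 * D ^ 3 / ((1 - (γ : ℝ)) ^ 9 * ε ^ 3)
  set L := Real.log (2 + Fintype.card A * D / ((1 - (γ : ℝ)) ^ 2 * ε)) with hL
  have hX0 : 0 ≤ X := by positivity
  -- Below the range of the value function the parameter choice applies. Otherwise every policy is
  -- accurate enough, and one iteration with `η = λ = 0` satisfies the coupling trivially.
  by_cases hεg : ε * (1 - (γ : ℝ)) < 1
  · have hL1 : 1 ≤ L := VRCPI.one_le_log_ratio ha hD hε hg hg1 hεg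
    obtain ⟨η, lam, T, hη, hlam, hT, hd, hunion, hbudget, hcount⟩ :=
      VRCPI.exists_parameters ha hD hε hg hg1 hεg hδ0 hδ1 hN'
    obtain ⟨W, hWcard, hW⟩ := VRCPI.exists_cover hPi hc
    refine ⟨η, lam, T, fun M μ πstar _ hmis erm herm π₁ hπ₁ => ⟨?_, ?_, ?_, hlen M μ η lam erm π₁ T⟩⟩
    · refine VRCPI.success_probability M γ μ η lam erm π₁ hlam hη hc.le herm hπ₁ hT W
        (by positivity) (by positivity) hW hd (le_trans ?_ hunion) (by positivity) hmis hbudget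
      gcongr
    · intro σ hσ
      rw [(VRCPI.reachable_run M γ μ η lam erm π₁ hlam (fun D => (herm D).1) hπ₁ T σ hσ).lens]
      push_cast
      refine hcount.trans ?_
      rw [← hL]
      have h1 : L ≤ L ^ 2 := le_self_pow₀ hL1 two_ne_zero
      gcongr <;> norm_num
    · intro κ hκ hscale σ hσ
      rw [(VRCPI.reachable_run M γ μ η lam erm π₁ hlam (fun D => (herm D).1) hπ₁ T σ hσ).lens]
      push_cast
      refine hcount.trans ?_
      have hle : 1 / 200 * (ε * (1 - (γ : ℝ)) ^ 3 / (Fintype.card A * D)) ≤ ε := by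
        have h1 : (1 - (γ : ℝ)) ^ 3 ≤ 1 := pow_le_one₀ hg.le hg1
        have h2 : ε * (1 - (γ : ℝ)) ^ 3 / (Fintype.card A * D) ≤ ε * (1 - (γ : ℝ)) ^ 3 :=
          div_le_self (by positivity) (one_le_mul_of_one_le_of_one_le ha hD)
        have h3 : ε * (1 - (γ : ℝ)) ^ 3 ≤ ε := mul_le_of_le_one_right hε.le h1
        linarith
      have h1 := VRCPI.log_covering_le ha hD hε hg hg1 hεg hδ0 hδ1 hN hN' hκ (hscale _ hc hle)
      rw [← hL] at h1 ⊢
      have h2 := mul_le_mul_of_nonneg_left h1 hX0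
      have h3 := mul_le_mul_of_nonneg_right h2 (zero_le_one.trans hL1)
      have h4 : 0 ≤ κ * X * Real.log (2 * VRCPI.covNum Pi ε / δ) * L ^ 2 := by positivity
      have e : X * (30 * κ * L * Real.log (2 * VRCPI.covNum Pi ε / δ)) * L =
          30 * (κ * X * Real.log (2 * VRCPI.covNum Pi ε / δ) * L ^ 2) := by ring
      rw [e] at h3
      linarith
  · have hε1 : 1 / (1 - (γ : ℝ)) ≤ ε := (div_le_iff₀ hg).2 (not_lt.1 hεg)
    have hL0 : 0 ≤ L := Real.log_nonneg (by
      have : 0 ≤ Fintype.card A * D / ((1 - (γ : ℝ)) ^ 2 * ε) := by positivity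
      linarith)
    refine ⟨0, 0, 1, fun M μ πstar _ _ erm herm π₁ hπ₁ => ⟨?_, ?_, ?_, hlen M μ 0 0 erm π₁ 1⟩⟩
    · exact VRCPI.success_of_large_accuracy M γ μ hδ0 hε1 (fun D => (herm D).1) hπ₁ πstar
    · intro σ hσ
      rw [(VRCPI.reachable_run M γ μ 0 0 erm π₁ (by simp) (fun D => (herm D).1) hπ₁ 1 σ hσ).lens]
      have h4 : 0 ≤ X * Real.log (2 * VRCPI.covNum Pi
        (1 / 200 * (ε * (1 - (γ : ℝ)) ^ 3 / (Fintype.card A * D))) / δ) * L ^ 2 := by positivity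
      push_cast
      linarith
    · intro κ hκ _ σ hσ
      rw [(VRCPI.reachable_run M γ μ 0 0 erm π₁ (by simp) (fun D => (herm D).1) hπ₁ 1 σ hσ).lens]
      have h4 : 0 ≤ κ * X * Real.log (2 * VRCPI.covNum Pi ε / δ) * L ^ 2 := by positivity
      push_cast
      linarith
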